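/- **Setting.** Let $M\ge 5$, $T\ge 5$, $H\ge 1$, $1\le k\le d$, $\delta\in(0,1)$, and write $[n]=\{1,\dots,n\}$. Let $\mathcal M^1,\dots,\mathcal M^M$ be episodic MDPs with horizon $H$ on common state and action spaces $\mathcal S,\mathcal A$; for task $i$ at step $h$, playing $a$ in state $s$ yields a random reward $R_h^i(s,a)$ with mean $r_h^i(s,a)$ and a next state $s'\sim p_h^i(\cdot\mid s,a)$. For a deterministic policy $\pi$ let $Q_h^{i,\pi}(s,a)=r_h^i(s,a)+\mathbb E\big[\sum_{j=h+1}^H R^i_j(s_j,\pi_j(s_j))\big]$, $V_h^{i,\pi}(s)=Q_h^{i,\pi}(s,\pi_h(s))$ and $V_h^{i*}=\sup_\pi V_h^{i,\pi}$. Let $\mathcal T_h^i(Q)(s,a)=r_h^i(s,a)+\mathbb E_{s'\sim p_h^i(\cdot\mid s,a)}\max_{a'}Q(s',a')$ be the Bellman optimality operator. Let $\phi_h:\mathcal S\times\mathcal A\to\mathbb R^d$ be feature maps (known to the learner), $Q_h(\theta)(s,a)=\phi_h(s,a)^\top\theta$, $V_h(\theta)(s)=\max_a\phi_h(s,a)^\top\theta$,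 and let $\Theta_h^{i\prime}\subseteq\mathbb R^d$ be given parameter sets. The joint class is $$\Theta_h=\{(Bw^1,\dots,Bw^M): B\in\mathbb R^{d\times k},\ B^\top B=I,\ \|w^i\|_2\le 1,\ Bw^i\in\Theta_h^{i\prime}\}\quad(h\in[H]),\qquad \Theta_{H+1}=\{0\},$$ and the low-rank inherent Bellman error, assumed finite, is $$\mathcal I=\sup_{h\in[H]}\ \sup_{\theta'\in\Theta_{h+1}}\ \inf_{\theta\in\Theta_h}\ \sup_{s,a,i}\big|Q_h(\theta^i)(s,a)-\mathcal T_h^i\big(Q_{h+1}(\theta'^i)\big)(s,a)\big|.$$ **Assumptions.** For all $h\in[H]$, $i\in[M]$, $(s,a)$: (i) $\|\phi_h(s,a)\|_2\le1$; (ii) $0\le Q_h^{i,\pi}(s,a)\le 1$ for every policy $\pi$; (iii) there is a constant $D$ with $\|\theta^i\|_2\le D$ for all $\theta\in\Theta_h$; (iv) for every $\theta\in\Theta_{h+1}$ the noise $R_h^i(s,a)+V_{h+1}(\theta^i)(s')-\mathcal T_h^i(Q_{h+1}(\theta^i))(s,a)$ lies in $[-1,1]$ almost surely; and, given all that has been observed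 up to the actions of step $h$ of an episode, the pairs (reward, next state) of the $M$ tasks at this step are independent and follow the laws of the $M$ MDPs. Initial states $s_{1t}^i$ of the episodes are arbitrary (they may be random or depend on the past). **Algorithm (MTLR-LSVI).** Put $\lambda=1$ and $\alpha=\big(2\sqrt{MT}\,\mathcal I+2F^1+\sqrt{2F^2+4MD^2\lambda}\big)^2$, where $$F^1=\sqrt{9kd\log(kMT)+5Mk\log(MT)+2\log(2/\delta)},$$ $$F^2=\sqrt{4kd\log(kMT)+5Mk\log(MT)+2\log(2/\delta)}+\sqrt{k+5kd\log(kMT)+2Mk\log(MT)+\log(2/\delta)}.$$ With $\phi_{hj}^i=\phi_h(s_{hj}^i,a_{hj}^i)$ and $\tilde V_{ht}^i=\sum_{j<t}\phi_{hj}^i(\phi_{hj}^i)^\top+\lambda I$, in episode $t$ the learner maximizes $\sum_{i}\max_a\phi_1(s_{1t}^i,a)^\top\bar\theta_1^i$ over $(\bar\xi_h^i,\hat\theta_h^i,\bar\theta_h^i)_{h\in[H],i\in[M]}$, with $\bar\theta_{H+1}^i=0$, subject to, for all $h\in[H]$: $\hat\theta_h$ minimizes $$\sum_{i=1}^M\sum_{j<t}\big((\phi_{hj}^i)^\top\theta^i-R_{hj}^i-V_{h+1}(\bar\theta_{h+1}^i)(s_{h+1,j}^i)\big)^2$$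 over all tuples $(\theta^1,\dots,\theta^M)=(Bw^1,\dots,Bw^M)$ with $B\in\mathbb R^{d\times k}$, $w^i\in\mathbb R^k$, $\|Bw^i\|_2\le D$; $\bar\theta_h^i=\hat\theta_h^i+\bar\xi_h^i$; $\sum_i(\bar\xi_h^i)^\top\tilde V_{ht}^i\,\bar\xi_h^i\le\alpha$; and $(\bar\theta_h^1,\dots,\bar\theta_h^M)\in\Theta_h$. It then executes in each task $i$ a greedy policy $\pi_{ht}^i(s)\in\arg\max_a\phi_h(s,a)^\top\bar\theta_{ht}^i$ for the solution $\bar\theta_{ht}$ found. (If the constraints cannot be satisfied in an episode, $\bar\theta_{ht}$ is arbitrary.) **Theorem.** For every $D$ there are constants $C>0$ and $p\in\mathbb N$, depending only on $D$, such that in the above setting, for every run of MTLR-LSVI, with probability at least $1-\delta$, $$\sum_{t=1}^T\sum_{i=1}^M\big(V_1^{i*}-V_1^{i,\pi_t^i}\big)(s_{1t}^i)\ \le\ C\,\log^p\!\Big(\frac{dMHT}{\delta}\Big)\Big(HM\sqrt{dkT}+Hd\sqrt{kMT}+HMT\sqrt d\;\mathcal I\Big).$$ -/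

import Mathlib

open MeasureTheory ProbabilityTheory
open scoped ENNReal Matrix

noncomputable section

namespace MTRL

/-- An episodic MDP, steps numbered `0, 1, 2, …` (an episode of horizon `H` uses the steps `h < H`).
`step h (s, a)` is the joint law of the random reward `R_h(s, a)` and the next state. -/
structure EpisodicMDP (S A : Type*) [MeasurableSpace S] [MeasurableSpace A] where
  step : ℕ → Kernel (S × A) (ℝ × S)
  markov : ∀ h, IsMarkovKernel (step h)
  integrable_reward : ∀ h x, Integrable Prod.fst (step h x)

/-- A deterministic (Markov, step-dependent) policy. -/
structure Policy (S A : Type*) [MeasurableSpace S] [MeasurableSpace A] where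
  act : ℕ → S → A
  measurable_act : ∀ h, Measurable (act h)

section MDP

variable {S A : Type*} [MeasurableSpace S] [MeasurableSpace A]

namespace EpisodicMDP

/-- The mean reward `r_h(s, a)`. -/
def reward (m : EpisodicMDP S A) (h : ℕ) (s : S) (a : A) : ℝ :=
  ∫ y, y.1 ∂(m.step h (s, a))

/-- The transition kernel `p_h(· | s, a)`. -/
def trans (m : EpisodicMDP S A) (h : ℕ) : Kernel (S × A) S :=
  (m.step h).snd

/-- The law of the state `s_{h+1+n}` when the agent starts from the state `s` at step `h`, plays `a`
at step `h`, and follows the policy `π` from step `h + 1` on. -/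
def stateLaw (m : EpisodicMDP S A) (π : Policy S A) (h : ℕ) (s : S) (a : A) : ℕ → Measure S
  | 0 => m.trans h (s, a)
  | n + 1 => (stateLaw m π h s a n).bind fun x => m.trans (h + n + 1) (x, π.act (h + n + 1) x)

/-- The action value `Q_h^π(s, a) = r_h(s, a) + 𝔼 [∑_{h < j < H} R_j(s_j, π_j(s_j))]`. -/
def qPol (m : EpisodicMDP S A) (H : ℕ) (π : Policy S A) (h : ℕ) (s : S) (a : A) : ℝ :=
  m.reward h s a + ∑ n ∈ Finset.range (H - h - 1),
    ∫ x, m.reward (h + n + 1) x (π.act (h + n + 1) x) ∂(m.stateLaw π h s a n)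

/-- The state value `V_h^π(s) = Q_h^π(s, π_h(s))`. -/
def vPol (m : EpisodicMDP S A) (H : ℕ) (π : Policy S A) (h : ℕ) (s : S) : ℝ :=
  m.qPol H π h s (π.act h s)

/-- The optimal state value `V_h^*(s) = sup_π V_h^π(s)`. -/
def vStar (m : EpisodicMDP S A) (H : ℕ) (h : ℕ) (s : S) : ℝ :=
  ⨆ π : Policy S A, m.vPol H π h s

/-- The Bellman optimality operator
`𝒯_h(Q)(s, a) = r_h(s, a) + 𝔼_{s' ∼ p_h(· | s, a)} [max_{a'} Q(s', a')]`. -/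
def bellman (m : EpisodicMDP S A) (h : ℕ) (Q : S → A → ℝ) (s : S) (a : A) : ℝ :=
  m.reward h s a + ∫ s', (⨆ a', Q s' a') ∂(m.trans h (s, a))

end EpisodicMDP

end MDP

/-- The multi-task data: `M` MDPs on the same states and actions, the feature maps
`φ_h : S × A → ℝ^d`, and the single-task parameter sets `Θ_h^{i'}`. The last two fields say that the
features and the functions `s ↦ max_a φ_h(s, a)ᵀ θ` are measurable. -/
structure MultiTask (S A : Type*) [MeasurableSpace S] [MeasurableSpace A] (M d : ℕ) where
  mdp : Fin M → EpisodicMDP S A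
  φ : ℕ → S → A → EuclideanSpace ℝ (Fin d)
  paramSet : ℕ → Fin M → Set (EuclideanSpace ℝ (Fin d))
  measurable_φ : ∀ h, Measurable fun x : S × A => φ h x.1 x.2
  measurable_max : ∀ h (θ : EuclideanSpace ℝ (Fin d)), Measurable fun s => ⨆ a, inner ℝ (φ h s a) θ

/-- One parameter vector in `ℝ^d` for each of the `M` tasks. -/
abbrev Params (M d : ℕ) : Type := Fin M → EuclideanSpace ℝ (Fin d)

/-- `‖x‖²_V = xᵀ V x`. -/
def mahalanobisSq {d : ℕ} (V : Matrix (Fin d) (Fin d) ℝ) (x : EuclideanSpace ℝ (Fin d)) : ℝ :=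
  x.ofLp ⬝ᵥ (V *ᵥ x.ofLp)

section Radius

/-- The first confidence width `F_h^1`. -/
def widthOne (M d k T : ℕ) (δ : ℝ) : ℝ :=
  √(9 * k * d * Real.log (k * M * T) + 5 * M * k * Real.log (M * T) + 2 * Real.log (2 / δ))

/-- The second confidence width `F_h^2`. -/
def widthTwo (M d k T : ℕ) (δ : ℝ) : ℝ :=
  √(4 * k * d * Real.log (k * M * T) + 5 * M * k * Real.log (M * T) + 2 * Real.log (2 / δ)) +
  √(k + 5 * k * d * Real.log (k * M * T) + 2 * M * k * Real.log (M * T) + Real.log (2 / δ))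

/-- The confidence radius `α_{ht}` with regularization `λ = 1`. It does not depend on `h`, `t`. -/
def radius (M d k T : ℕ) (D I δ : ℝ) : ℝ :=
  (2 * √(M * T) * I + 2 * widthOne M d k T δ + √(2 * widthTwo M d k T δ + 4 * M * D ^ 2)) ^ 2

end Radius

namespace MultiTask

variable {S A : Type*} [MeasurableSpace S] [MeasurableSpace A] {M d : ℕ}

/-- `Q_h(θ)(s, a) = φ_h(s, a)ᵀ θ`. -/
def qLin (E : MultiTask S A M d) (h : ℕ) (θ : EuclideanSpace ℝ (Fin d)) (s : S) (a : A) : ℝ :=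
  inner ℝ (E.φ h s a) θ

/-- `V_h(θ)(s) = max_a φ_h(s, a)ᵀ θ`. -/
def vLin (E : MultiTask S A M d) (h : ℕ) (θ : EuclideanSpace ℝ (Fin d)) (s : S) : ℝ :=
  ⨆ a, E.qLin h θ s a

/-- The joint parameter class `Θ_h`: tuples `(B w¹, …, B w^M)` with `B` a `d × k` matrix with
orthonormal columns, `w^i` in the closed unit ball of `ℝ^k`, and `B w^i ∈ Θ_h^{i'}`.
After the last step, only the zero parameters are left. -/
def jointClass (E : MultiTask S A M d) (k H h : ℕ) : Set (Params M d) :=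
  if h < H then
    {θ | ∃ (B : Matrix (Fin d) (Fin k) ℝ) (w : Fin M → EuclideanSpace ℝ (Fin k)),
      Bᵀ * B = 1 ∧ ∀ i, ‖w i‖ ≤ 1 ∧ θ i = WithLp.toLp 2 (B *ᵥ (w i).ofLp) ∧ θ i ∈ E.paramSet h i}
  else {0}

/-- The low-rank inherent Bellman error `𝓘 = sup_{h < H} 𝓘_h^mul`, where
`𝓘_h^mul = sup_{Q_{h+1} ∈ 𝒬_{h+1}} inf_{Q_h ∈ 𝒬_h} sup_{s, a, i} |(Q_h^i - 𝒯_h^i Q_{h+1}^i)(s, a)|`. -/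
def bellmanError (E : MultiTask S A M d) (k H : ℕ) : ℝ≥0∞ :=
  ⨆ h ∈ Finset.range H, ⨆ θ' ∈ E.jointClass k H (h + 1), ⨅ θ ∈ E.jointClass k H h,
    ⨆ (i : Fin M) (s : S) (a : A),
      ENNReal.ofReal |E.qLin h (θ i) s a - (E.mdp i).bellman h (E.qLin (h + 1) (θ' i)) s a|

/-- The regularity assumptions on the scale of the problem. -/
structure Regular (E : MultiTask S A M d) (k H : ℕ) (D : ℝ) : Prop where
  norm_feature : ∀ h < H, ∀ s a, ‖E.φ h s a‖ ≤ 1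
  value_mem : ∀ i, ∀ h < H, ∀ (π : Policy S A) s a, (E.mdp i).qPol H π h s a ∈ Set.Icc (0 : ℝ) 1
  norm_param : ∀ h < H, ∀ θ ∈ E.jointClass k H h, ∀ i, ‖θ i‖ ≤ D
  noise_bound : ∀ h < H, ∀ θ ∈ E.jointClass k H (h + 1), ∀ i s a,
    ∀ᵐ y ∂((E.mdp i).step h (s, a)),
      |y.1 + E.vLin (h + 1) (θ i) y.2 - (E.mdp i).bellman h (E.qLin (h + 1) (θ i)) s a| ≤ 1

/-- What is observed: `s j h i`, `a j h i`, `R j h i` are the state, action and reward of task `i` at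
step `h` of episode `j` (episodes are numbered `0, 1, 2, …`, and `s j H i` is the final state). -/
structure Data (S A : Type*) (M : ℕ) where
  s : ℕ → ℕ → Fin M → S
  a : ℕ → ℕ → Fin M → A
  R : ℕ → ℕ → Fin M → ℝ

/-- The regularized design matrix `Ṽ_{ht}^i(λ) = ∑_{j < t} φ_{hj}^i (φ_{hj}^i)ᵀ + λ I`, `λ = 1`. -/
def design (E : MultiTask S A M d) (x : Data S A M) (t h : ℕ) (i : Fin M) :
    Matrix (Fin d) (Fin d) ℝ :=
  ∑ j ∈ Finset.range t,
    Matrix.vecMulVec (E.φ h (x.s j h i) (x.a j h i)).ofLp (E.φ h (x.s j h i) (x.a j h i)).ofLp + 1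

/-- The empirical least-squares loss at step `h` of the parameters `θ`, with regression targets
`R_{hj}^i + V_{h+1}(θ'^i)(s_{h+1,j}^i)`. -/
def loss (E : MultiTask S A M d) (x : Data S A M) (t h : ℕ) (θ' θ : Params M d) : ℝ :=
  ∑ i, ∑ j ∈ Finset.range t,
    (E.qLin h (θ i) (x.s j h i) (x.a j h i) - x.R j h i
      - E.vLin (h + 1) (θ' i) (x.s j (h + 1) i)) ^ 2

end MultiTask

/-- The parameters over which the least-squares loss is minimized: `(B w¹, …, B w^M)` with
`B ∈ ℝ^{d × k}` and `‖B w^i‖ ≤ D`. -/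
def lowRankClass (M d k : ℕ) (D : ℝ) : Set (Params M d) :=
  {θ | ∃ (B : Matrix (Fin d) (Fin k) ℝ) (w : Fin M → EuclideanSpace ℝ (Fin k)),
    ∀ i, θ i = WithLp.toLp 2 (B *ᵥ (w i).ofLp) ∧ ‖θ i‖ ≤ D}

namespace MultiTask

variable {S A : Type*} [MeasurableSpace S] [MeasurableSpace A] {M d : ℕ}

/-- The constraints of the global optimization program of episode `t` (there are `t` earlier
episodes), on variables `ξ = ξ̄`, `θh = θ̂`, `θb = θ̄`. -/
structure Feasible (E : MultiTask S A M d) (k H : ℕ) (D α : ℝ) (x : Data S A M) (t : ℕ)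
    (ξ θh θb : ℕ → Params M d) : Prop where
  terminal : θb H = 0
  mem_lowRank : ∀ h < H, θh h ∈ lowRankClass M d k D
  least_squares : ∀ h < H, ∀ θ ∈ lowRankClass M d k D,
    E.loss x t h (θb (h + 1)) (θh h) ≤ E.loss x t h (θb (h + 1)) θ
  bonus : ∀ h < H, ∀ i, θb h i = θh h i + ξ h i
  confidence : ∀ h < H, ∑ i, mahalanobisSq (E.design x t h i) (ξ h i) ≤ α
  mem_class : ∀ h < H, θb h ∈ E.jointClass k H h

/-- The objective of the program of episode `t`: `∑_i max_a φ(s_1^i, a)ᵀ θ̄_1^i`. -/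
def objective (E : MultiTask S A M d) (x : Data S A M) (t : ℕ) (θb : ℕ → Params M d) : ℝ :=
  ∑ i, E.vLin 0 (θb 0 i) (x.s t 0 i)

/-- `θb` is the `θ̄`-part of a solution of the global optimization program of episode `t`. -/
def Solves (E : MultiTask S A M d) (k H : ℕ) (D α : ℝ) (x : Data S A M) (t : ℕ)
    (θb : ℕ → Params M d) : Prop :=
  (∃ ξ θh, E.Feasible k H D α x t ξ θh θb) ∧
    ∀ ξ' θh' θb', E.Feasible k H D α x t ξ' θh' θb' → E.objective x t θb' ≤ E.objective x t θb

/-- A run of MTLR-LSVI with confidence radius `α` for `T` episodes on the probability space `(Ω, P)`.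
`𝓕 t h` is the information available at step `h` of episode `t` once the states and actions of that
step are known, but not its rewards. The initial states of each episode are arbitrary, possibly
random or chosen adaptively. -/
structure Run (E : MultiTask S A M d) (k H T : ℕ) (D α : ℝ)
    {Ω : Type*} [mΩ : MeasurableSpace Ω] (P : Measure Ω) where
  data : Ω → Data S A M
  θb : ℕ → Ω → ℕ → Params M d
  pol : ℕ → Fin M → Ω → Policy S A
  𝓕 : ℕ → ℕ → MeasurableSpace Ω
  le_space : ∀ t h, 𝓕 t h ≤ mΩ
  mono_step : ∀ t h, 𝓕 t h ≤ 𝓕 t (h + 1)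
  mono_episode : ∀ t, 𝓕 t H ≤ 𝓕 (t + 1) 0
  measurable_state : ∀ t < T, ∀ h ≤ H, ∀ i, Measurable[𝓕 t h] fun ω => (data ω).s t h i
  measurable_action : ∀ t < T, ∀ h < H, ∀ i, Measurable[𝓕 t h] fun ω => (data ω).a t h i
  measurable_reward : ∀ t < T, ∀ h < H, ∀ i, Measurable[𝓕 t (h + 1)] fun ω => (data ω).R t h i
  measurable_param : ∀ t < T, ∀ h ≤ H, ∀ i, Measurable[𝓕 t 0] fun ω => θb t ω h i
  measurable_pol : ∀ t < T, ∀ h, ∀ i,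
    Measurable[(𝓕 t 0).prod inferInstance] fun z : Ω × S => (pol t i z.1).act h z.2
  /-- Given the past, the rewards and next states of the `M` tasks are independent and follow the
  laws of the `M` MDPs. -/
  transition : ∀ t < T, ∀ h < H, ∀ U : Fin M → Set (ℝ × S), (∀ i, MeasurableSet (U i)) →
    P⟦{ω | ∀ i, ((data ω).R t h i, (data ω).s t (h + 1) i) ∈ U i} | 𝓕 t h⟧ =ᵐ[P]
      fun ω => ∏ i, ((E.mdp i).step h ((data ω).s t h i, (data ω).a t h i)).real (U i)
  /-- In each episode the parameters `θ̄` solve the global optimization program, if its constraints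
  can be satisfied at all; otherwise they are arbitrary. -/
  solves : ∀ t < T, ∀ ω, (∃ ξ θh θb', E.Feasible k H D α (data ω) t ξ θh θb') →
    E.Solves k H D α (data ω) t (θb t ω)
  /-- The policies are greedy: `π_{ht}^i(s) ∈ argmax_a φ_h(s, a)ᵀ θ̄_{ht}^i`. -/
  greedy : ∀ t < T, ∀ i ω, ∀ h < H, ∀ s a,
    E.qLin h (θb t ω h i) s a ≤ E.qLin h (θb t ω h i) s ((pol t i ω).act h s)
  /-- The greedy policies are executed. -/
  executes : ∀ t < T, ∀ i ω, ∀ h < H,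
    (data ω).a t h i = (pol t i ω).act h ((data ω).s t h i)

/-- The regret `∑_{t ≤ T} ∑_{i ≤ M} (V_1^{i*} - V_1^{π_t^i})(s_{1t}^i)`. -/
def Run.regret {E : MultiTask S A M d} {k H T : ℕ} {D α : ℝ} {Ω : Type*} [MeasurableSpace Ω]
    {P : Measure Ω} (r : E.Run k H T D α P) (ω : Ω) : ℝ :=
  ∑ t ∈ Finset.range T, ∑ i, ((E.mdp i).vStar H 0 ((r.data ω).s t 0 i)
    - (E.mdp i).vPol H (r.pol t i ω) 0 ((r.data ω).s t 0 i))

end MultiTask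

end MTRL

end

/-!
The regret bound is proved by optimism in the face of uncertainty. The first two ingredients are
of a statistical nature, the last two are deterministic.

* *Accuracy of the regressions* (`Run.measure_not_accurate_le`). For parameters `θ'` of the next
  step, a member `θ` of `Θ_h` satisfies the Bellman equation up to the inherent Bellman error, so
  the regression targets are the predictions of `θ`, plus a small bias, plus noise. The class
  `{(B w¹, …, B w^M)}` has only `d k + M k` degrees of freedom, so finite nets for `θ'` and for the
  least-squares estimate have logarithmic size of order `(d k + M k) log (M T)` (`exists_net`,
  `entropy_le_widthOne_sq`). At fixed points of the nets the noise has conditionally subgaussian,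
  conditionally independent terms, so its exponential moments can be multiplied up
  (`Run.lintegral_prod_prod_le_one`, `Run.measure_noise_gt_le`). The basic inequality of least
  squares bounds the squared prediction error `X²` by the noise in the direction of the error plus
  `b X`, where `b` is of order `1` plus `√(M T)` times the Bellman error. Usually the scale of `X` in the
  exponential martingale calls for a self-normalized bound; here the deterministic parameter
  `F / (b + 2 F)` gives `X ≤ b + 2 F` directly (`le_of_quadratic`, `sqrt_sum_sq_le`).

* *Martingale terms* (`Run.measure_gapNoise_sum_gt_le`). For each step `h`, the deviations of the
  overestimated values at the next states from their conditional means are summed over episodes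
  and tasks, and bounded by Azuma's inequality.

* *Optimism* (`exists_feasible`, `vStar_le`). If all regressions are accurate, the backward
  recursion through nearly Bellman-optimal members of `Θ_h` is feasible for the program of each
  episode. So the optimum of the program is at least the sum of the optimal values, up to `H`
  times the bias, and the regret is at most the sum of the overestimations `V_1(θ̄) - V_1^π`,
  plus this bias.

* *Decomposition* (`Run.regret_le`). Along an episode the overestimation telescopes into the
  Bellman residuals of `θ̄` at the visited state-action pairs and the martingale terms. Each
  residual is a prediction of parameters in an ellipsoid of squared radius `4 α`, up to the bias;
  Cauchy–Schwarz and the elliptical potential lemma (`sum_qLin_le`) bound their sum.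

Inserting the confidence radius gives the three summands of the bound (`regret_bound_le`). The
entropy estimate needs `T` to be at least `H² d k` and at least a constant depending on `D`.
Otherwise the claimed bound exceeds `M T`, which bounds the regret since all values lie in
`[0, 1]` (`card_le_of_lt`, `Run.regret_le_card`).
-/

namespace MTRL

/-! ### Dynamic programming -/

lemma abs_integral_le_of_forall {X : Type*} [MeasurableSpace X] {μ : Measure X}
    [IsProbabilityMeasure μ] {f : X → ℝ} {c : ℝ} (h : ∀ x, |f x| ≤ c) : |∫ x, f x ∂μ| ≤ c := by
  simpa using norm_integral_le_of_norm_le_const (μ := μ) (f := f) (C := c) (.of_forall h)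

namespace EpisodicMDP

variable {S A : Type*} [MeasurableSpace S] [MeasurableSpace A]

instance (m : EpisodicMDP S A) (h : ℕ) : IsMarkovKernel (m.step h) := m.markov h

instance (m : EpisodicMDP S A) (h : ℕ) : IsMarkovKernel (m.trans h) := by
  unfold trans; infer_instance

lemma integral_trans (m : EpisodicMDP S A) (h : ℕ) (x : S × A) {f : S → ℝ} (hf : Measurable f) :
    ∫ s, f s ∂(m.trans h x) = ∫ y, f y.2 ∂(m.step h x) := by
  rw [trans, Kernel.snd_apply, integral_map measurable_snd.aemeasurable hf.aestronglyMeasurable]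

lemma measurable_reward (m : EpisodicMDP S A) (h : ℕ) :
    Measurable fun x : S × A => m.reward h x.1 x.2 := by
  have h1 : StronglyMeasurable fun p : (S × A) × (ℝ × S) => p.2.1 :=
    (measurable_fst.comp measurable_snd).stronglyMeasurable
  exact (h1.integral_kernel_prod_right' (κ := m.step h)).measurable

lemma measurable_policy_pair (π : Policy S A) (h : ℕ) : Measurable fun x : S => (x, π.act h x) :=
  measurable_id.prodMk (π.measurable_act h)

/-- The kernel form of `stateLaw`: it makes the Chapman–Kolmogorov equation available. -/
noncomputable def stateKernel (m : EpisodicMDP S A) (π : Policy S A) (h : ℕ) :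
    ℕ → Kernel (S × A) S
  | 0 => m.trans h
  | n + 1 => ((m.trans (h + n + 1)).comap _ (measurable_policy_pair π (h + n + 1))) ∘ₖ
      stateKernel m π h n

instance (m : EpisodicMDP S A) (π : Policy S A) (h n : ℕ) :
    IsMarkovKernel (m.stateKernel π h n) := by
  induction n with
  | zero => unfold stateKernel; infer_instance
  | succ n ih => unfold stateKernel; infer_instance

lemma stateLaw_eq (m : EpisodicMDP S A) (π : Policy S A) (h : ℕ) (s : S) (a : A) (n : ℕ) :
    m.stateLaw π h s a n = m.stateKernel π h n (s, a) := by
  induction n with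
  | zero => rfl
  | succ n ih => rw [stateLaw, ih, stateKernel, Kernel.comp_apply]; rfl

lemma comap_comp_eq {X Y Z W : Type*} [MeasurableSpace X] [MeasurableSpace Y] [MeasurableSpace Z]
    [MeasurableSpace W] (η : Kernel Y Z) (κ : Kernel X Y) {g : W → X} (hg : Measurable g) :
    (η ∘ₖ κ).comap g hg = η ∘ₖ κ.comap g hg := by
  ext w : 1
  simp [Kernel.comp_apply, Kernel.comap_apply]

/-- Chapman–Kolmogorov: the first step may be split off instead of the last one. -/
lemma stateKernel_succ (m : EpisodicMDP S A) (π : Policy S A) (h n : ℕ) :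
    m.stateKernel π h (n + 1) =
      ((m.stateKernel π (h + 1) n).comap _ (measurable_policy_pair π (h + 1))) ∘ₖ m.trans h := by
  induction n with
  | zero => rfl
  | succ n ih =>
    rw [stateKernel, ih, ← Kernel.comp_assoc, ← comap_comp_eq, stateKernel]
    have e : h + (n + 1) + 1 = h + 1 + n + 1 := by omega
    simp only [e]

/-- The Bellman equation, given that the later rewards are bounded. -/
lemma qPol_eq_of_reward (m : EpisodicMDP S A) {H h : ℕ} (hH : h + 1 < H) (π : Policy S A)
    (hb : ∀ j, h < j → j < H → ∀ s a, |m.reward j s a| ≤ 1) (s : S) (a : A) :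
    m.qPol H π h s a = m.reward h s a + ∫ x, m.vPol H π (h + 1) x ∂(m.trans h (s, a)) := by
  have hmeas : ∀ j, Measurable fun x : S => m.reward j x (π.act j x) := fun j =>
    (m.measurable_reward j).comp (measurable_policy_pair π j)
  have hint : ∀ j, h < j → j < H → ∀ (μ : Measure S) [IsProbabilityMeasure μ],
      Integrable (fun x => m.reward j x (π.act j x)) μ := fun j h1 h2 μ _ =>
    Integrable.of_bound (hmeas j).aestronglyMeasurable 1 (.of_forall fun x => hb j h1 h2 _ _)
  obtain ⟨N, hN⟩ : ∃ N, H - h - 1 = N + 1 := ⟨H - h - 2, by omega⟩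
  have hN' : H - (h + 1) - 1 = N := by omega
  have hsum : ∀ n ∈ Finset.range N, Integrable (fun x : S => ∫ y,
      m.reward (h + 1 + n + 1) y (π.act (h + 1 + n + 1) y)
        ∂(m.stateLaw π (h + 1) x (π.act (h + 1) x) n)) (m.trans h (s, a)) := by
    intro n hn
    rw [Finset.mem_range] at hn
    refine Integrable.of_bound (C := 1) ?_ (.of_forall fun x => ?_)
    · simp_rw [stateLaw_eq]
      have : StronglyMeasurable fun p : (S × A) × S =>
          m.reward (h + 1 + n + 1) p.2 (π.act (h + 1 + n + 1) p.2) :=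
        ((hmeas (h + 1 + n + 1)).comp measurable_snd).stronglyMeasurable
      have := this.integral_kernel_prod_right' (κ := m.stateKernel π (h + 1) n)
      exact (this.comp_measurable (measurable_policy_pair π (h + 1))).aestronglyMeasurable
    · rw [stateLaw_eq]
      exact abs_integral_le_of_forall fun y => hb _ (by omega) (by omega) _ _
  simp only [qPol, vPol, hN, hN']
  rw [Finset.sum_range_succ', integral_add (hint _ (by omega) (by omega) _)
    (integrable_finsetSum _ hsum), integral_finsetSum _ hsum]
  rw [add_comm (Finset.sum _ _)]
  congr 2
  refine Finset.sum_congr rfl fun n hn => ?_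
  rw [Finset.mem_range] at hn
  have e : h + (n + 1) + 1 = h + 1 + n + 1 := by omega
  rw [stateLaw_eq, stateKernel_succ, Kernel.integral_comp, e]
  · simp_rw [stateLaw_eq]; rfl
  · exact hint _ (by omega) (by omega) _

/-- Values in `[0, 1]` force mean rewards in `[-1, 1]`; the rewards themselves need not be bounded.
The policy only witnesses that there is one. -/
lemma abs_reward_le (m : EpisodicMDP S A) {H : ℕ} (π : Policy S A)
    (hv : ∀ h < H, ∀ (π : Policy S A) s a, m.qPol H π h s a ∈ Set.Icc (0 : ℝ) 1) :
    ∀ h < H, ∀ s a, |m.reward h s a| ≤ 1 := by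
  suffices h : ∀ n, ∀ h < H, H - h ≤ n → ∀ s a, |m.reward h s a| ≤ 1 from
    fun j hj => h _ j hj le_rfl
  intro n
  induction n with
  | zero => intro h hh h0; omega
  | succ n ih =>
    intro h hh hn s a
    have hq := hv h hh π s a
    by_cases hH : h + 1 < H
    · rw [m.qPol_eq_of_reward hH π (fun j h1 h2 => ih j h2 (by omega))] at hq
      have h0 : 0 ≤ ∫ x, m.vPol H π (h + 1) x ∂(m.trans h (s, a)) :=
        integral_nonneg fun x => (hv _ hH π _ _).1
      have h1 : ∫ x, m.vPol H π (h + 1) x ∂(m.trans h (s, a)) ≤ 1 := by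
        refine (le_abs_self _).trans (abs_integral_le_of_forall fun x => ?_)
        have := hv _ hH π x (π.act (h + 1) x)
        rw [abs_le]
        exact ⟨by simp only [vPol]; linarith [this.1], this.2⟩
      rw [abs_le]; constructor <;> linarith [hq.1, hq.2]
    · have e : H - h - 1 = 0 := by omega
      simp only [qPol, e, Finset.range_zero, Finset.sum_empty, add_zero] at hq
      rw [abs_le]; constructor <;> linarith [hq.1, hq.2]

lemma qPol_eq (m : EpisodicMDP S A) {H h : ℕ} (hH : h + 1 < H) (π : Policy S A)
    (hv : ∀ h < H, ∀ (π : Policy S A) s a, m.qPol H π h s a ∈ Set.Icc (0 : ℝ) 1) (s : S) (a : A) :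
    m.qPol H π h s a = m.reward h s a + ∫ x, m.vPol H π (h + 1) x ∂(m.trans h (s, a)) :=
  m.qPol_eq_of_reward hH π (fun j _ hj => m.abs_reward_le π hv j hj) s a

lemma qPol_last (m : EpisodicMDP S A) {H h : ℕ} (hH : h + 1 = H) (π : Policy S A) (s : S) (a : A) :
    m.qPol H π h s a = m.reward h s a := by
  have e : H - h - 1 = 0 := by omega
  simp [qPol, e]

/-- The values of a random policy are jointly measurable in the policy and the state. -/
lemma measurable_qPol (m : EpisodicMDP S A) {H : ℕ} {X : Type*} [MeasurableSpace X]
    (π : X → Policy S A) (hπ : ∀ h, Measurable fun z : X × S => (π z.1).act h z.2)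
    (hv : ∀ h < H, ∀ (π : Policy S A) s a, m.qPol H π h s a ∈ Set.Icc (0 : ℝ) 1) :
    ∀ h < H, Measurable fun z : X × (S × A) => m.qPol H (π z.1) h z.2.1 z.2.2 := by
  suffices h : ∀ n, ∀ h < H, H - h ≤ n →
      Measurable fun z : X × (S × A) => m.qPol H (π z.1) h z.2.1 z.2.2 from
    fun j hj => h _ j hj le_rfl
  intro n
  induction n with
  | zero => intro h hh h0; omega
  | succ n ih =>
    intro h hh hn
    have hr : Measurable fun z : X × (S × A) => m.reward h z.2.1 z.2.2 :=
      (m.measurable_reward h).comp measurable_snd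
    by_cases hH : h + 1 < H
    · simp_rw [m.qPol_eq hH _ hv]
      refine hr.add ?_
      have hm : Measurable fun p : (X × (S × A)) × S => m.vPol H (π p.1.1) (h + 1) p.2 := by
        have := ih (h + 1) hH (by omega)
        have h2 : Measurable fun p : (X × (S × A)) × S => (p.1.1, p.2, (π p.1.1).act (h + 1) p.2) :=
          measurable_fst.fst.prodMk (measurable_snd.prodMk
            ((hπ (h + 1)).comp (measurable_fst.fst.prodMk measurable_snd)))
        exact this.comp h2
      exact (hm.stronglyMeasurable.integral_kernel_prod_right'
        (κ := (m.trans h).comap Prod.snd measurable_snd)).measurable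
    · simp_rw [m.qPol_last (show h + 1 = H by omega)]
      exact hr

lemma measurable_vPol (m : EpisodicMDP S A) {H : ℕ} {X : Type*} [MeasurableSpace X]
    (π : X → Policy S A) (hπ : ∀ h, Measurable fun z : X × S => (π z.1).act h z.2)
    (hv : ∀ h < H, ∀ (π : Policy S A) s a, m.qPol H π h s a ∈ Set.Icc (0 : ℝ) 1) :
    ∀ h < H, Measurable fun z : X × S => m.vPol H (π z.1) h z.2 := fun h hh =>
  (m.measurable_qPol π hπ hv h hh).comp
    (measurable_fst.prodMk (measurable_snd.prodMk (hπ h)))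

lemma measurable_vPol_right (m : EpisodicMDP S A) {H : ℕ} (π : Policy S A)
    (hv : ∀ h < H, ∀ (π : Policy S A) s a, m.qPol H π h s a ∈ Set.Icc (0 : ℝ) 1) :
    ∀ h < H, Measurable (m.vPol H π h) := fun h hh =>
  (m.measurable_vPol (X := Unit) (fun _ => π) (fun h => (π.measurable_act h).comp measurable_snd)
    hv h hh).comp (measurable_const.prodMk measurable_id : Measurable fun s : S => ((), s))

end EpisodicMDP

namespace MultiTask

variable {S A : Type*} [MeasurableSpace S] [MeasurableSpace A] {M d : ℕ}

lemma abs_qLin_le (E : MultiTask S A M d) {h : ℕ} (hφ : ∀ s a, ‖E.φ h s a‖ ≤ 1)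
    (θ : EuclideanSpace ℝ (Fin d)) (s : S) (a : A) : |E.qLin h θ s a| ≤ ‖θ‖ :=
  (abs_real_inner_le_norm _ _).trans (mul_le_of_le_one_left (norm_nonneg _) (hφ s a))

lemma qLin_le_vLin (E : MultiTask S A M d) {h : ℕ} (hφ : ∀ s a, ‖E.φ h s a‖ ≤ 1)
    (θ : EuclideanSpace ℝ (Fin d)) (s : S) (a : A) : E.qLin h θ s a ≤ E.vLin h θ s :=
  le_ciSup (f := fun a => E.qLin h θ s a)
    ⟨‖θ‖, by rintro _ ⟨b, rfl⟩; exact (abs_le.1 (E.abs_qLin_le hφ θ s b)).2⟩ a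

lemma abs_vLin_sub_le (E : MultiTask S A M d) [Nonempty A] {h : ℕ} (hφ : ∀ s a, ‖E.φ h s a‖ ≤ 1)
    (θ θ' : EuclideanSpace ℝ (Fin d)) (s : S) : |E.vLin h θ s - E.vLin h θ' s| ≤ ‖θ - θ'‖ := by
  have key : ∀ θ θ', E.vLin h θ s ≤ E.vLin h θ' s + ‖θ - θ'‖ := fun θ θ' => by
    refine ciSup_le fun a => ?_
    have h1 := (abs_le.1 (E.abs_qLin_le hφ (θ - θ') s a)).2
    have h2 := E.qLin_le_vLin hφ θ' s a
    simp only [qLin, inner_sub_right] at h1 h2 ⊢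
    linarith
  rw [abs_le]
  have h1 := key θ θ'
  have h2 := key θ' θ
  rw [norm_sub_rev] at h2
  constructor <;> linarith

lemma vLin_zero (E : MultiTask S A M d) [Nonempty A] (h : ℕ) (s : S) : E.vLin h 0 s = 0 := by
  simp [vLin, qLin]

lemma abs_vLin_le (E : MultiTask S A M d) [Nonempty A] {h : ℕ} (hφ : ∀ s a, ‖E.φ h s a‖ ≤ 1)
    (θ : EuclideanSpace ℝ (Fin d)) (s : S) : |E.vLin h θ s| ≤ ‖θ‖ := by
  simpa [vLin_zero] using E.abs_vLin_sub_le hφ θ 0 s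

/-- Joint measurability (a Carathéodory argument: `V_h(θ)` is Lipschitz in `θ`). -/
lemma measurable_vLin_uncurry (E : MultiTask S A M d) [Nonempty A] {h : ℕ}
    (hφ : ∀ s a, ‖E.φ h s a‖ ≤ 1) :
    Measurable fun z : EuclideanSpace ℝ (Fin d) × S => E.vLin h z.1 z.2 := by
  refine measurable_uncurry_of_continuous_of_measurable (u := fun θ s => E.vLin h θ s)
    (fun s => ?_) (fun θ => E.measurable_max h θ)
  have : LipschitzWith 1 fun θ => E.vLin h θ s := LipschitzWith.of_dist_le_mul fun θ θ' => by
    simpa [Real.dist_eq, dist_eq_norm] using E.abs_vLin_sub_le hφ θ θ' s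
  exact this.continuous

lemma integrable_vLin (E : MultiTask S A M d) [Nonempty A] {h : ℕ} (hφ : ∀ s a, ‖E.φ h s a‖ ≤ 1)
    (θ : EuclideanSpace ℝ (Fin d)) (μ : Measure S) [IsFiniteMeasure μ] :
    Integrable (E.vLin h θ) μ :=
  Integrable.of_bound (E.measurable_max h θ).aestronglyMeasurable ‖θ‖
    (.of_forall fun s => E.abs_vLin_le hφ θ s)

lemma bellman_eq (E : MultiTask S A M d) (i : Fin M) (h : ℕ) (θ : EuclideanSpace ℝ (Fin d))
    (s : S) (a : A) : (E.mdp i).bellman h (E.qLin (h + 1) θ) s a =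
      (E.mdp i).reward h s a + ∫ s', E.vLin (h + 1) θ s' ∂((E.mdp i).trans h (s, a)) := rfl

lemma measurable_bellman (E : MultiTask S A M d) (i : Fin M) (h : ℕ)
    (θ : EuclideanSpace ℝ (Fin d)) :
    Measurable fun x : S × A => (E.mdp i).bellman h (E.qLin (h + 1) θ) x.1 x.2 := by
  simp_rw [bellman_eq]
  refine ((E.mdp i).measurable_reward h).add ?_
  have h1 : Measurable fun p : (S × A) × S => E.vLin (h + 1) θ p.2 :=
    (E.measurable_max (h + 1) θ).comp measurable_snd
  exact (h1.stronglyMeasurable.integral_kernel_prod_right' (κ := (E.mdp i).trans h)).measurable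

/-- Optimism: parameters with Bellman errors at most `ε` overestimate every policy value,
up to `ε` per remaining step. -/
lemma qPol_le_qLin_add (E : MultiTask S A M d) [Nonempty A] {H : ℕ} (i : Fin M)
    (hφ : ∀ h < H, ∀ s a, ‖E.φ h s a‖ ≤ 1)
    (hv : ∀ h < H, ∀ (π : Policy S A) s a, (E.mdp i).qPol H π h s a ∈ Set.Icc (0 : ℝ) 1)
    {ε : ℝ} (hε : 0 ≤ ε) (θ : ℕ → EuclideanSpace ℝ (Fin d)) (h0 : θ H = 0)
    (hθ : ∀ h < H, ∀ s a,
      |E.qLin h (θ h) s a - (E.mdp i).bellman h (E.qLin (h + 1) (θ (h + 1))) s a| ≤ ε)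
    (π : Policy S A) :
    ∀ n, ∀ h < H, H - h = n → ∀ s a,
      (E.mdp i).qPol H π h s a ≤ E.qLin h (θ h) s a + n * ε := by
  intro n
  induction n with
  | zero => intro h hh h0; omega
  | succ n ih =>
    intro h hh hn s a
    have hb := (abs_le.1 (hθ h hh s a)).1
    rw [bellman_eq] at hb
    push_cast
    by_cases hH : h + 1 < H
    · rw [(E.mdp i).qPol_eq hH π hv]
      have h1 : ∫ x, (E.mdp i).vPol H π (h + 1) x ∂((E.mdp i).trans h (s, a)) ≤
          ∫ x, (E.vLin (h + 1) (θ (h + 1)) x + n * ε) ∂((E.mdp i).trans h (s, a)) := by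
        refine integral_mono ?_ ((E.integrable_vLin (hφ _ hH) _ _).add (integrable_const _)) ?_
        · refine Integrable.of_bound
            ((E.mdp i).measurable_vPol_right π hv _ hH).aestronglyMeasurable 1
            (.of_forall fun x => ?_)
          have := hv _ hH π x (π.act (h + 1) x)
          rw [Real.norm_eq_abs, abs_le]
          exact ⟨by simp only [EpisodicMDP.vPol]; linarith [this.1], this.2⟩
        · intro x
          have h2 := ih (h + 1) hH (by omega) x (π.act (h + 1) x)
          have h3 := E.qLin_le_vLin (hφ _ hH) (θ (h + 1)) x (π.act (h + 1) x)
          simp only [EpisodicMDP.vPol]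
          linarith
      rw [integral_add (E.integrable_vLin (hφ _ hH) _ _) (integrable_const _)] at h1
      simp only [integral_const, probReal_univ, one_smul] at h1
      linarith
    · have e : h + 1 = H := by omega
      rw [(E.mdp i).qPol_last e]
      rw [e, h0] at hb
      simp only [vLin_zero, integral_zero, add_zero] at hb
      have : 0 ≤ n * ε := by positivity
      linarith

end MultiTask

/-! ### Conditionally independent observations -/

section CondLaw

variable {ι : Type*} [Fintype ι] {X Y : Type*} {mX : MeasurableSpace X} [MeasurableSpace Y]

/-- The product over `i` of the kernels `κ i`, as a kernel. -/
noncomputable def piKernel (κ : ι → Kernel X Y) [∀ i, IsMarkovKernel (κ i)] :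
    Kernel X (ι → Y) where
  toFun x := Measure.pi fun i => κ i x
  measurable' := by
    refine Measurable.measure_of_isPiSystem_of_isProbabilityMeasure
      (generateFrom_pi (α := fun _ : ι => Y)).symm isPiSystem_pi ?_
    rintro _ ⟨U, hU, rfl⟩
    simp only [Measure.pi_pi]
    exact Finset.measurable_prod _ fun i _ => Kernel.measurable_coe _ (hU i trivial)

instance (κ : ι → Kernel X Y) [∀ i, IsMarkovKernel (κ i)] : IsMarkovKernel (piKernel κ) :=
  ⟨fun x => by change IsProbabilityMeasure (Measure.pi fun i => κ i x); infer_instance⟩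

/-- A product of probability measures integrates products of one-variable functions factorwise. -/
lemma lintegral_pi_prod (μ : ι → Measure Y) [∀ i, IsProbabilityMeasure (μ i)]
    (g : ι → Y → ℝ≥0∞) (hg : ∀ i, Measurable (g i)) :
    ∫⁻ y, ∏ i, g i (y i) ∂(Measure.pi μ) = ∏ i, ∫⁻ v, g i v ∂(μ i) := by
  rw [lintegral_prod_eq_prod_lintegral_of_indepFun _ (fun i (y : ι → Y) => g i (y i))
    (iIndepFun_pi fun i => (hg i).aemeasurable) fun i => (hg i).comp (measurable_pi_apply i)]
  refine Finset.prod_congr rfl fun i _ => ?_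
  rw [← (measurePreserving_eval μ i).lintegral_comp (hg i)]

/-- If, given `x`, the `y i` are independent with laws `κ i (x)`, which is tested on rectangles,
then the joint law of `(x, y)` is the composition of the law of `x` with the product kernel. -/
lemma map_prodMk_eq_compProd {Ω : Type*} [MeasurableSpace Ω] (P : Measure Ω)
    [IsProbabilityMeasure P] {x : Ω → X} (hx : Measurable x) {y : Ω → ι → Y} (hy : Measurable y)
    (κ : ι → Kernel X Y) [∀ i, IsMarkovKernel (κ i)]
    (h : ∀ B, MeasurableSet B → ∀ U : ι → Set Y, (∀ i, MeasurableSet (U i)) →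
      P (x ⁻¹' B ∩ {ω | ∀ i, y ω i ∈ U i}) = ∫⁻ ω in x ⁻¹' B, ∏ i, κ i (x ω) (U i) ∂P) :
    P.map (fun ω => (x ω, y ω)) = (P.map x) ⊗ₘ piKernel κ := by
  have hxy : Measurable fun ω => (x ω, y ω) := hx.prodMk hy
  have : IsProbabilityMeasure (P.map fun ω => (x ω, y ω)) :=
    Measure.isProbabilityMeasure_map hxy.aemeasurable
  have : IsProbabilityMeasure (P.map x) := Measure.isProbabilityMeasure_map hx.aemeasurable
  refine ext_of_generate_finite _ (generateFrom_eq_prod (α := X) (β := ι → Y)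
    MeasurableSpace.generateFrom_measurableSet (generateFrom_pi (α := fun _ : ι => Y))
    isCountablySpanning_measurableSet ⟨fun _ => Set.univ, fun _ =>
      ⟨fun _ => Set.univ, by simp, by simp⟩, Set.iUnion_const _⟩).symm
    (MeasurableSpace.isPiSystem_measurableSet.prod isPiSystem_pi) ?_ (by simp)
  rintro _ ⟨B, hB, _, ⟨U, hU, rfl⟩, rfl⟩
  have hU' : ∀ i, MeasurableSet (U i) := fun i => hU i trivial
  have hB' : MeasurableSet B := hB
  have hUm : MeasurableSet (Set.univ.pi U) := MeasurableSet.univ_pi hU'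
  rw [Measure.map_apply hxy (hB'.prod hUm), Measure.compProd_apply_prod hB' hUm,
    setLIntegral_map hB' (Kernel.measurable_coe _ hUm) hx]
  have e : (fun ω => (x ω, y ω)) ⁻¹' B ×ˢ Set.univ.pi U =
      x ⁻¹' B ∩ {ω | ∀ i, y ω i ∈ U i} := by
    ext ω; simp
  rw [e, h B hB' U hU']
  refine lintegral_congr fun ω => ?_
  change _ = Measure.pi (fun i => κ i (x ω)) _
  rw [Measure.pi_pi]

/-- Under this conditional independence, a product of functions of the single `y i` and of `x` may
be replaced by the product of their conditional expectations given `x`. -/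
lemma lintegral_mul_prod_eq {Ω : Type*} [MeasurableSpace Ω] (P : Measure Ω)
    [IsProbabilityMeasure P] {x : Ω → X} (hx : Measurable x) {y : Ω → ι → Y} (hy : Measurable y)
    (κ : ι → Kernel X Y) [∀ i, IsMarkovKernel (κ i)]
    (h : ∀ B, MeasurableSet B → ∀ U : ι → Set Y, (∀ i, MeasurableSet (U i)) →
      P (x ⁻¹' B ∩ {ω | ∀ i, y ω i ∈ U i}) = ∫⁻ ω in x ⁻¹' B, ∏ i, κ i (x ω) (U i) ∂P)
    {Z : X → ℝ≥0∞} (hZ : Measurable Z) {G : ι → X → Y → ℝ≥0∞}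
    (hG : ∀ i, Measurable (Function.uncurry (G i))) :
    ∫⁻ ω, Z (x ω) * ∏ i, G i (x ω) (y ω i) ∂P =
      ∫⁻ ω, Z (x ω) * ∏ i, ∫⁻ v, G i (x ω) v ∂(κ i (x ω)) ∂P := by
  have : IsProbabilityMeasure (P.map x) := Measure.isProbabilityMeasure_map hx.aemeasurable
  have hG' : ∀ i, Measurable fun p : X × (ι → Y) => G i p.1 (p.2 i) := fun i =>
    (hG i).comp (measurable_fst.prodMk ((measurable_pi_apply i).comp measurable_snd))
  have hF : Measurable fun p : X × (ι → Y) => Z p.1 * ∏ i, G i p.1 (p.2 i) :=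
    (hZ.comp measurable_fst).mul (Finset.measurable_prod _ fun i _ => hG' i)
  have hL : ∫⁻ ω, Z (x ω) * ∏ i, G i (x ω) (y ω i) ∂P =
      ∫⁻ p, Z p.1 * ∏ i, G i p.1 (p.2 i) ∂(P.map fun ω => (x ω, y ω)) := by
    rw [lintegral_map hF (hx.prodMk hy)]
  have hJ : ∀ a, ∫⁻ b, Z a * ∏ i, G i a (b i) ∂(piKernel κ a) =
      Z a * ∏ i, ∫⁻ v, G i a v ∂(κ i a) := by
    intro a
    have hGa : ∀ i, Measurable (G i a) := fun i => (hG i).comp measurable_prodMk_left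
    rw [lintegral_const_mul (Z a) (f := fun b : ι → Y => ∏ i, G i a (b i))
      (Finset.measurable_prod _ fun i _ => (hGa i).comp (measurable_pi_apply i))]
    congr 1
    exact lintegral_pi_prod (fun i => κ i a) (G · a) hGa
  rw [hL, map_prodMk_eq_compProd P hx hy κ h, Measure.lintegral_compProd hF]
  simp_rw [hJ]
  rw [lintegral_map _ hx]
  refine hZ.mul (Finset.measurable_prod _ fun i _ => ?_)
  exact Measurable.lintegral_kernel_prod_right' (hG i)

lemma measurable_prodMap_id {W : Type*} [MeasurableSpace W] {w : X → W} (hw : Measurable w) :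
    Measurable fun z : X × Y => (w z.1, z.2) :=
  (hw.comp measurable_fst).prodMk measurable_snd

lemma measurable_comp_graph {W : Type*} [MeasurableSpace W] {mX' : MeasurableSpace X}
    (hle : mX ≤ mX') {F : X × Y → W} (hF : Measurable[mX.prod inferInstance] F) {y : X → Y}
    (hy : Measurable[mX'] y) : Measurable[mX'] fun x => F (x, y x) :=
  hF.comp (@Measurable.prodMk _ mX' _ _ _ _ (fun x => x) y (measurable_id'' hle) hy)

end CondLaw

namespace MultiTask.Run

variable {S A : Type*} [MeasurableSpace S] [MeasurableSpace A] {M d k H T : ℕ} {D α : ℝ}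
  {E : MultiTask S A M d} {Ω : Type*} [MeasurableSpace Ω] {P : Measure Ω}

/-- The state-action pair of task `i` at step `h` of episode `t`. -/
def sa (r : E.Run k H T D α P) (t h : ℕ) (i : Fin M) (ω : Ω) : S × A :=
  ((r.data ω).s t h i, (r.data ω).a t h i)

/-- The reward and the next state of task `i` at step `h` of episode `t`. -/
def obs (r : E.Run k H T D α P) (t h : ℕ) (ω : Ω) (i : Fin M) : ℝ × S :=
  ((r.data ω).R t h i, (r.data ω).s t (h + 1) i)

lemma measurable_sa (r : E.Run k H T D α P) {t h : ℕ} (ht : t < T) (hh : h < H) (i : Fin M) :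
    Measurable[r.𝓕 t h] (r.sa t h i) :=
  (r.measurable_state t ht h hh.le i).prodMk (r.measurable_action t ht h hh i)

lemma measurable_obs (r : E.Run k H T D α P) {t h : ℕ} (ht : t < T) (hh : h < H) (i : Fin M) :
    Measurable[r.𝓕 t (h + 1)] fun ω => r.obs t h ω i :=
  (r.measurable_reward t ht h hh i).prodMk (r.measurable_state t ht (h + 1) hh i)

lemma le_of_le (r : E.Run k H T D α P) (t : ℕ) {h h' : ℕ} (hh : h ≤ h') : r.𝓕 t h ≤ r.𝓕 t h' :=
  monotone_nat_of_le_succ (f := r.𝓕 t) (r.mono_step t) hh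

lemma le_next (r : E.Run k H T D α P) (t : ℕ) {h h' : ℕ} (hh : h ≤ H) :
    r.𝓕 t h ≤ r.𝓕 (t + 1) h' :=
  (r.le_of_le t hh).trans ((r.mono_episode t).trans (r.le_of_le _ (Nat.zero_le _)))

lemma le_of_lt (r : E.Run k H T D α P) {t t' : ℕ} (ht : t < t') {h h' : ℕ} (hh : h ≤ H)
    (hh' : h' ≤ H) : r.𝓕 t h ≤ r.𝓕 t' h' := by
  induction t', ht using Nat.le_induction with
  | base => exact r.le_next t hh
  | succ n _ ih => exact ih.trans (r.le_next n hh')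

/-- Integration of the observations of one step against the past. -/
lemma lintegral_mul_prod [IsProbabilityMeasure P] (r : E.Run k H T D α P) {t h : ℕ} (ht : t < T)
    (hh : h < H) {Z : Ω → ℝ≥0∞} (hZ : Measurable[r.𝓕 t h] Z) {G : Fin M → Ω → ℝ × S → ℝ≥0∞}
    (hG : ∀ i, Measurable[(r.𝓕 t h).prod inferInstance] (Function.uncurry (G i))) :
    ∫⁻ ω, Z ω * ∏ i, G i ω (r.obs t h ω i) ∂P =
      ∫⁻ ω, Z ω * ∏ i, ∫⁻ v, G i ω v ∂((E.mdp i).step h (r.sa t h i ω)) ∂P := by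
  have hle := r.le_space t h
  -- the past is encoded by the identity of `Ω`, with the smaller σ-algebra on its target
  have hκ : ∀ i, IsMarkovKernel (@Kernel.comap _ _ _ _ _ (r.𝓕 t h) ((E.mdp i).step h)
      (r.sa t h i) (r.measurable_sa ht hh i)) := fun i =>
    @Kernel.IsMarkovKernel.comap _ _ _ _ _ (r.𝓕 t h) _ _ _ (r.measurable_sa ht hh i)
  refine lintegral_mul_prod_eq (mX := r.𝓕 t h) P (x := fun ω => ω) (measurable_id'' hle)
    (y := r.obs t h) ?_ (fun i => @Kernel.comap _ _ _ _ _ (r.𝓕 t h) ((E.mdp i).step h)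
      (r.sa t h i) (r.measurable_sa ht hh i)) ?_ hZ hG
  · exact measurable_pi_lambda _ fun i =>
      (r.measurable_obs ht hh i).mono (r.le_space t (h + 1)) le_rfl
  · intro B hB U hU
    have hB' : MeasurableSet[r.𝓕 t h] B := hB
    set V : Set Ω := {ω | ∀ i, r.obs t h ω i ∈ U i} with hVdef
    have hV : MeasurableSet V := by
      rw [hVdef, Set.ofPred_forall]
      exact MeasurableSet.iInter fun i =>
        ((r.measurable_obs ht hh i).mono (r.le_space t (h + 1)) le_rfl) (hU i)
    have h1 : P⟦V | r.𝓕 t h⟧ =ᵐ[P] fun ω => ∏ i, ((E.mdp i).step h (r.sa t h i ω)).real (U i) :=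
      r.transition t ht h hh U hU
    have h2 : ∫ ω in B, (P⟦V | r.𝓕 t h⟧) ω ∂P = ∫ ω in B, V.indicator (fun _ => (1 : ℝ)) ω ∂P :=
      setIntegral_condExp hle ((integrable_const _).indicator hV) hB'
    rw [setIntegral_congr_ae (hle _ hB') (h1.mono fun ω hω _ => hω),
      integral_indicator_const _ hV, smul_eq_mul, mul_one] at h2
    have h3 : ∀ ω, ∏ i, (@Kernel.comap _ _ _ _ _ (r.𝓕 t h) ((E.mdp i).step h)
        (r.sa t h i) (r.measurable_sa ht hh i)) ω (U i) =
          ENNReal.ofReal (∏ i, ((E.mdp i).step h (r.sa t h i ω)).real (U i)) := by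
      intro ω
      rw [ENNReal.ofReal_prod_of_nonneg fun i _ => measureReal_nonneg]
      refine Finset.prod_congr rfl fun i _ => ?_
      rw [Kernel.comap_apply, ofReal_measureReal]
    have h4 : ∀ ω, 0 ≤ ∏ i, ((E.mdp i).step h (r.sa t h i ω)).real (U i) := fun ω =>
      Finset.prod_nonneg fun i _ => measureReal_nonneg
    have hm : Measurable fun ω => ∏ i, ((E.mdp i).step h (r.sa t h i ω)).real (U i) := by
      refine Finset.measurable_prod _ fun i _ => ?_
      exact (Kernel.measurable_coe _ (hU i)).ennreal_toReal.comp
        ((r.measurable_sa ht hh i).mono hle le_rfl)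
    simp_rw [h3]
    change P (B ∩ V) = ∫⁻ ω in B, _ ∂P
    rw [← ofReal_integral_eq_lintegral_ofReal _ (.of_forall h4)]
    · have : ∫ ω in B, ∏ i, ((E.mdp i).step h (r.sa t h i ω)).real (U i) ∂P =
          (P.restrict B).real V := h2
      rw [this, measureReal_restrict_apply hV, ofReal_measureReal, Set.inter_comm]
    · refine Integrable.of_bound hm.aestronglyMeasurable 1 (.of_forall fun ω => ?_)
      rw [Real.norm_eq_abs, abs_of_nonneg (h4 ω)]
      exact Finset.prod_le_one (fun i _ => measureReal_nonneg) fun i _ => measureReal_le_one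

/-- What holds almost surely under the laws of the MDP holds almost surely along the run. -/
lemma ae_obs [IsProbabilityMeasure P] (r : E.Run k H T D α P) {t h : ℕ} (ht : t < T)
    (hh : h < H) (i : Fin M) {p : (S × A) → ℝ × S → Prop}
    (hp : MeasurableSet {z : (S × A) × (ℝ × S) | p z.1 z.2})
    (hae : ∀ x, ∀ᵐ y ∂((E.mdp i).step h x), p x y) :
    ∀ᵐ ω ∂P, p (r.sa t h i ω) (r.obs t h ω i) := by
  classical
  have hm : Measurable[(r.𝓕 t h).prod inferInstance]
      fun z : Ω × (ℝ × S) => (r.sa t h i z.1, z.2) :=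
    measurable_prodMap_id (r.measurable_sa ht hh i)
  have key := r.lintegral_mul_prod ht hh (Z := fun _ => 1) measurable_const
    (G := fun i' ω v => if i' = i then
      {z : (S × A) × (ℝ × S) | p z.1 z.2}ᶜ.indicator (fun _ => (1 : ℝ≥0∞)) (r.sa t h i ω, v)
      else 1) (by
      intro i'
      by_cases hi : i' = i
      · simp only [hi, if_true]
        exact (measurable_const.indicator hp.compl).comp hm
      · simp only [hi, if_false]
        exact measurable_const)
  have e1 : ∀ ω, ∏ i', ∫⁻ v, (if i' = i then
      {z : (S × A) × (ℝ × S) | p z.1 z.2}ᶜ.indicator (fun _ => (1 : ℝ≥0∞)) (r.sa t h i ω, v) else 1)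
        ∂((E.mdp i').step h (r.sa t h i' ω)) = 0 := by
    intro ω
    refine Finset.prod_eq_zero (Finset.mem_univ i) ?_
    simp only [if_true]
    have hm1 : Measurable fun v => {z : (S × A) × (ℝ × S) | p z.1 z.2}ᶜ.indicator
        (fun _ => (1 : ℝ≥0∞)) (r.sa t h i ω, v) :=
      (measurable_const.indicator hp.compl).comp measurable_prodMk_left
    rw [lintegral_eq_zero_iff hm1]
    filter_upwards [hae (r.sa t h i ω)] with y hy
    simp [hy]
  simp only [e1, Finset.prod_ite_eq', Finset.mem_univ, if_true] at key
  simp only [one_mul, lintegral_zero] at key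
  have hm' : Measurable fun ω => (r.sa t h i ω, r.obs t h ω i) :=
    ((r.measurable_sa ht hh i).mono (r.le_space t h) le_rfl).prodMk
      ((r.measurable_obs ht hh i).mono (r.le_space t (h + 1)) le_rfl)
  have hm'' : Measurable fun ω => {z : (S × A) × (ℝ × S) | p z.1 z.2}ᶜ.indicator
      (fun _ => (1 : ℝ≥0∞)) (r.sa t h i ω, r.obs t h ω i) :=
    (measurable_const.indicator hp.compl).comp hm'
  rw [lintegral_eq_zero_iff hm''] at key
  filter_upwards [key] with ω hω
  by_contra hcon
  simp [hcon] at hω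

/-- Products over the episodes of one-step factors with conditional expectation at most `1` have
expectation at most `1`. -/
lemma lintegral_prod_prod_le_one [IsProbabilityMeasure P] (r : E.Run k H T D α P) {h : ℕ}
    (hh : h < H) {G : ℕ → Fin M → Ω → ℝ × S → ℝ≥0∞}
    (hG : ∀ t < T, ∀ i, Measurable[(r.𝓕 t h).prod inferInstance] (Function.uncurry (G t i)))
    (hle : ∀ t < T, ∀ i ω, ∫⁻ v, G t i ω v ∂((E.mdp i).step h (r.sa t h i ω)) ≤ 1) :
    ∀ t ≤ T, ∫⁻ ω, ∏ j ∈ Finset.range t, ∏ i, G j i ω (r.obs j h ω i) ∂P ≤ 1 := by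
  intro t
  induction t with
  | zero => simp
  | succ t ih =>
    intro ht
    simp_rw [Finset.prod_range_succ]
    rw [r.lintegral_mul_prod (t := t) (by omega) hh _ (hG t (by omega))]
    · refine (lintegral_mono fun ω => ?_).trans (ih (by omega))
      exact mul_le_of_le_one_right' (Finset.prod_le_one' fun i _ => hle t (by omega) i ω)
    · refine Finset.measurable_prod _ fun j hj => Finset.measurable_prod _ fun i _ => ?_
      rw [Finset.mem_range] at hj
      have h1 : Measurable[r.𝓕 t h] fun ω => r.obs j h ω i :=
        (r.measurable_obs (by omega) hh i).mono (r.le_of_lt hj hh hh.le) le_rfl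
      exact measurable_comp_graph (r.le_of_lt hj hh.le hh.le) (hG j (by omega) i) h1

end MultiTask.Run

/-! ### The elliptical potential -/

section Potential

variable {d : ℕ}

/-- The regularized Gram matrix of the first `t` vectors of a sequence. -/
def gram (v : ℕ → Fin d → ℝ) (t : ℕ) : Matrix (Fin d) (Fin d) ℝ :=
  ∑ j ∈ Finset.range t, Matrix.vecMulVec (v j) (v j) + 1

lemma gram_posDef (v : ℕ → Fin d → ℝ) (t : ℕ) : (gram v t).PosDef :=
  Matrix.PosDef.posSemidef_add
    (Matrix.posSemidef_sum _ fun j _ => Matrix.posSemidef_vecMulVec_self_star (v j))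
    Matrix.PosDef.one

lemma gram_quadratic (v : ℕ → Fin d → ℝ) (t : ℕ) (x : Fin d → ℝ) :
    x ⬝ᵥ (gram v t *ᵥ x) = ∑ j ∈ Finset.range t, (v j ⬝ᵥ x) ^ 2 + x ⬝ᵥ x := by
  rw [gram, Matrix.add_mulVec, dotProduct_add, Matrix.one_mulVec, Matrix.sum_mulVec,
    dotProduct_sum]
  congr 1
  refine Finset.sum_congr rfl fun j _ => ?_
  rw [Matrix.vecMulVec_mulVec]
  simp [dotProduct_comm x, sq]

/-- Cauchy–Schwarz for the norm of a positive definite matrix and its dual norm. -/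
lemma sq_dotProduct_le {V : Matrix (Fin d) (Fin d) ℝ} (hV : V.PosDef) (u x : Fin d → ℝ) :
    (u ⬝ᵥ x) ^ 2 ≤ (u ⬝ᵥ (V⁻¹ *ᵥ u)) * (x ⬝ᵥ (V *ᵥ x)) := by
  have hinv : V *ᵥ (V⁻¹ *ᵥ u) = u := by
    rw [Matrix.mulVec_mulVec, Matrix.mul_nonsing_inv _ (hV.det_pos.ne'.isUnit), Matrix.one_mulVec]
  have hsymm : ∀ y z : Fin d → ℝ, y ⬝ᵥ (V *ᵥ z) = z ⬝ᵥ (V *ᵥ y) := by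
    intro y z
    have : Vᵀ = V := by simpa [Matrix.IsHermitian] using hV.1
    rw [Matrix.dotProduct_mulVec, ← Matrix.mulVec_transpose, this, dotProduct_comm]
  set w := V⁻¹ *ᵥ u with hw
  have key : ∀ c : ℝ, 0 ≤ (u ⬝ᵥ w) * (c * c) + (2 * (u ⬝ᵥ x)) * c + x ⬝ᵥ (V *ᵥ x) := by
    intro c
    have h0 := hV.posSemidef.dotProduct_mulVec_nonneg (x + c • w)
    simp only [star_trivial, Matrix.mulVec_add, Matrix.mulVec_smul, hinv, dotProduct_add,
      add_dotProduct, smul_dotProduct, dotProduct_smul, smul_eq_mul, hsymm w x] at h0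
    rw [dotProduct_comm w u, dotProduct_comm x u] at h0
    linarith
  have := discrim_le_zero key
  rw [discrim] at this
  nlinarith

lemma gram_inv_le_one {v : ℕ → Fin d → ℝ} (t : ℕ) {u : Fin d → ℝ} (hu : u ⬝ᵥ u ≤ 1) :
    u ⬝ᵥ ((gram v t)⁻¹ *ᵥ u) ≤ 1 := by
  have hV := gram_posDef v t
  set w := (gram v t)⁻¹ *ᵥ u with hw
  have hinv : gram v t *ᵥ w = u := by
    rw [hw, Matrix.mulVec_mulVec, Matrix.mul_nonsing_inv _ (hV.det_pos.ne'.isUnit),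
      Matrix.one_mulVec]
  have h1 := gram_quadratic v t w
  rw [hinv, dotProduct_comm] at h1
  have h2 : 0 ≤ ∑ j ∈ Finset.range t, (v j ⬝ᵥ w) ^ 2 := Finset.sum_nonneg fun _ _ => sq_nonneg _
  have h3 : (u ⬝ᵥ w) ^ 2 ≤ (u ⬝ᵥ u) * (w ⬝ᵥ w) := by
    simpa [dotProduct, sq] using Finset.sum_mul_sq_le_sq_mul_sq Finset.univ u w
  have h4 : 0 ≤ w ⬝ᵥ w := Finset.sum_nonneg fun _ _ => mul_self_nonneg _
  nlinarith

lemma det_gram_succ (v : ℕ → Fin d → ℝ) (t : ℕ) :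
    (gram v (t + 1)).det = (gram v t).det * (1 + v t ⬝ᵥ ((gram v t)⁻¹ *ᵥ v t)) := by
  have e : gram v (t + 1) = gram v t +
      Matrix.replicateCol Unit (v t) * Matrix.replicateRow Unit (v t) := by
    rw [gram, gram, Finset.sum_range_succ, Matrix.vecMulVec_eq Unit, add_right_comm]
  rw [e, Matrix.det_add_replicateCol_mul_replicateRow (gram_posDef v t).det_pos.ne'.isUnit]
  congr 1
  rw [Matrix.det_unique, Matrix.add_apply, Matrix.one_apply_eq, Matrix.mul_assoc,
    ← Matrix.replicateCol_mulVec, Matrix.replicateRow_mul_replicateCol_apply]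

lemma det_gram_le {v : ℕ → Fin d → ℝ} (hv : ∀ j, v j ⬝ᵥ v j ≤ 1) (t : ℕ) :
    (gram v t).det ≤ ((d : ℝ) + t) ^ d := by
  have hV := gram_posDef v t
  have htr : (gram v t).trace ≤ d + t := by
    rw [gram, Matrix.trace_add, Matrix.trace_one, Matrix.trace_sum, Fintype.card_fin, add_comm]
    gcongr
    refine (Finset.sum_le_sum fun j _ => ?_).trans (b := ∑ j ∈ Finset.range t, (1 : ℝ)) (by simp)
    rw [Matrix.trace_vecMulVec]
    exact hv j
  rw [hV.1.trace_eq_sum_eigenvalues] at htr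
  rw [hV.1.det_eq_prod_eigenvalues]
  have h1 : ∀ i, hV.1.eigenvalues i ≤ d + t := fun i =>
    (Finset.single_le_sum (f := hV.1.eigenvalues) (fun j _ => (hV.eigenvalues_pos j).le)
      (Finset.mem_univ i)).trans htr
  refine (Finset.prod_le_prod (fun i _ => (hV.eigenvalues_pos i).le) fun i _ => h1 i).trans ?_
  simp

/-- The elliptical potential lemma. -/
lemma sum_gram_inv_le {v : ℕ → Fin d → ℝ} (hv : ∀ j, v j ⬝ᵥ v j ≤ 1) (T : ℕ) :
    ∑ t ∈ Finset.range T, v t ⬝ᵥ ((gram v t)⁻¹ *ᵥ v t) ≤ 2 * (d * Real.log (d + T)) := by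
  have h1 : ∀ T, ∑ t ∈ Finset.range T, v t ⬝ᵥ ((gram v t)⁻¹ *ᵥ v t) ≤
      2 * Real.log (gram v T).det := by
    intro T
    induction T with
    | zero => simp [gram]
    | succ t ih =>
      have hd := (gram_posDef v t).det_pos
      have hx0 : 0 ≤ v t ⬝ᵥ ((gram v t)⁻¹ *ᵥ v t) :=
        (gram_posDef v t).inv.posSemidef.dotProduct_mulVec_nonneg (v t)
      have hx1 := gram_inv_le_one (v := v) t (hv t)
      rw [Finset.sum_range_succ, det_gram_succ, Real.log_mul hd.ne' (by positivity)]
      set x := v t ⬝ᵥ ((gram v t)⁻¹ *ᵥ v t)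
      have h2 : 1 - (1 + x)⁻¹ ≤ Real.log (1 + x) := Real.one_sub_inv_le_log_of_pos (by positivity)
      have h3 : x / 2 ≤ 1 - (1 + x)⁻¹ := by
        rw [le_sub_iff_add_le, ← le_sub_iff_add_le', inv_le_comm₀ (by positivity) (by linarith),
          inv_eq_one_div, div_le_iff₀ (by linarith)]
        nlinarith
      linarith
  refine (h1 T).trans ?_
  gcongr
  rw [← Real.log_pow]
  exact Real.log_le_log (gram_posDef v T).det_pos (det_gram_le hv T)

end Potential

namespace MultiTask

variable {S A : Type*} [MeasurableSpace S] [MeasurableSpace A] {M d : ℕ}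

/-- The feature vectors of task `i` at step `h`, as a sequence over the episodes. -/
def features (E : MultiTask S A M d) (x : Data S A M) (h : ℕ) (i : Fin M) (j : ℕ) : Fin d → ℝ :=
  (E.φ h (x.s j h i) (x.a j h i)).ofLp

lemma design_eq_gram (E : MultiTask S A M d) (x : Data S A M) (t h : ℕ) (i : Fin M) :
    E.design x t h i = gram (E.features x h i) t := rfl

lemma features_dotProduct (E : MultiTask S A M d) (x : Data S A M) (h : ℕ) (i : Fin M) (j : ℕ)
    (θ : EuclideanSpace ℝ (Fin d)) :
    E.features x h i j ⬝ᵥ θ.ofLp = E.qLin h θ (x.s j h i) (x.a j h i) := by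
  rw [qLin, EuclideanSpace.inner_eq_star_dotProduct, dotProduct_comm]; rfl

lemma ofLp_dotProduct_self (θ : EuclideanSpace ℝ (Fin d)) : θ.ofLp ⬝ᵥ θ.ofLp = ‖θ‖ ^ 2 := by
  rw [EuclideanSpace.norm_sq_eq]
  simp [dotProduct, sq]

lemma mahalanobisSq_design (E : MultiTask S A M d) (x : Data S A M) (t h : ℕ) (i : Fin M)
    (θ : EuclideanSpace ℝ (Fin d)) :
    mahalanobisSq (E.design x t h i) θ =
      ∑ j ∈ Finset.range t, E.qLin h θ (x.s j h i) (x.a j h i) ^ 2 + ‖θ‖ ^ 2 := by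
  rw [mahalanobisSq, design_eq_gram, gram_quadratic, ofLp_dotProduct_self]
  simp_rw [features_dotProduct]

/-- The sum over all episodes and tasks of the predictions of parameters that lie in ellipsoids of
squared radius `β`: Cauchy–Schwarz and the elliptical potential lemma in each task. -/
lemma sum_qLin_le (E : MultiTask S A M d) (x : Data S A M) {h : ℕ} (hφ : ∀ s a, ‖E.φ h s a‖ ≤ 1)
    (T : ℕ) {β : ℝ} (θ : ℕ → Params M d)
    (hθ : ∀ t < T, ∑ i, mahalanobisSq (E.design x t h i) (θ t i) ≤ β) :
    ∑ t ∈ Finset.range T, ∑ i, E.qLin h (θ t i) (x.s t h i) (x.a t h i) ≤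
      √(β * T * (M * (2 * (d * Real.log (d + T))))) := by
  have hnorm : ∀ i j, E.features x h i j ⬝ᵥ E.features x h i j ≤ 1 := fun i j => by
    rw [features, ofLp_dotProduct_self]
    exact pow_le_one₀ (norm_nonneg _) (hφ _ _)
  set N : ℕ → Fin M → ℝ := fun t i => E.features x h i t ⬝ᵥ
    ((gram (E.features x h i) t)⁻¹ *ᵥ E.features x h i t) with hN
  have hN0 : ∀ t i, 0 ≤ N t i := fun t i =>
    (gram_posDef (E.features x h i) t).inv.posSemidef.dotProduct_mulVec_nonneg _
  have hm0 : ∀ t i, 0 ≤ mahalanobisSq (E.design x t h i) (θ t i) := fun t i => by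
    rw [mahalanobisSq_design]; positivity
  have h1 : ∀ t i, E.qLin h (θ t i) (x.s t h i) (x.a t h i) ≤
      √(mahalanobisSq (E.design x t h i) (θ t i)) * √(N t i) := by
    intro t i
    rw [← Real.sqrt_mul (hm0 t i)]
    refine Real.le_sqrt_of_sq_le ?_
    rw [mul_comm, ← features_dotProduct]
    exact sq_dotProduct_le (gram_posDef _ t) _ _
  have h2 : ∑ t ∈ Finset.range T, ∑ i, N t i ≤ M * (2 * (d * Real.log (d + T))) := by
    rw [Finset.sum_comm]
    refine (Finset.sum_le_sum fun i _ => sum_gram_inv_le (hnorm i) T).trans ?_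
    simp
  have h3 : ∑ t ∈ Finset.range T, ∑ i, mahalanobisSq (E.design x t h i) (θ t i) ≤ β * T := by
    refine (Finset.sum_le_sum fun t ht => hθ t (Finset.mem_range.1 ht)).trans ?_
    simp [mul_comm]
  refine (Finset.sum_le_sum fun t _ => Finset.sum_le_sum fun i _ => h1 t i).trans ?_
  rw [← Finset.sum_product']
  refine Real.le_sqrt_of_sq_le ((Finset.sum_mul_sq_le_sq_mul_sq _ _ _).trans ?_)
  have e1 : ∑ p ∈ Finset.range T ×ˢ (Finset.univ : Finset (Fin M)),
      √(mahalanobisSq (E.design x p.1 h p.2) (θ p.1 p.2)) ^ 2 =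
      ∑ t ∈ Finset.range T, ∑ i, mahalanobisSq (E.design x t h i) (θ t i) := by
    rw [← Finset.sum_product']
    exact Finset.sum_congr rfl fun p _ => Real.sq_sqrt (hm0 _ _)
  have e2 : ∑ p ∈ Finset.range T ×ˢ (Finset.univ : Finset (Fin M)), √(N p.1 p.2) ^ 2 =
      ∑ t ∈ Finset.range T, ∑ i, N t i := by
    rw [← Finset.sum_product']
    exact Finset.sum_congr rfl fun p _ => Real.sq_sqrt (hN0 _ _)
  rw [e1, e2]
  refine mul_le_mul h3 h2 (Finset.sum_nonneg fun t _ => Finset.sum_nonneg fun i _ => hN0 t i) ?_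
  exact (Finset.sum_nonneg fun t _ => Finset.sum_nonneg fun i _ => hm0 t i).trans h3

end MultiTask

/-! ### Low-rank parameters -/

section LowRank

variable {M d k : ℕ}

/-- `B w`, as a vector of the Euclidean space. -/
abbrev applyMat (B : Matrix (Fin d) (Fin k) ℝ) (w : EuclideanSpace ℝ (Fin k)) :
    EuclideanSpace ℝ (Fin d) :=
  WithLp.toLp 2 (B *ᵥ w.ofLp)

lemma norm_applyMat {B : Matrix (Fin d) (Fin k) ℝ} (hB : Bᵀ * B = 1)
    (w : EuclideanSpace ℝ (Fin k)) : ‖applyMat B w‖ = ‖w‖ := by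
  have h : ‖applyMat B w‖ ^ 2 = ‖w‖ ^ 2 := by
    rw [← MultiTask.ofLp_dotProduct_self, ← MultiTask.ofLp_dotProduct_self]
    change (B *ᵥ w.ofLp) ⬝ᵥ (B *ᵥ w.ofLp) = _
    rw [Matrix.dotProduct_mulVec, ← Matrix.mulVec_transpose, Matrix.mulVec_mulVec, hB,
      Matrix.one_mulVec]
  exact (sq_eq_sq₀ (norm_nonneg _) (norm_nonneg _)).1 h

lemma applyMat_sub (B : Matrix (Fin d) (Fin k) ℝ) (w w' : EuclideanSpace ℝ (Fin k)) :
    applyMat B (w - w') = applyMat B w - applyMat B w' := by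
  ext i; simp [applyMat, Matrix.mulVec_sub]

lemma sub_applyMat (B B' : Matrix (Fin d) (Fin k) ℝ) (w : EuclideanSpace ℝ (Fin k)) :
    applyMat (B - B') w = applyMat B w - applyMat B' w := by
  ext i; simp [applyMat, Matrix.sub_mulVec]

lemma norm_applyMat_le {B : Matrix (Fin d) (Fin k) ℝ} {η : ℝ} (hη : 0 ≤ η)
    (hB : ∀ i j, |B i j| ≤ η) (w : EuclideanSpace ℝ (Fin k)) :
    ‖applyMat B w‖ ≤ √(d * k) * η * ‖w‖ := by
  have h : ‖applyMat B w‖ ^ 2 ≤ (√(d * k) * η * ‖w‖) ^ 2 := by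
    rw [mul_pow, mul_pow, Real.sq_sqrt (by positivity), EuclideanSpace.norm_sq_eq]
    refine (Finset.sum_le_sum (g := fun _ => k * η ^ 2 * ‖w‖ ^ 2) fun i _ => ?_).trans
      (by simp; ring_nf; rfl)
    rw [Real.norm_eq_abs, sq_abs, EuclideanSpace.norm_sq_eq]
    refine (Finset.sum_mul_sq_le_sq_mul_sq Finset.univ (B i) w.ofLp).trans ?_
    simp only [Real.norm_eq_abs, sq_abs]
    gcongr
    refine (Finset.sum_le_sum (g := fun _ => η ^ 2) fun j _ => ?_).trans (by simp)
    rw [← sq_abs]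
    exact pow_le_pow_left₀ (abs_nonneg _) (hB i j) 2
  exact (sq_le_sq₀ (norm_nonneg _) (by positivity)).1 h

lemma norm_le_of_coord {η : ℝ} (hη : 0 ≤ η) (w : EuclideanSpace ℝ (Fin k))
    (h : ∀ j, |w j| ≤ η) : ‖w‖ ≤ √k * η := by
  rw [EuclideanSpace.norm_eq]
  refine Real.sqrt_le_iff.2 ⟨by positivity, ?_⟩
  rw [mul_pow, Real.sq_sqrt (by positivity)]
  refine (Finset.sum_le_sum (g := fun _ => η ^ 2) fun j _ => ?_).trans (by simp)
  exact pow_le_pow_left₀ (norm_nonneg _) (h j) 2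

lemma abs_entry_le_one {B : Matrix (Fin d) (Fin k) ℝ} (hB : Bᵀ * B = 1) (i : Fin d) (j : Fin k) :
    |B i j| ≤ 1 := by
  have h : ∑ l, B l j * B l j = 1 := by
    have := congrFun (congrFun hB j) j
    simpa [Matrix.mul_apply] using this
  have h2 : B i j * B i j ≤ 1 := h ▸
    Finset.single_le_sum (f := fun l => B l j * B l j) (fun l _ => mul_self_nonneg _)
      (Finset.mem_univ i)
  rw [← sq_le_one_iff_abs_le_one]
  linarith [sq (B i j)]

/-- The tuples `(B w¹, …, B w^M)` with orthonormal columns of `B` and `‖w i‖ ≤ ρ`. -/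
def orthClass (M d k : ℕ) (ρ : ℝ) : Set (Params M d) :=
  {θ | ∃ (B : Matrix (Fin d) (Fin k) ℝ) (w : Fin M → EuclideanSpace ℝ (Fin k)),
    Bᵀ * B = 1 ∧ ∀ i, ‖w i‖ ≤ ρ ∧ θ i = applyMat B (w i)}

lemma orthClass_mono {ρ ρ' : ℝ} (h : ρ ≤ ρ') : orthClass M d k ρ ⊆ orthClass M d k ρ' := by
  rintro θ ⟨B, w, hB, hw⟩
  exact ⟨B, w, hB, fun i => ⟨(hw i).1.trans h, (hw i).2⟩⟩

/-- Up to the choice of the factorization, `B` may be assumed to have orthonormal columns: the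
Gram–Schmidt basis of the columns of `B` has its first `k` elements span them. -/
lemma lowRankClass_eq (hkd : k ≤ d) (D : ℝ) : lowRankClass M d k D = orthClass M d k D := by
  obtain ⟨m, rfl⟩ := Nat.exists_eq_add_of_le hkd
  refine Set.Subset.antisymm ?_ ?_
  · rintro θ ⟨B, w, h⟩
    let f : Fin (k + m) → EuclideanSpace ℝ (Fin (k + m)) :=
      Fin.addCases (fun j => WithLp.toLp 2 (fun i => B i j)) (fun _ => 0)
    have hcard : Module.finrank ℝ (EuclideanSpace ℝ (Fin (k + m))) =
        Fintype.card (Fin (k + m)) := by simp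
    let b := InnerProductSpace.gramSchmidtOrthonormalBasis hcard f
    have hθ : ∀ i, θ i = ∑ j, (w i).ofLp j • f (Fin.castAdd m j) := by
      intro i
      rw [(h i).1]
      ext l
      simp [f, Matrix.mulVec, dotProduct, mul_comm]
    have hperp : ∀ i (j : Fin m), inner ℝ (b (Fin.natAdd k j)) (θ i) = 0 := by
      intro i j
      rw [hθ, inner_sum]
      refine Finset.sum_eq_zero fun l _ => ?_
      rw [inner_smul_right, InnerProductSpace.gramSchmidtOrthonormalBasis_inv_triangular hcard f,
        mul_zero]
      rw [Fin.lt_def, Fin.val_castAdd, Fin.val_natAdd]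
      omega
    have hB : (Matrix.of fun i j => b (Fin.castAdd m j) i)ᵀ *
        (Matrix.of fun i j => b (Fin.castAdd m j) i) = (1 : Matrix (Fin k) (Fin k) ℝ) := by
      ext i j
      have := orthonormal_iff_ite.1 b.orthonormal (Fin.castAdd m i) (Fin.castAdd m j)
      rw [EuclideanSpace.inner_eq_star_dotProduct] at this
      rw [Matrix.mul_apply, Matrix.one_apply]
      simp only [Fin.castAdd_inj] at this
      rw [← this]
      simp [dotProduct, mul_comm]
    have hrep : ∀ i, θ i = applyMat (Matrix.of fun i j => b (Fin.castAdd m j) i)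
        (WithLp.toLp 2 fun j => inner ℝ (b (Fin.castAdd m j)) (θ i)) := by
      intro i
      conv_lhs => rw [← b.sum_repr' (θ i), Fin.sum_univ_add]
      simp only [hperp, zero_smul, Finset.sum_const_zero, add_zero]
      ext l
      simp [Matrix.mulVec, dotProduct, mul_comm]
    refine ⟨_, _, hB, fun i => ⟨?_, hrep i⟩⟩
    rw [← norm_applyMat hB, ← hrep]
    exact (h i).2
  · rintro θ ⟨B, w, hB, h⟩
    refine ⟨B, w, fun i => ⟨(h i).2, ?_⟩⟩
    rw [(h i).2, norm_applyMat hB]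
    exact (h i).1

lemma isCompact_orthClass (ρ : ℝ) : IsCompact (orthClass M d k ρ) := by
  let K : Set (Matrix (Fin d) (Fin k) ℝ × (Fin M → EuclideanSpace ℝ (Fin k))) :=
    {p | p.1ᵀ * p.1 = 1} ∩ ((Set.univ.pi fun _ => Set.univ.pi fun _ => Set.Icc (-1 : ℝ) 1) ×ˢ
      (Set.univ.pi fun _ => Metric.closedBall 0 ρ))
  have hK : IsCompact K := by
    refine IsCompact.inter_left ?_ ?_
    · exact (isCompact_univ_pi fun _ => isCompact_univ_pi fun _ => isCompact_Icc).prod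
        (isCompact_univ_pi fun _ => isCompact_closedBall _ _)
    · exact isClosed_eq (by fun_prop) continuous_const
  have e : orthClass M d k ρ =
      (fun (p : Matrix (Fin d) (Fin k) ℝ × (Fin M → EuclideanSpace ℝ (Fin k))) i =>
        applyMat p.1 (p.2 i)) '' K := by
    ext θ
    constructor
    · rintro ⟨B, w, hB, hw⟩
      refine ⟨(B, w), ⟨hB, ?_, ?_⟩, funext fun i => (hw i).2.symm⟩
      · exact fun i _ j _ => abs_le.1 (abs_entry_le_one hB i j)
      · exact fun i _ => by simpa using (hw i).1
    · rintro ⟨⟨B, w⟩, ⟨hB, -, hw⟩, rfl⟩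
      exact ⟨B, w, hB, fun i => ⟨by simpa using hw i trivial, rfl⟩⟩
  rw [e]
  refine hK.image ?_
  unfold applyMat
  fun_prop

/-- Finitely many members of a set represent all values on it of a map with finite range. -/
lemma exists_finset_repr {α β : Type*} (s : Set α) (c : α → β) (t : Finset β)
    (h : ∀ x ∈ s, c x ∈ t) :
    ∃ N : Finset α, ↑N ⊆ s ∧ N.card ≤ t.card ∧ ∀ x ∈ s, ∃ y ∈ N, c y = c x := by
  obtain ⟨u, hus, hbij⟩ := Set.exists_subset_bijOn s c
  have hsub : c '' u ⊆ t := by rintro _ ⟨x, hx, rfl⟩; exact h x (hus hx)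
  have hfin : u.Finite := Set.Finite.of_finite_image (t.finite_toSet.subset hsub) hbij.injOn
  refine ⟨hfin.toFinset, by simpa using hus, ?_, fun x hx => ?_⟩
  · refine Finset.card_le_card_of_injOn c (fun x hx => ?_) (by simpa using hbij.injOn)
    exact h x (hus (by simpa using hx))
  · obtain ⟨y, hy, hxy⟩ := hbij.surjOn ⟨x, hx, rfl⟩
    exact ⟨y, by simpa using hy, hxy⟩

lemma abs_sub_le_of_floor_eq {x y η : ℝ} (hη : 0 < η) (h : ⌊x / η⌋ = ⌊y / η⌋) :
    |x - y| ≤ η := by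
  have := Int.abs_sub_lt_one_of_floor_eq_floor h
  rw [← sub_div, abs_div, abs_of_pos hη, div_lt_one hη] at this
  exact this.le

lemma floor_mem_Icc {x r η : ℝ} (hη : 0 < η) (h : |x| ≤ r) :
    ⌊x / η⌋ ∈ Finset.Icc (-⌈r / η⌉) ⌈r / η⌉ := by
  rw [abs_le] at h
  rw [Finset.mem_Icc]
  constructor
  · rw [Int.le_floor, Int.cast_neg]
    have := Int.le_ceil (r / η)
    have h2 : -(r / η) ≤ x / η := by rw [← neg_div]; gcongr; exact h.1
    linarith
  · have h2 : x / η ≤ r / η := by gcongr; exact h.2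
    exact (Int.floor_le_ceil _).trans (Int.ceil_mono h2)

lemma card_Icc_le {r η : ℝ} (hη : 0 < η) (hr : 0 ≤ r) :
    ((Finset.Icc (-⌈r / η⌉) ⌈r / η⌉).card : ℝ) ≤ 2 * (r / η) + 3 := by
  have h0 : 0 ≤ ⌈r / η⌉ := Int.ceil_nonneg (by positivity)
  rw [Int.card_Icc]
  have : (((⌈r / η⌉ + 1 - -⌈r / η⌉).toNat : ℤ) : ℝ) = 2 * (⌈r / η⌉ : ℝ) + 1 := by
    rw [Int.toNat_of_nonneg (by omega)]
    push_cast; ring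
  rw [Int.cast_natCast] at this
  rw [this]
  linarith [Int.ceil_lt_add_one (r / η)]

/-- Nets consisting of members of the given set: rounding the entries of `B` and `w` splits it into
finitely many cells of small diameter, and one member is taken of each. -/
lemma exists_net (hk : 1 ≤ k) (hkd : k ≤ d) {ρ ε : ℝ} (hρ : 1 ≤ ρ) (hε : 0 < ε) (hε1 : ε ≤ 1)
    {s : Set (Params M d)} (hs : s ⊆ orthClass M d k ρ) :
    ∃ N : Finset (Params M d), ↑N ⊆ s ∧
      (N.card : ℝ) ≤ (7 * ρ * √(d * k) / ε) ^ (d * k) * (7 * ρ * √k / ε) ^ (M * k) ∧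
      ∀ θ ∈ s, ∃ θ' ∈ N, ∀ i, ‖θ i - θ' i‖ ≤ ε := by
  choose! B w hB hw using fun θ (h : θ ∈ s) => hs h
  have hk0 : (1 : ℝ) ≤ k := by exact_mod_cast hk
  have hd0 : (1 : ℝ) ≤ d := by exact_mod_cast hk.trans hkd
  have hk1 : 1 ≤ √k := Real.one_le_sqrt.2 hk0
  have hdk1 : 1 ≤ √(d * k) := Real.one_le_sqrt.2 (by nlinarith)
  set η₁ := ε / (2 * ρ * √(d * k)) with hη₁
  set η₂ := ε / (2 * √k) with hη₂
  have h1 : 0 < η₁ := by positivity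
  have h2 : 0 < η₂ := by positivity
  let c : Params M d → (Fin d → Fin k → ℤ) × (Fin M → Fin k → ℤ) := fun θ =>
    (fun i j => ⌊B θ i j / η₁⌋, fun i j => ⌊w θ i j / η₂⌋)
  obtain ⟨N, hN, hcard, hrep⟩ := exists_finset_repr s c
    ((Fintype.piFinset fun _ => Fintype.piFinset fun _ => Finset.Icc (-⌈1 / η₁⌉) ⌈1 / η₁⌉) ×ˢ
      (Fintype.piFinset fun _ => Fintype.piFinset fun _ => Finset.Icc (-⌈ρ / η₂⌉) ⌈ρ / η₂⌉)) (by
    intro θ hθ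
    simp only [Finset.mem_product, Fintype.mem_piFinset]
    refine ⟨fun i j => floor_mem_Icc h1 (abs_entry_le_one (hB θ hθ) i j),
      fun i j => floor_mem_Icc h2 ?_⟩
    exact (PiLp.norm_apply_le (w θ i) j).trans (hw θ hθ i).1)
  refine ⟨N, hN, ?_, fun θ hθ => ?_⟩
  · refine (Nat.cast_le.2 hcard).trans ?_
    simp only [Finset.card_product, Fintype.card_piFinset, Finset.prod_const, Finset.card_univ,
      Fintype.card_fin, ← pow_mul]
    push_cast
    rw [mul_comm k d, mul_comm k M]
    gcongr
    · refine (card_Icc_le h1 zero_le_one).trans ?_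
      have : 1 ≤ ρ * √(d * k) / ε := by
        rw [le_div_iff₀ hε]; nlinarith
      have e : 1 / η₁ = 2 * (ρ * √(d * k) / ε) := by rw [hη₁]; field_simp
      have e2 : 7 * ρ * √(d * k) / ε = 7 * (ρ * √(d * k) / ε) := by ring
      rw [e, e2]; linarith
    · refine (card_Icc_le h2 (by linarith)).trans ?_
      have : 1 ≤ ρ * √k / ε := by
        rw [le_div_iff₀ hε]; nlinarith
      have e : ρ / η₂ = 2 * (ρ * √k / ε) := by rw [hη₂]; field_simp
      have e2 : 7 * ρ * √k / ε = 7 * (ρ * √k / ε) := by ring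
      rw [e, e2]; linarith
  · obtain ⟨θ', hθ', hc⟩ := hrep θ hθ
    have hθ's := hN hθ'
    refine ⟨θ', hθ', fun i => ?_⟩
    have hc1 : ∀ i j, ⌊B θ i j / η₁⌋ = ⌊B θ' i j / η₁⌋ := fun i j =>
      (congrFun (congrFun (congrArg Prod.fst hc) i) j).symm
    have hc2 : ∀ i j, ⌊w θ i j / η₂⌋ = ⌊w θ' i j / η₂⌋ := fun i j =>
      (congrFun (congrFun (congrArg Prod.snd hc) i) j).symm
    have e : θ i - θ' i = applyMat (B θ - B θ') (w θ i) + applyMat (B θ') (w θ i - w θ' i) := by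
      rw [(hw θ hθ i).2, (hw θ' hθ's i).2, sub_applyMat, applyMat_sub]; abel
    rw [e]
    refine (norm_add_le _ _).trans ?_
    have b1 : ‖applyMat (B θ - B θ') (w θ i)‖ ≤ ε / 2 := by
      refine (norm_applyMat_le h1.le
        (fun a b => abs_sub_le_of_floor_eq h1 (hc1 a b)) _).trans ?_
      calc √(d * k) * η₁ * ‖w θ i‖ ≤ √(d * k) * η₁ * ρ := by gcongr; exact (hw θ hθ i).1
        _ = ε / 2 := by rw [hη₁]; field_simp
    have b2 : ‖applyMat (B θ') (w θ i - w θ' i)‖ ≤ ε / 2 := by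
      rw [norm_applyMat (hB θ' hθ's)]
      refine (norm_le_of_coord h2.le _ fun j => abs_sub_le_of_floor_eq h2 (hc2 i j)).trans ?_
      rw [hη₂]; apply le_of_eq; field_simp
    linarith

end LowRank

namespace MultiTask

variable {S A : Type*} [MeasurableSpace S] [MeasurableSpace A] {M d : ℕ}

lemma jointClass_subset_orthClass (E : MultiTask S A M d) {k H h : ℕ} (hh : h < H) :
    E.jointClass k H h ⊆ orthClass M d k 1 := by
  intro θ hθ
  rw [jointClass, if_pos hh] at hθ
  obtain ⟨B, w, hB, hw⟩ := hθ
  exact ⟨B, w, hB, fun i => ⟨(hw i).1, (hw i).2.1⟩⟩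

lemma norm_le_one_of_mem (E : MultiTask S A M d) {k H h : ℕ} {θ : Params M d}
    (hθ : θ ∈ E.jointClass k H h) (i : Fin M) : ‖θ i‖ ≤ 1 := by
  by_cases hh : h < H
  · obtain ⟨B, w, hB, hw⟩ := E.jointClass_subset_orthClass hh hθ
    rw [(hw i).2, norm_applyMat hB]
    exact (hw i).1
  · rw [jointClass, if_neg hh] at hθ
    rw [show θ = 0 from hθ]
    simp

lemma exists_leastSquares (E : MultiTask S A M d) {k : ℕ} (hkd : k ≤ d) {D : ℝ} (hD : 0 ≤ D)
    (x : Data S A M) (t h : ℕ) (θ' : Params M d) :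
    ∃ θh ∈ lowRankClass M d k D, ∀ θ ∈ lowRankClass M d k D,
      E.loss x t h θ' θh ≤ E.loss x t h θ' θ := by
  have hc : IsCompact (lowRankClass M d k D) := by
    rw [lowRankClass_eq hkd]; exact isCompact_orthClass D
  have hne : (lowRankClass M d k D).Nonempty :=
    ⟨0, 0, 0, fun i => ⟨by ext; simp, by simpa using hD⟩⟩
  have hcont : Continuous fun θ : Params M d => E.loss x t h θ' θ := by
    unfold loss qLin
    fun_prop
  obtain ⟨θh, h1, h2⟩ := hc.exists_isMinOn hne hcont.continuousOn
  exact ⟨θh, h1, fun θ hθ => h2 hθ⟩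

end MultiTask

/-! ### Exponential tail bounds -/

lemma measurable_uncurry_comp {X Y W Z : Type*} {mX : MeasurableSpace X} [MeasurableSpace Y]
    [MeasurableSpace W] [MeasurableSpace Z] {F : W × Y → Z} (hF : Measurable F) {w : X → W}
    (hw : Measurable w) : Measurable (Function.uncurry fun x y => F (w x, y)) :=
  hF.comp (measurable_prodMap_id hw)

/-- Hoeffding's lemma in the form of a supermartingale increment. -/
lemma lintegral_exp_le_one {X : Type*} [MeasurableSpace X] {μ : Measure X} [IsProbabilityMeasure μ]
    {f : X → ℝ} (hf : AEMeasurable f μ) {b : ℝ} (hb : ∀ᵐ x ∂μ, |f x| ≤ b)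
    (h0 : ∫ x, f x ∂μ = 0) (c : ℝ) :
    ∫⁻ x, ENNReal.ofReal (Real.exp (c * f x - (c * b) ^ 2 / 2)) ∂μ ≤ 1 := by
  have hsub := hasSubgaussianMGF_of_mem_Icc_of_integral_eq_zero (a := -b) (b := b) hf
    (hb.mono fun x hx => abs_le.1 hx) h0
  have hmgf := hsub.mgf_le c
  have hint := hsub.integrable_exp_mul c
  have e : ((((‖b - -b‖₊ / 2) ^ 2 : NNReal) : ℝ)) = b ^ 2 := by
    push_cast
    rw [Real.norm_eq_abs, div_pow, sq_abs]
    ring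
  rw [e, mgf] at hmgf
  have e2 : ∀ x, Real.exp (c * f x - (c * b) ^ 2 / 2) =
      Real.exp (c * f x) * Real.exp (-((c * b) ^ 2 / 2)) := fun x => by
    rw [← Real.exp_add, sub_eq_add_neg]
  simp_rw [e2]
  rw [← ofReal_integral_eq_lintegral_ofReal (hint.mul_const _)
    (.of_forall fun x => by positivity), integral_mul_const, ENNReal.ofReal_le_one]
  calc _ ≤ Real.exp (b ^ 2 * c ^ 2 / 2) * Real.exp (-((c * b) ^ 2 / 2)) := by gcongr
    _ = 1 := by rw [← Real.exp_add, Real.exp_eq_one_iff]; ring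

namespace MultiTask

variable {S A : Type*} [MeasurableSpace S] [MeasurableSpace A] {M d : ℕ}

/-- The noise of the regression target `R + V_{h+1}(θ)(s')` around its mean. -/
noncomputable def noise (E : MultiTask S A M d) (i : Fin M) (h : ℕ) (θ : EuclideanSpace ℝ (Fin d))
    (x : S × A) (y : ℝ × S) : ℝ :=
  y.1 + E.vLin (h + 1) θ y.2 - (E.mdp i).bellman h (E.qLin (h + 1) θ) x.1 x.2

lemma measurable_noise (E : MultiTask S A M d) (i : Fin M) (h : ℕ)
    (θ : EuclideanSpace ℝ (Fin d)) :
    Measurable fun z : (S × A) × (ℝ × S) => E.noise i h θ z.1 z.2 :=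
  ((measurable_fst.comp measurable_snd).add
    ((E.measurable_max (h + 1) θ).comp (measurable_snd.comp measurable_snd))).sub
    ((E.measurable_bellman i h θ).comp measurable_fst)

lemma measurable_qLin (E : MultiTask S A M d) (h : ℕ) (θ : EuclideanSpace ℝ (Fin d)) :
    Measurable fun x : S × A => E.qLin h θ x.1 x.2 :=
  (E.measurable_φ h).inner measurable_const

lemma abs_vLin_sub_le_of_mem [Nonempty A] (E : MultiTask S A M d) {k H : ℕ}
    (hφ : ∀ h < H, ∀ s a, ‖E.φ h s a‖ ≤ 1) {h : ℕ} {θ θ' : Params M d}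
    (hθ : θ ∈ E.jointClass k H h) (hθ' : θ' ∈ E.jointClass k H h) (i : Fin M) (s : S) :
    |E.vLin h (θ i) s - E.vLin h (θ' i) s| ≤ ‖θ i - θ' i‖ := by
  by_cases hh : h < H
  · exact E.abs_vLin_sub_le (hφ h hh) _ _ s
  · rw [jointClass, if_neg hh] at hθ hθ'
    rw [show θ = 0 from hθ, show θ' = 0 from hθ']
    simp

lemma integrable_vLin_of_mem [Nonempty A] (E : MultiTask S A M d) {k H : ℕ}
    (hφ : ∀ h < H, ∀ s a, ‖E.φ h s a‖ ≤ 1) {h : ℕ} {θ : Params M d}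
    (hθ : θ ∈ E.jointClass k H h) (i : Fin M) (μ : Measure S) [IsFiniteMeasure μ] :
    Integrable (E.vLin h (θ i)) μ := by
  by_cases hh : h < H
  · exact E.integrable_vLin (hφ h hh) _ _
  · rw [jointClass, if_neg hh] at hθ
    rw [show θ = 0 from hθ, show E.vLin h ((0 : Params M d) i) = fun _ => 0 from
      funext fun s => E.vLin_zero h s]
    exact integrable_const _

lemma abs_bellman_sub_le_of_mem [Nonempty A] (E : MultiTask S A M d) {k H : ℕ}
    (hφ : ∀ h < H, ∀ s a, ‖E.φ h s a‖ ≤ 1) {h : ℕ} {θ θ' : Params M d}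
    (hθ : θ ∈ E.jointClass k H (h + 1)) (hθ' : θ' ∈ E.jointClass k H (h + 1)) (i : Fin M)
    (s : S) (a : A) :
    |(E.mdp i).bellman h (E.qLin (h + 1) (θ i)) s a -
      (E.mdp i).bellman h (E.qLin (h + 1) (θ' i)) s a| ≤ ‖θ i - θ' i‖ := by
  rw [bellman_eq, bellman_eq, add_sub_add_left_eq_sub, ← integral_sub
    (E.integrable_vLin_of_mem hφ hθ i _) (E.integrable_vLin_of_mem hφ hθ' i _)]
  exact abs_integral_le_of_forall fun x => E.abs_vLin_sub_le_of_mem hφ hθ hθ' i x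

lemma integral_noise [Nonempty A] (E : MultiTask S A M d) {k H : ℕ}
    (hφ : ∀ h < H, ∀ s a, ‖E.φ h s a‖ ≤ 1) {h : ℕ} {θ : Params M d}
    (hθ : θ ∈ E.jointClass k H (h + 1)) (i : Fin M) (x : S × A) :
    ∫ y, E.noise i h (θ i) x y ∂((E.mdp i).step h x) = 0 := by
  have h1 := (E.mdp i).integrable_reward h x
  have h2 : Integrable (fun y : ℝ × S => E.vLin (h + 1) (θ i) y.2) ((E.mdp i).step h x) := by
    have := E.integrable_vLin_of_mem hφ hθ i (((E.mdp i).step h x).map Prod.snd)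
    exact this.comp_measurable measurable_snd
  have h3 : Integrable (fun y : ℝ × S => y.1 + E.vLin (h + 1) (θ i) y.2) ((E.mdp i).step h x) :=
    h1.add h2
  simp only [noise]
  rw [integral_sub h3 (integrable_const _), integral_add h1 h2, bellman_eq,
    (E.mdp i).integral_trans h _ (f := E.vLin (h + 1) (θ i)) (E.measurable_max (h + 1) (θ i))]
  simp [EpisodicMDP.reward]

end MultiTask

namespace MultiTask.Run

variable {S A : Type*} [MeasurableSpace S] [MeasurableSpace A] {M d k H T : ℕ} {D α : ℝ}
  {E : MultiTask S A M d} {Ω : Type*} [MeasurableSpace Ω] {P : Measure Ω}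

/-- Chernoff's bound for sums over episodes and tasks whose terms have conditional exponential
moment at most `1`. -/
lemma measure_sum_gt_le [IsProbabilityMeasure P] (r : E.Run k H T D α P) {h : ℕ}
    (hh : h < H) {g : ℕ → Fin M → Ω → ℝ × S → ℝ}
    (hg : ∀ t < T, ∀ i, Measurable[(r.𝓕 t h).prod inferInstance] (Function.uncurry (g t i)))
    (hle : ∀ t < T, ∀ i ω,
      ∫⁻ v, ENNReal.ofReal (Real.exp (g t i ω v)) ∂((E.mdp i).step h (r.sa t h i ω)) ≤ 1)
    {t : ℕ} (ht : t ≤ T) (l : ℝ) :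
    P {ω | l < ∑ j ∈ Finset.range t, ∑ i, g j i ω (r.obs j h ω i)} ≤
      ENNReal.ofReal (Real.exp (-l)) := by
  have key := r.lintegral_prod_prod_le_one hh
    (G := fun t i ω v => ENNReal.ofReal (Real.exp (g t i ω v)))
    (fun t ht i => ENNReal.measurable_ofReal.comp (Real.measurable_exp.comp (hg t ht i)))
    hle t ht
  have e : ∀ ω, ∏ j ∈ Finset.range t, ∏ i, ENNReal.ofReal (Real.exp (g j i ω (r.obs j h ω i))) =
      ENNReal.ofReal (Real.exp (∑ j ∈ Finset.range t, ∑ i, g j i ω (r.obs j h ω i))) := by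
    intro ω
    rw [Real.exp_sum, ENNReal.ofReal_prod_of_nonneg fun _ _ => (Real.exp_pos _).le]
    refine Finset.prod_congr rfl fun j _ => ?_
    rw [Real.exp_sum, ENNReal.ofReal_prod_of_nonneg fun _ _ => (Real.exp_pos _).le]
  simp only [e] at key
  have hm : Measurable fun ω => ∑ j ∈ Finset.range t, ∑ i, g j i ω (r.obs j h ω i) := by
    refine Finset.measurable_sum _ fun j hj => Finset.measurable_sum _ fun i _ => ?_
    have hj' : j < T := (Finset.mem_range.1 hj).trans_le ht
    exact measurable_comp_graph (r.le_space j h) (hg j hj' i)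
      ((r.measurable_obs hj' hh i).mono (r.le_space j (h + 1)) le_rfl)
  have hmark := mul_meas_ge_le_lintegral (μ := P)
    (ENNReal.measurable_ofReal.comp (Real.measurable_exp.comp hm))
    (ENNReal.ofReal (Real.exp l))
  have h1 : P {ω | l < ∑ j ∈ Finset.range t, ∑ i, g j i ω (r.obs j h ω i)} ≤
      P {ω | ENNReal.ofReal (Real.exp l) ≤
        ENNReal.ofReal (Real.exp (∑ j ∈ Finset.range t, ∑ i, g j i ω (r.obs j h ω i)))} := by
    refine measure_mono fun ω hω => ?_
    exact ENNReal.ofReal_le_ofReal (Real.exp_le_exp.2 (_root_.le_of_lt hω))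
  refine h1.trans ?_
  have h2 := hmark.trans key
  rw [Real.exp_neg, ENNReal.ofReal_inv_of_pos (Real.exp_pos l)]
  rw [ENNReal.le_inv_iff_mul_le, mul_comm]
  exact h2

/-- The deviation of the noise for fixed parameters `θ` of the next step, in a fixed direction
`Δ`. -/
lemma measure_noise_gt_le [IsProbabilityMeasure P] [Nonempty A] (r : E.Run k H T D α P)
    (hE : E.Regular k H D) {h : ℕ} (hh : h < H) {θ : Params M d}
    (hθ : θ ∈ E.jointClass k H (h + 1)) (Δ : Params M d) (c : ℝ) {t : ℕ} (ht : t ≤ T) (l : ℝ) :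
    P {ω | l < ∑ j ∈ Finset.range t, ∑ i,
      (c * E.qLin h (Δ i) (r.sa j h i ω).1 (r.sa j h i ω).2 *
        E.noise i h (θ i) (r.sa j h i ω) (r.obs j h ω i) -
        (c * E.qLin h (Δ i) (r.sa j h i ω).1 (r.sa j h i ω).2) ^ 2 / 2)} ≤
      ENNReal.ofReal (Real.exp (-l)) := by
  refine r.measure_sum_gt_le hh (g := fun j i ω v =>
    c * E.qLin h (Δ i) (r.sa j h i ω).1 (r.sa j h i ω).2 * E.noise i h (θ i) (r.sa j h i ω) v -
      (c * E.qLin h (Δ i) (r.sa j h i ω).1 (r.sa j h i ω).2) ^ 2 / 2) ?_ ?_ ht l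
  · intro j hj i
    have hq : Measurable fun z : (S × A) × (ℝ × S) => c * E.qLin h (Δ i) z.1.1 z.1.2 :=
      ((E.measurable_qLin h (Δ i)).comp measurable_fst).const_mul c
    have hF : Measurable fun z : (S × A) × (ℝ × S) => c * E.qLin h (Δ i) z.1.1 z.1.2 *
        E.noise i h (θ i) z.1 z.2 - (c * E.qLin h (Δ i) z.1.1 z.1.2) ^ 2 / 2 :=
      (hq.mul (E.measurable_noise i h (θ i))).sub ((hq.pow_const 2).div_const 2)
    exact measurable_uncurry_comp hF (r.measurable_sa hj hh i)
  · intro j hj i ω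
    have := lintegral_exp_le_one (μ := (E.mdp i).step h (r.sa j h i ω)) (b := 1)
      (f := E.noise i h (θ i) (r.sa j h i ω))
      ((E.measurable_noise i h (θ i)).comp measurable_prodMk_left).aemeasurable
      (hE.noise_bound h hh θ hθ i _ _) (E.integral_noise hE.norm_feature hθ i _)
      (c * E.qLin h (Δ i) (r.sa j h i ω).1 (r.sa j h i ω).2)
    simpa only [mul_one] using this

lemma ae_abs_noise_le [IsProbabilityMeasure P] (r : E.Run k H T D α P)
    (hE : E.Regular k H D) {h t : ℕ} (hh : h < H) (ht : t < T) {θ : Params M d}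
    (hθ : θ ∈ E.jointClass k H (h + 1)) (i : Fin M) :
    ∀ᵐ ω ∂P, |E.noise i h (θ i) (r.sa t h i ω) (r.obs t h ω i)| ≤ 1 :=
  r.ae_obs ht hh i (p := fun x y => |E.noise i h (θ i) x y| ≤ 1)
    (measurableSet_le (continuous_abs.measurable.comp (E.measurable_noise i h (θ i)))
      measurable_const)
    fun x => hE.noise_bound h hh θ hθ i x.1 x.2

end MultiTask.Run

/-! ### The least-squares estimates -/

/-- `X ≤ b + 2F` follows from a quadratic inequality in which the noise was bounded with the
deterministic parameter `c = F / (b + 2F)`: at `X = b + 2F` the two sides are equal, so that no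
union bound over the scale of `X` is needed. -/
lemma le_of_quadratic {b F X c : ℝ} (hb : 0 ≤ b) (hF : 0 < F)
    (hc : c * (b + 2 * F) = F) (h : c * X ^ 2 ≤ F ^ 2 + c ^ 2 * X ^ 2 + c * b * X) :
    X ≤ b + 2 * F := by
  have hY : 0 < b + 2 * F := by positivity
  have hc0 : 0 < c := by
    by_contra hcon
    nlinarith
  by_contra! hcon
  obtain ⟨δ, hδ, rfl⟩ : ∃ δ, 0 < δ ∧ X = b + 2 * F + δ := ⟨X - (b + 2 * F), by linarith, by ring⟩
  have hc1 : c < 1 := by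
    by_contra hcon
    nlinarith
  -- the difference of the sides is `c δ (b + 2F) + c (1 - c) δ²`
  have e : c * (b + 2 * F + δ) ^ 2 - (F ^ 2 + c ^ 2 * (b + 2 * F + δ) ^ 2 +
      c * b * (b + 2 * F + δ)) = c * δ * (b + 2 * F) + c * (1 - c) * δ ^ 2 := by
    have : F ^ 2 + c ^ 2 * (b + 2 * F + δ) ^ 2 = F ^ 2 + (c * (b + 2 * F)) ^ 2 +
      2 * (c * (b + 2 * F)) * c * δ + c ^ 2 * δ ^ 2 := by ring
    rw [this, hc]
    linear_combination (2 * F) * hc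
  have h1 : 0 < c * δ * (b + 2 * F) := by positivity
  have h2 : 0 < c * (1 - c) * δ ^ 2 := by
    have : 0 < 1 - c := by linarith
    positivity
  linarith

/-- The deterministic core of the analysis of least squares. The predictions of the estimate are
`z + v`, those of a nearly unbiased competitor are `z`, and `u` is an approximation of `v` for which
the noise `η` is under control. -/
lemma sqrt_sum_sq_le {ι : Type*} (s : Finset ι) {z v u y η : ι → ℝ} {m κ b F l c ε ρ : ℝ}
    (hcard : (s.card : ℝ) ≤ m) (hκ0 : 0 ≤ κ) (hb : 2 * √m * κ ≤ b) (hF : 0 < F)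
    (hFl : 2 * (l + 1) ≤ F ^ 2) (hc : c * (b + 2 * F) = F)
    (hρ : 1 ≤ ρ) (hε : 0 ≤ ε) (hεm : 7 * ρ * (m * ε) ≤ 1) (hε1 : ε ≤ 1)
    (hη : ∀ p ∈ s, |η p| ≤ 1) (hv : ∀ p ∈ s, |v p| ≤ 2 * ρ) (huv : ∀ p ∈ s, |v p - u p| ≤ ε)
    (hbias : ∀ p ∈ s, |y p - z p - η p| ≤ κ)
    (hls : ∑ p ∈ s, (z p + v p - y p) ^ 2 ≤ ∑ p ∈ s, (z p - y p) ^ 2)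
    (hconc : ∑ p ∈ s, (c * u p * η p - (c * u p) ^ 2 / 2) ≤ l) :
    √(∑ p ∈ s, v p ^ 2) ≤ b + 2 * F := by
  have hm0 : 0 ≤ m := (Nat.cast_nonneg _).trans hcard
  have hb0 : 0 ≤ b := le_trans (by positivity) hb
  have hY : 0 < b + 2 * F := by positivity
  have hc0 : 0 < c := by
    by_contra hcon
    nlinarith
  have hc2 : c ≤ 1 / 2 := by
    by_contra! hcon
    nlinarith
  set X := √(∑ p ∈ s, v p ^ 2) with hX
  have hX0 : 0 ≤ X := Real.sqrt_nonneg _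
  have hX2 : X ^ 2 = ∑ p ∈ s, v p ^ 2 := Real.sq_sqrt (Finset.sum_nonneg fun _ _ => sq_nonneg _)
  have hnε : s.card * ε ≤ m * ε := by gcongr
  have hmε : m * ε ≤ 1 / 7 := by
    have : 0 ≤ m * ε := by positivity
    nlinarith
  -- the basic inequality of least squares
  have h1 : X ^ 2 ≤ 2 * ∑ p ∈ s, v p * η p + 2 * ∑ p ∈ s, |v p| * κ := by
    have e : ∑ p ∈ s, (z p + v p - y p) ^ 2 = ∑ p ∈ s, (z p - y p) ^ 2 +
        (∑ p ∈ s, v p ^ 2 - 2 * ∑ p ∈ s, v p * (y p - z p)) := by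
      rw [Finset.mul_sum, ← Finset.sum_sub_distrib, ← Finset.sum_add_distrib]
      exact Finset.sum_congr rfl fun p _ => by ring
    have h2 : ∑ p ∈ s, v p * (y p - z p) ≤ ∑ p ∈ s, v p * η p + ∑ p ∈ s, |v p| * κ := by
      rw [← Finset.sum_add_distrib]
      refine Finset.sum_le_sum fun p hp => ?_
      have h3 : v p * (y p - z p - η p) ≤ |v p| * κ := by
        refine (le_abs_self _).trans ?_
        rw [abs_mul]
        exact mul_le_mul_of_nonneg_left (hbias p hp) (abs_nonneg _)
      linarith
    linarith
  have h2 : 2 * ∑ p ∈ s, |v p| * κ ≤ b * X := by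
    have h3 : ∑ p ∈ s, |v p| ≤ √m * X := by
      rw [hX, ← Real.sqrt_mul hm0]
      refine Real.le_sqrt_of_sq_le ((sq_sum_le_card_mul_sum_sq).trans ?_)
      simp only [sq_abs]
      gcongr
    rw [← Finset.sum_mul]
    calc 2 * ((∑ p ∈ s, |v p|) * κ) ≤ 2 * ((√m * X) * κ) := by gcongr
      _ = (2 * √m * κ) * X := by ring
      _ ≤ b * X := by gcongr
  have h3 : ∑ p ∈ s, v p * η p ≤ ∑ p ∈ s, u p * η p + m * ε := by
    have : ∑ p ∈ s, v p * η p ≤ ∑ p ∈ s, (u p * η p + ε) := by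
      refine Finset.sum_le_sum fun p hp => ?_
      have h4 : (v p - u p) * η p ≤ ε := by
        refine (le_abs_self _).trans ?_
        rw [abs_mul]
        calc _ ≤ ε * 1 := mul_le_mul (huv p hp) (hη p hp) (abs_nonneg _) hε
          _ = ε := mul_one ε
      linarith
    rw [Finset.sum_add_distrib, Finset.sum_const, nsmul_eq_mul] at this
    linarith
  have h4 : ∑ p ∈ s, u p ^ 2 ≤ X ^ 2 + 5 * ρ * (m * ε) := by
    have : ∑ p ∈ s, u p ^ 2 ≤ ∑ p ∈ s, (v p ^ 2 + 5 * ρ * ε) := by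
      refine Finset.sum_le_sum fun p hp => ?_
      have h5 := abs_le.1 (huv p hp)
      have h6 := abs_le.1 (hv p hp)
      have h7 : (u p - v p) * (u p + v p) ≤ ε * (4 * ρ + ε) := by
        refine (le_abs_self _).trans ?_
        rw [abs_mul]
        refine mul_le_mul (abs_le.2 ⟨by linarith, by linarith⟩)
          (abs_le.2 ⟨by linarith, by linarith⟩) (abs_nonneg _) hε
      nlinarith
    rw [Finset.sum_add_distrib, Finset.sum_const, nsmul_eq_mul, ← hX2] at this
    have h8 : s.card * (5 * ρ * ε) ≤ 5 * ρ * (m * ε) := by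
      have : (5 * ρ) * (s.card * ε) ≤ (5 * ρ) * (m * ε) := by gcongr
      linarith
    linarith
  have h5 : c * ∑ p ∈ s, u p * η p ≤ l + c ^ 2 / 2 * ∑ p ∈ s, u p ^ 2 := by
    rw [Finset.sum_sub_distrib] at hconc
    have e1 : ∑ p ∈ s, c * u p * η p = c * ∑ p ∈ s, u p * η p := by
      rw [Finset.mul_sum]; exact Finset.sum_congr rfl fun p _ => by ring
    have e2 : ∑ p ∈ s, (c * u p) ^ 2 / 2 = c ^ 2 / 2 * ∑ p ∈ s, u p ^ 2 := by
      rw [Finset.mul_sum]; exact Finset.sum_congr rfl fun p _ => by ring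
    linarith
  refine le_of_quadratic hb0 hF hc ?_
  have h6 : c ^ 2 / 2 * ∑ p ∈ s, u p ^ 2 ≤ c ^ 2 / 2 * (X ^ 2 + 5 * ρ * (m * ε)) := by gcongr
  have h7 : c ^ 2 / 2 * (5 * ρ * (m * ε)) ≤ 1 / 8 := by
    have : c ^ 2 / 2 ≤ 1 / 8 := by nlinarith
    calc _ ≤ 1 / 8 * 1 := mul_le_mul this (by linarith) (by positivity) (by norm_num)
      _ = 1 / 8 := by norm_num
  have h8 : c * (m * ε) ≤ 1 / 2 * (1 / 7) := by gcongr
  have h9 : c * X ^ 2 ≤ c * (2 * ∑ p ∈ s, v p * η p + b * X) := by gcongr; linarith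
  have h10 : c * ∑ p ∈ s, v p * η p ≤ c * (∑ p ∈ s, u p * η p + m * ε) := by gcongr
  linarith

namespace MultiTask

variable {S A : Type*} [MeasurableSpace S] [MeasurableSpace A] {M d : ℕ}

/-- The Bellman backup of a member of `Θ_{h+1}` is approximated by a member of `Θ_h`. -/
lemma exists_approx (E : MultiTask S A M d) {k H : ℕ} (hI : E.bellmanError k H ≠ ∞) {h : ℕ}
    (hh : h < H) {θ' : Params M d} (hθ' : θ' ∈ E.jointClass k H (h + 1)) {ε : ℝ} (hε : 0 < ε) :
    ∃ θ ∈ E.jointClass k H h, ∀ i s a,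
      |E.qLin h (θ i) s a - (E.mdp i).bellman h (E.qLin (h + 1) (θ' i)) s a| ≤
        (E.bellmanError k H).toReal + ε := by
  have h1 : (⨅ θ ∈ E.jointClass k H h, ⨆ (i : Fin M) (s : S) (a : A),
      ENNReal.ofReal |E.qLin h (θ i) s a - (E.mdp i).bellman h (E.qLin (h + 1) (θ' i)) s a|) ≤
      E.bellmanError k H := by
    unfold bellmanError
    exact le_iSup₂_of_le h (Finset.mem_range.2 hh) (le_iSup₂_of_le θ' hθ' le_rfl)
  have h2 : E.bellmanError k H <
      ENNReal.ofReal ((E.bellmanError k H).toReal + ε) := by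
    rw [← ENNReal.ofReal_toReal hI, ENNReal.toReal_ofReal ENNReal.toReal_nonneg]
    exact (ENNReal.ofReal_lt_ofReal_iff (by positivity)).2 (by linarith)
  obtain ⟨θ, hθ⟩ := iInf_lt_iff.1 (h1.trans_lt h2)
  obtain ⟨hθm, hθ⟩ := iInf_lt_iff.1 hθ
  refine ⟨θ, hθm, fun i s a => ?_⟩
  have h3 := (le_iSup₂_of_le i s (le_iSup (fun a => ENNReal.ofReal
    |E.qLin h (θ i) s a - (E.mdp i).bellman h (E.qLin (h + 1) (θ' i)) s a|) a)).trans hθ.le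
  exact (ENNReal.ofReal_le_ofReal_iff (by positivity)).1 h3

/-- Given the data `x`, the regression at step `h` of episode `t` is accurate: for all admissible
parameters `θ'` of the next step there is a member of `Θ_h` that almost satisfies the Bellman
equation and lies in the confidence set around every least-squares estimate. -/
def Accurate (E : MultiTask S A M d) (k H : ℕ) (D α κ : ℝ) (x : Data S A M) (t h : ℕ) : Prop :=
  ∀ θ' ∈ E.jointClass k H (h + 1), ∃ θ ∈ E.jointClass k H h,
    (∀ i s a, |E.qLin h (θ i) s a -
      (E.mdp i).bellman h (E.qLin (h + 1) (θ' i)) s a| ≤ κ) ∧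
    ∀ θh ∈ lowRankClass M d k D, (∀ θ₁ ∈ lowRankClass M d k D,
      E.loss x t h θ' θh ≤ E.loss x t h θ' θ₁) →
      ∑ i, mahalanobisSq (E.design x t h i) (θh i - θ i) ≤ α

end MultiTask

/-! ### Confidence radius and accuracy of the regressions -/

lemma widthOne_sq (M d k T : ℕ) {δ : ℝ} (hδ : 0 < δ) (hδ1 : δ < 1) :
    widthOne M d k T δ ^ 2 = 9 * k * d * Real.log (k * M * T) + 5 * M * k * Real.log (M * T) +
      2 * Real.log (2 / δ) := by
  have h1 : 0 ≤ Real.log (k * M * T) := by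
    have := Real.log_natCast_nonneg (k * M * T)
    push_cast at this; exact this
  have h2 : 0 ≤ Real.log (M * T) := by
    have := Real.log_natCast_nonneg (M * T)
    push_cast at this; exact this
  have h3 : 0 ≤ Real.log (2 / δ) := Real.log_nonneg (by rw [le_div_iff₀ hδ]; linarith)
  exact Real.sq_sqrt (by positivity)

lemma log_prod_pow {x₁ x₂ x₃ x₄ δ h t : ℝ} (p₁ : 0 < x₁) (p₂ : 0 < x₂) (p₃ : 0 < x₃)
    (p₄ : 0 < x₄) (hδ : 0 < δ) (hh : 0 < h) (ht : 0 < t) (a b : ℕ) :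
    Real.log (2 * ((x₁ ^ a * x₂ ^ b) * (x₃ ^ a * x₄ ^ b) * (h * t)) / δ) =
      a * (Real.log x₁ + Real.log x₃) + b * (Real.log x₂ + Real.log x₄)
      + Real.log h + Real.log t + Real.log (2 / δ) := by
  have : 2 * ((x₁ ^ a * x₂ ^ b) * (x₃ ^ a * x₄ ^ b) * (h * t)) / δ =
    (x₁ ^ a * x₂ ^ b) * (x₃ ^ a * x₄ ^ b) * (h * t) * (2 / δ) := by ring
  rw [this, Real.log_mul (by positivity) (by positivity), Real.log_mul (by positivity)
    (by positivity), Real.log_mul (by positivity) (by positivity), Real.log_mul (by positivity)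
    (by positivity), Real.log_mul (by positivity) (by positivity), Real.log_mul (by positivity)
    (by positivity), Real.log_pow, Real.log_pow, Real.log_pow, Real.log_pow]
  ring

/-- The first confidence width dominates the entropy of the nets for the parameters of the next step
(radius `1`, scale `1 / (4 √(M T))`) and for the least-squares estimates (radius `ρ`, scale
`1 / (7 ρ M T)`). The constants `7 * 4` and `7 * 7 * ρ ^ 2` of their cardinalities are absorbed by
`log T`. -/
lemma entropy_le_widthOne_sq {M d k H T : ℕ} {δ ρ : ℝ} (hM : 5 ≤ M) (hT : 5 ≤ T) (hH : 1 ≤ H)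
    (hk : 1 ≤ k) (hkd : k ≤ d) (hδ : 0 < δ) (hδ1 : δ < 1) (hρ : 1 ≤ ρ)
    (hTbig : H ^ 2 * (d * k) ≤ T) (hTρ : (28 * (49 * ρ ^ 2)) ^ 4 ≤ (T : ℝ)) :
    2 * (Real.log (2 * (((7 * 1 * √(d * k) / (1 / (4 * √(M * T)))) ^ (d * k) *
        (7 * 1 * √k / (1 / (4 * √(M * T)))) ^ (M * k)) *
      ((7 * ρ * √(d * k) / (1 / (7 * ρ * (M * T)))) ^ (d * k) *
        (7 * ρ * √k / (1 / (7 * ρ * (M * T)))) ^ (M * k)) * (H * T)) / δ) + 1) ≤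
      widthOne M d k T δ ^ 2 := by
  have hM0 : (5 : ℝ) ≤ M := by exact_mod_cast hM
  have hT0 : (5 : ℝ) ≤ T := by exact_mod_cast hT
  have hH0 : (1 : ℝ) ≤ H := by exact_mod_cast hH
  have hk0 : (1 : ℝ) ≤ k := by exact_mod_cast hk
  have hd0 : (1 : ℝ) ≤ d := by exact_mod_cast hk.trans hkd
  have hkd0 : (k : ℝ) ≤ d := by exact_mod_cast hkd
  have hTbig0 : (H : ℝ) ^ 2 * (d * k) ≤ T := by exact_mod_cast hTbig
  have hdk : (1 : ℝ) ≤ d * k := by nlinarith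
  have hMk : (1 : ℝ) ≤ M * k := by nlinarith
  have hmT : (T : ℝ) ≤ M * T := by nlinarith
  rw [widthOne_sq M d k T hδ hδ1]
  set L := Real.log (M * T) with hL
  have hlogT : Real.log T ≤ L := Real.log_le_log (by linarith) hmT
  have hLk : L ≤ Real.log (k * M * T) := Real.log_le_log (by positivity) (by nlinarith)
  have hldk : Real.log (d * k) ≤ L := by
    refine (Real.log_le_log (by positivity) ?_).trans hlogT
    nlinarith [one_le_pow₀ hH0 (n := 2)]
  have hlk : Real.log k ≤ L / 2 := by
    have h1 : (k : ℝ) ^ 2 ≤ T := by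
      have : (k : ℝ) ^ 2 ≤ d * k := by nlinarith
      nlinarith [one_le_pow₀ hH0 (n := 2)]
    have h2 := Real.log_le_log (by positivity) h1
    rw [Real.log_pow] at h2
    push_cast at h2
    linarith
  have hlH : Real.log H ≤ L / 2 := by
    have h1 : (H : ℝ) ^ 2 ≤ T := by nlinarith [sq_nonneg (H : ℝ)]
    have h2 := Real.log_le_log (by positivity) h1
    rw [Real.log_pow] at h2
    push_cast at h2
    linarith
  -- the constants of the nets are absorbed by `log T`
  have hc : Real.log 28 + Real.log (49 * ρ ^ 2) ≤ L / 4 := by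
    have h2 := Real.log_le_log (by positivity) hTρ
    rw [Real.log_pow, Real.log_mul (by norm_num) (by positivity)] at h2
    push_cast at h2
    linarith
  have hL4 : 1 ≤ L / 4 := by
    refine le_trans ?_ hc
    have h28 : 1 ≤ Real.log 28 := by
      rw [Real.le_log_iff_exp_le (by norm_num)]
      linarith [Real.exp_one_lt_d9]
    have : 0 ≤ Real.log (49 * ρ ^ 2) := Real.log_nonneg (by nlinarith)
    linarith
  have hm0 : (0 : ℝ) < M * T := by positivity
  have e1 : Real.log (7 * 1 * √(d * k) / (1 / (4 * √(M * T)))) =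
      Real.log 28 + Real.log (d * k) / 2 + L / 2 := by
    have : 7 * 1 * √(d * k) / (1 / (4 * √(M * T))) = 28 * √((d : ℝ) * k) * √((M : ℝ) * T) := by
      field_simp; norm_num
    rw [this, Real.log_mul (by positivity) (by positivity), Real.log_mul (by positivity)
      (by positivity), Real.log_sqrt (by positivity), Real.log_sqrt (by positivity)]
  have e2 : Real.log (7 * 1 * √k / (1 / (4 * √(M * T)))) =
      Real.log 28 + Real.log k / 2 + L / 2 := by
    have : 7 * 1 * √k / (1 / (4 * √(M * T))) = 28 * √(k : ℝ) * √((M : ℝ) * T) := by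
      field_simp; norm_num
    rw [this, Real.log_mul (by positivity) (by positivity), Real.log_mul (by positivity)
      (by positivity), Real.log_sqrt (by positivity), Real.log_sqrt (by positivity)]
  have e3 : Real.log (7 * ρ * √(d * k) / (1 / (7 * ρ * (M * T)))) =
      Real.log (49 * ρ ^ 2) + Real.log (d * k) / 2 + L := by
    have : 7 * ρ * √(d * k) / (1 / (7 * ρ * (M * T))) =
        (49 * ρ ^ 2) * √((d : ℝ) * k) * ((M : ℝ) * T) := by
      field_simp; norm_num
    rw [this, Real.log_mul (by positivity) (by positivity), Real.log_mul (by positivity)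
      (by positivity), Real.log_sqrt (by positivity)]
  have e4 : Real.log (7 * ρ * √k / (1 / (7 * ρ * (M * T)))) =
      Real.log (49 * ρ ^ 2) + Real.log k / 2 + L := by
    have : 7 * ρ * √k / (1 / (7 * ρ * (M * T))) =
        (49 * ρ ^ 2) * √(k : ℝ) * ((M : ℝ) * T) := by
      field_simp; norm_num
    rw [this, Real.log_mul (by positivity) (by positivity), Real.log_mul (by positivity)
      (by positivity), Real.log_sqrt (by positivity)]
  rw [log_prod_pow (by positivity) (by positivity) (by positivity) (by positivity) hδ
    (by positivity) (by positivity) (d * k) (M * k), e1, e2, e3, e4]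
  push_cast
  have b1 : ((d : ℝ) * k) * (Real.log 28 + Real.log (d * k) / 2 + L / 2 + (Real.log (49 * ρ ^ 2) +
      Real.log (d * k) / 2 + L)) ≤ (d * k) * (11 / 4 * L) := by gcongr; linarith
  have b2 : ((M : ℝ) * k) * (Real.log 28 + Real.log k / 2 + L / 2 + (Real.log (49 * ρ ^ 2) +
      Real.log k / 2 + L)) ≤ (M * k) * (9 / 4 * L) := by gcongr; linarith
  have b3 : ((d : ℝ) * k) * L ≤ (d * k) * Real.log (k * M * T) := by gcongr
  have hL0 : 0 ≤ L := by linarith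
  have b4 : L ≤ (d * k) * L := le_mul_of_one_le_left hL0 hdk
  have b5 : 0 ≤ ((M : ℝ) * k) * L := by positivity
  linarith

lemma half_le_widthTwo {M d k T : ℕ} {δ : ℝ} (hk : 1 ≤ k) (hδ : 0 < δ) (hδ1 : δ < 1) :
    1 / 2 ≤ widthTwo M d k T δ := by
  have hk0 : (1 : ℝ) ≤ k := by exact_mod_cast hk
  have h1 : 0 ≤ Real.log (k * M * T) := by
    have := Real.log_natCast_nonneg (k * M * T)
    push_cast at this; exact this
  have h2 : 0 ≤ Real.log (M * T) := by
    have := Real.log_natCast_nonneg (M * T)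
    push_cast at this; exact this
  have h3 : 0 ≤ Real.log (2 / δ) := Real.log_nonneg (by rw [le_div_iff₀ hδ]; linarith)
  unfold widthTwo
  have h4 : (1 : ℝ) ≤ √(k + 5 * k * d * Real.log (k * M * T) + 2 * M * k * Real.log (M * T) +
      Real.log (2 / δ)) := by
    rw [Real.one_le_sqrt]
    have : 0 ≤ 5 * k * d * Real.log (k * M * T) + 2 * M * k * Real.log (M * T) +
      Real.log (2 / δ) := by positivity
    linarith
  linarith [Real.sqrt_nonneg (4 * k * d * Real.log (k * M * T) + 5 * M * k * Real.log (M * T) +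
    2 * Real.log (2 / δ))]

lemma widthOne_pos {M d k T : ℕ} {δ : ℝ} (hδ : 0 < δ) (hδ1 : δ < 1) :
    0 < widthOne M d k T δ := by
  have h1 : 0 ≤ Real.log (k * M * T) := by
    have := Real.log_natCast_nonneg (k * M * T)
    push_cast at this; exact this
  have h2 : 0 ≤ Real.log (M * T) := by
    have := Real.log_natCast_nonneg (M * T)
    push_cast at this; exact this
  have h3 : 0 < Real.log (2 / δ) := Real.log_pos (by rw [lt_div_iff₀ hδ]; linarith)
  exact Real.sqrt_pos.2 (by positivity)

/-- The second width leaves room for the slack `1` of the least-squares bound and for the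
regularization. -/
lemma sq_add_le_radius {M d k T : ℕ} {D I δ : ℝ} (hk : 1 ≤ k) (hδ : 0 < δ) (hδ1 : δ < 1)
    (hI : 0 ≤ I) :
    (2 * √(M * T) * I + 1 + 2 * widthOne M d k T δ) ^ 2 + 4 * M * D ^ 2 ≤
      radius M d k T D I δ := by
  have h1 := half_le_widthTwo (M := M) (d := d) (T := T) hk hδ hδ1
  have h2 := widthOne_pos (M := M) (d := d) (k := k) (T := T) hδ hδ1
  unfold radius
  set q := √(2 * widthTwo M d k T δ + 4 * M * D ^ 2) with hq
  have hMD : 0 ≤ 4 * (M : ℝ) * D ^ 2 := by positivity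
  have hq2 : q ^ 2 = 2 * widthTwo M d k T δ + 4 * M * D ^ 2 := Real.sq_sqrt (by positivity)
  have hq1 : 1 ≤ q := by rw [hq, Real.one_le_sqrt]; linarith
  have ha : 0 ≤ 2 * √(M * T) * I + 2 * widthOne M d k T δ := by positivity
  set a := 2 * √(M * T) * I + 2 * widthOne M d k T δ
  have : 2 * √(M * T) * I + 1 + 2 * widthOne M d k T δ = a + 1 := by ring
  rw [this]
  nlinarith

namespace MultiTask

variable {S A : Type*} [MeasurableSpace S] [MeasurableSpace A] {M d : ℕ}

lemma qLin_sub (E : MultiTask S A M d) (h : ℕ) (θ θ' : EuclideanSpace ℝ (Fin d)) (s : S) (a : A) :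
    E.qLin h (θ - θ') s a = E.qLin h θ s a - E.qLin h θ' s a := by
  simp only [qLin, inner_sub_right]

lemma jointClass_subset (E : MultiTask S A M d) {k H : ℕ} (hkd : k ≤ d) (h : ℕ) :
    E.jointClass k H h ⊆ orthClass M d k 1 := by
  by_cases hh : h < H
  · exact E.jointClass_subset_orthClass hh
  · rw [jointClass, if_neg hh, Set.singleton_subset_iff, ← lowRankClass_eq hkd]
    exact ⟨0, 0, fun i => ⟨by ext; simp, by simp⟩⟩

lemma jointClass_subset_lowRankClass (E : MultiTask S A M d) {k H : ℕ} {D : ℝ}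
    (hE : E.Regular k H D) {h : ℕ} (hh : h < H) : E.jointClass k H h ⊆ lowRankClass M d k D := by
  intro θ hθ
  obtain ⟨B, w, -, hw⟩ := E.jointClass_subset_orthClass hh hθ
  exact ⟨B, w, fun i => ⟨(hw i).2, hE.norm_param h hh θ hθ i⟩⟩

/-- Accuracy of the regression, from bounds on the noise at the points of finite nets. -/
lemma accurate_of_net [Nonempty A] (E : MultiTask S A M d) {k H T : ℕ} {D δ l : ℝ}
    (hE : E.Regular k H D) (hk : 1 ≤ k) (hM : 1 ≤ M) (hT : 1 ≤ T)
    (hδ : 0 < δ) (hδ1 : δ < 1) {h t : ℕ} (hh : h < H) (ht : t ≤ T) (x : Data S A M)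
    (hl : 2 * (l + 1) ≤ widthOne M d k T δ ^ 2)
    (N₁ N₂ : Finset (Params M d)) (hN₁ : ↑N₁ ⊆ E.jointClass k H (h + 1))
    (hnet₁ : ∀ θ ∈ E.jointClass k H (h + 1), ∃ θ' ∈ N₁, ∀ i, ‖θ i - θ' i‖ ≤ 1 / (4 * √(M * T)))
    (hnet₂ : ∀ θ ∈ lowRankClass M d k D,
      ∃ θ' ∈ N₂, ∀ i, ‖θ i - θ' i‖ ≤ 1 / (7 * max D 1 * (M * T)))
    (app : Params M d → Params M d) (happ : ∀ θ ∈ N₁, app θ ∈ E.jointClass k H h)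
    (happ' : ∀ θ ∈ N₁, ∀ i s a, |E.qLin h (app θ i) s a -
      (E.mdp i).bellman h (E.qLin (h + 1) (θ i)) s a| ≤
        (E.bellmanError k H).toReal + 1 / (4 * √(M * T)))
    (hη : ∀ θ ∈ N₁, ∀ j < t, ∀ i,
      |E.noise i h (θ i) (x.s j h i, x.a j h i) (x.R j h i, x.s j (h + 1) i)| ≤ 1)
    (hconc : ∀ θ ∈ N₁, ∀ Δ ∈ N₂, ∑ j ∈ Finset.range t, ∑ i,
      ((widthOne M d k T δ / (2 * √(M * T) * (E.bellmanError k H).toReal + 1 +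
          2 * widthOne M d k T δ)) * E.qLin h ((Δ - app θ) i) (x.s j h i) (x.a j h i) *
        E.noise i h (θ i) (x.s j h i, x.a j h i) (x.R j h i, x.s j (h + 1) i) -
        ((widthOne M d k T δ / (2 * √(M * T) * (E.bellmanError k H).toReal + 1 +
          2 * widthOne M d k T δ)) * E.qLin h ((Δ - app θ) i) (x.s j h i) (x.a j h i)) ^ 2 / 2)
        ≤ l) :
    E.Accurate k H D (radius M d k T D (E.bellmanError k H).toReal δ)
      ((E.bellmanError k H).toReal + 2 * (1 / (4 * √(M * T)))) x t h := by
  have hM0 : (1 : ℝ) ≤ M := by exact_mod_cast hM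
  have hT0 : (1 : ℝ) ≤ T := by exact_mod_cast hT
  have hφ := hE.norm_feature
  have hm : (1 : ℝ) ≤ M * T := by nlinarith
  have hI : 0 ≤ (E.bellmanError k H).toReal := ENNReal.toReal_nonneg
  set I := (E.bellmanError k H).toReal
  set ε₁ := 1 / (4 * √((M : ℝ) * T)) with hε₁
  have hε₁0 : 0 < ε₁ := by positivity
  have hF := widthOne_pos (M := M) (d := d) (k := k) (T := T) hδ hδ1
  set F := widthOne M d k T δ
  set b := 2 * √((M : ℝ) * T) * I + 1 with hb
  have hb0 : 0 ≤ b := by positivity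
  set ρ := max D 1 with hρ
  have hρ1 : 1 ≤ ρ := le_max_right _ _
  intro θ' hθ'
  obtain ⟨θn, hθn, hclose⟩ := hnet₁ θ' hθ'
  have hθnm := hN₁ hθn
  refine ⟨app θn, happ θn hθn, fun i s a => ?_, fun θh hθh hmin => ?_⟩
  · have h1 := happ' θn hθn i s a
    have h2 := (E.abs_bellman_sub_le_of_mem hφ hθ' hθnm i s a).trans (hclose i)
    rw [abs_le] at h1 h2 ⊢
    constructor <;> linarith [h1.1, h1.2, h2.1, h2.2]
  · obtain ⟨Δ, hΔ, hΔc⟩ := hnet₂ θh hθh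
    have happm := happ θn hθn
    have hD : ∀ i, ‖θh i‖ ≤ D := by
      obtain ⟨B, w, hw⟩ := hθh
      exact fun i => (hw i).2
    have hle := hmin (app θn) (E.jointClass_subset_lowRankClass hE hh happm)
    have key := sqrt_sum_sq_le (Finset.range t ×ˢ (Finset.univ : Finset (Fin M)))
      (z := fun p => E.qLin h (app θn p.2) (x.s p.1 h p.2) (x.a p.1 h p.2))
      (v := fun p => E.qLin h (θh p.2 - app θn p.2) (x.s p.1 h p.2) (x.a p.1 h p.2))
      (u := fun p => E.qLin h ((Δ - app θn) p.2) (x.s p.1 h p.2) (x.a p.1 h p.2))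
      (y := fun p => x.R p.1 h p.2 + E.vLin (h + 1) (θ' p.2) (x.s p.1 (h + 1) p.2))
      (η := fun p => E.noise p.2 h (θn p.2) (x.s p.1 h p.2, x.a p.1 h p.2)
        (x.R p.1 h p.2, x.s p.1 (h + 1) p.2))
      (m := M * T) (κ := I + 2 * ε₁) (b := b) (F := F) (l := l) (c := F / (b + 2 * F))
      (ε := 1 / (7 * ρ * (M * T))) (ρ := ρ) ?_ (by positivity) ?_ hF hl
      (by field_simp) hρ1 (by positivity) (by field_simp; norm_num) ?_ ?_ ?_ ?_ ?_ ?_ ?_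
    · have h1 : ∑ i, mahalanobisSq (E.design x t h i) (θh i - app θn i) =
          ∑ p ∈ Finset.range t ×ˢ (Finset.univ : Finset (Fin M)),
            E.qLin h (θh p.2 - app θn p.2) (x.s p.1 h p.2) (x.a p.1 h p.2) ^ 2 +
          ∑ i, ‖θh i - app θn i‖ ^ 2 := by
        simp_rw [mahalanobisSq_design]
        rw [Finset.sum_add_distrib, Finset.sum_comm, ← Finset.sum_product']
      have h2 : ∑ i, ‖θh i - app θn i‖ ^ 2 ≤ 4 * M * D ^ 2 := by
        refine (Finset.sum_le_sum (g := fun _ => (2 * D) ^ 2) fun i _ => ?_).trans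
          (by simp; ring_nf; rfl)
        refine pow_le_pow_left₀ (norm_nonneg _) ((norm_sub_le _ _).trans ?_) 2
        linarith [hD i, hE.norm_param h hh _ happm i]
      have h3 := pow_le_pow_left₀ (Real.sqrt_nonneg _) key 2
      rw [Real.sq_sqrt (Finset.sum_nonneg fun _ _ => sq_nonneg _)] at h3
      rw [h1]
      exact (add_le_add h3 h2).trans (sq_add_le_radius hk hδ hδ1 hI)
    · simp only [Finset.card_product, Finset.card_range, Finset.card_univ, Fintype.card_fin]
      push_cast
      rw [mul_comm]
      have : (t : ℝ) ≤ T := by exact_mod_cast ht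
      gcongr
    · rw [hb, hε₁]
      apply le_of_eq
      field_simp
      ring
    · rw [div_le_one (by positivity)]
      nlinarith [mul_nonneg (sub_nonneg.2 hρ1) (sub_nonneg.2 hm)]
    · rintro ⟨j, i⟩ hp
      simp only [Finset.mem_product, Finset.mem_range] at hp
      exact hη θn hθn j hp.1 i
    · rintro ⟨j, i⟩ -
      refine (E.abs_qLin_le (hφ h hh) _ _ _).trans ((norm_sub_le _ _).trans ?_)
      have h1 : D ≤ ρ := le_max_left _ _
      linarith [hD i, E.norm_le_one_of_mem happm i]
    · rintro ⟨j, i⟩ -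
      rw [← qLin_sub]
      refine (E.abs_qLin_le (hφ h hh) _ _ _).trans ?_
      have : θh i - app θn i - (Δ - app θn) i = θh i - Δ i := by simp
      rw [this]
      exact hΔc i
    · rintro ⟨j, i⟩ -
      have h1 := happ' θn hθn i (x.s j h i) (x.a j h i)
      have h2 := (E.abs_vLin_sub_le_of_mem hφ hθ' hθnm i (x.s j (h + 1) i)).trans (hclose i)
      simp only [noise]
      rw [abs_le] at h1 h2 ⊢
      constructor <;> linarith [h1.1, h1.2, h2.1, h2.2]
    · unfold loss at hle
      rw [Finset.sum_comm, ← Finset.sum_product', Finset.sum_comm, ← Finset.sum_product'] at hle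
      refine le_trans (le_of_eq ?_) (hle.trans (le_of_eq ?_))
      · refine Finset.sum_congr rfl fun p _ => ?_
        rw [qLin_sub]; ring
      · refine Finset.sum_congr rfl fun p _ => ?_
        ring
    · have := hconc θn hθn Δ hΔ
      rw [← Finset.sum_product'] at this
      exact this

end MultiTask

namespace MultiTask.Run

variable {S A : Type*} [MeasurableSpace S] [MeasurableSpace A] {M d k H T : ℕ} {D α δ : ℝ}
  {E : MultiTask S A M d} {Ω : Type*} [MeasurableSpace Ω] {P : Measure Ω}

/-- With high probability all regressions are accurate: a union bound over the steps, the episodes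
and the points of the nets. -/
lemma measure_not_accurate_le [IsProbabilityMeasure P] [Nonempty A] (r : E.Run k H T D α P)
    (hE : E.Regular k H D) (hI : E.bellmanError k H ≠ ∞)
    (hM : 5 ≤ M) (hT : 5 ≤ T) (hH : 1 ≤ H) (hk : 1 ≤ k) (hkd : k ≤ d) (hδ : 0 < δ) (hδ1 : δ < 1)
    (hTbig : H ^ 2 * (d * k) ≤ T) (hTρ : (28 * (49 * (max D 1) ^ 2)) ^ 4 ≤ (T : ℝ)) :
    P {ω | ¬ ∀ h < H, ∀ t < T,
      E.Accurate k H D (radius M d k T D (E.bellmanError k H).toReal δ)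
        ((E.bellmanError k H).toReal + 2 * (1 / (4 * √(M * T)))) (r.data ω) t h} ≤
      ENNReal.ofReal (δ / 2) := by
  have hM0 : (5 : ℝ) ≤ M := by exact_mod_cast hM
  have hT0 : (5 : ℝ) ≤ T := by exact_mod_cast hT
  have hH0 : (1 : ℝ) ≤ H := by exact_mod_cast hH
  have hk0 : (1 : ℝ) ≤ k := by exact_mod_cast hk
  have hd0 : (1 : ℝ) ≤ d := by exact_mod_cast hk.trans hkd
  have hm : (1 : ℝ) ≤ M * T := by nlinarith
  have hsm : 1 ≤ √((M : ℝ) * T) := Real.one_le_sqrt.2 hm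
  have hρ1 : 1 ≤ max D 1 := le_max_right _ _
  have hent := entropy_le_widthOne_sq (M := M) (δ := δ) hM hT hH hk hkd hδ hδ1 hρ1 hTbig hTρ
  have hε₁ : 1 / (4 * √((M : ℝ) * T)) ≤ 1 := by
    rw [div_le_one (by positivity)]; linarith
  have hε₂ : 1 / (7 * max D 1 * ((M : ℝ) * T)) ≤ 1 := by
    rw [div_le_one (by positivity)]
    nlinarith [mul_nonneg (sub_nonneg.2 hρ1) (sub_nonneg.2 hm)]
  choose N₁ hN₁ hcard₁ hnet₁ using fun h => exists_net hk hkd le_rfl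
    (show 0 < 1 / (4 * √((M : ℝ) * T)) by positivity) hε₁
    (E.jointClass_subset (H := H) hkd (h + 1))
  obtain ⟨N₂, -, hcard₂, hnet₂⟩ := exists_net hk hkd hρ1
    (show 0 < 1 / (7 * max D 1 * ((M : ℝ) * T)) by positivity) hε₂
    (show lowRankClass M d k D ⊆ orthClass M d k (max D 1) by
      rw [lowRankClass_eq hkd]; exact orthClass_mono (le_max_left _ _))
  set n₁ : ℝ := (7 * 1 * √(d * k) / (1 / (4 * √(M * T)))) ^ (d * k) *
        (7 * 1 * √k / (1 / (4 * √(M * T)))) ^ (M * k) with hn₁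
  set n₂ : ℝ := (7 * max D 1 * √(d * k) / (1 / (7 * max D 1 * (M * T)))) ^ (d * k) *
        (7 * max D 1 * √k / (1 / (7 * max D 1 * (M * T)))) ^ (M * k) with hn₂
  have hn₁0 : 0 < n₁ := by positivity
  have hn₂0 : 0 < n₂ := by positivity
  set l := Real.log (2 * (n₁ * n₂ * (H * T)) / δ) with hl
  have happ : ∀ h < H, ∀ θ' ∈ N₁ h, ∃ θ ∈ E.jointClass k H h, ∀ i s a,
      |E.qLin h (θ i) s a - (E.mdp i).bellman h (E.qLin (h + 1) (θ' i)) s a| ≤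
        (E.bellmanError k H).toReal + 1 / (4 * √((M : ℝ) * T)) := fun h hh θ' hθ' =>
    E.exists_approx hI hh (hN₁ h hθ') (by positivity)
  choose! app happ₁ happ₂ using happ
  set c := widthOne M d k T δ / (2 * √((M : ℝ) * T) * (E.bellmanError k H).toReal + 1 +
          2 * widthOne M d k T δ)
  let bad : ℕ → ℕ → Params M d → Params M d → Set Ω := fun h t θ Δ =>
    {ω | l < ∑ j ∈ Finset.range t, ∑ i,
      (c * E.qLin h ((Δ - app h θ) i) (r.sa j h i ω).1 (r.sa j h i ω).2 *
        E.noise i h (θ i) (r.sa j h i ω) (r.obs j h ω i) -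
        (c * E.qLin h ((Δ - app h θ) i) (r.sa j h i ω).1 (r.sa j h i ω).2) ^ 2 / 2)}
  have hbad : ∀ h < H, ∀ t < T, ∀ θ ∈ N₁ h, ∀ Δ, P (bad h t θ Δ) ≤
      ENNReal.ofReal (Real.exp (-l)) := fun h hh t ht θ hθ Δ =>
    r.measure_noise_gt_le hE hh (hN₁ h hθ) (Δ - app h θ) c ht.le l
  have hnoise : ∀ᵐ ω ∂P, ∀ h : ℕ, ∀ j : ℕ, ∀ i : Fin M, ∀ θ : N₁ h, h < H → j < T →
      |E.noise i h (θ.1 i) (r.sa j h i ω) (r.obs j h ω i)| ≤ 1 := by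
    refine ae_all_iff.2 fun h => ae_all_iff.2 fun j => ae_all_iff.2 fun i =>
      ae_all_iff.2 fun θ => ?_
    by_cases hh : h < H
    · by_cases hj : j < T
      · filter_upwards [r.ae_abs_noise_le hE hh hj (hN₁ h θ.2) i] with ω hω _ _ using hω
      · exact .of_forall fun ω _ h2 => absurd h2 hj
    · exact .of_forall fun ω h1 => absurd h1 hh
  calc P _ ≤ P (⋃ h ∈ Finset.range H, ⋃ t ∈ Finset.range T, ⋃ θ ∈ N₁ h, ⋃ Δ ∈ N₂,
        bad h t θ Δ) := by
        refine measure_mono_ae ?_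
        filter_upwards [hnoise] with ω hω hnot
        by_contra hcon
        refine hnot fun h hh t ht => ?_
        change ω ∉ ⋃ h ∈ Finset.range H, _ at hcon
        simp only [Set.mem_iUnion, not_exists, Finset.mem_range] at hcon
        exact E.accurate_of_net hE hk (by omega) (by omega) hδ hδ1 hh ht.le (r.data ω) hent
          (N₁ h) N₂ (hN₁ h) (hnet₁ h) hnet₂ (app h) (happ₁ h hh) (happ₂ h hh)
          (fun θ hθ j hj i => hω h j i ⟨θ, hθ⟩ hh (hj.trans ht))
          fun θ hθ Δ hΔ => not_lt.1 (hcon h hh t ht θ hθ Δ hΔ)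
    _ ≤ ∑ h ∈ Finset.range H, ∑ t ∈ Finset.range T, ∑ θ ∈ N₁ h, ∑ Δ ∈ N₂,
          P (bad h t θ Δ) := by
        refine (measure_biUnion_finset_le _ _).trans (Finset.sum_le_sum fun h _ => ?_)
        refine (measure_biUnion_finset_le _ _).trans (Finset.sum_le_sum fun t _ => ?_)
        refine (measure_biUnion_finset_le _ _).trans (Finset.sum_le_sum fun θ _ => ?_)
        exact measure_biUnion_finset_le _ _
    _ ≤ ∑ h ∈ Finset.range H, ∑ t ∈ Finset.range T, ∑ θ ∈ N₁ h, ∑ Δ ∈ N₂,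
          ENNReal.ofReal (Real.exp (-l)) := by
        refine Finset.sum_le_sum fun h hh => Finset.sum_le_sum fun t ht =>
          Finset.sum_le_sum fun θ hθ => Finset.sum_le_sum fun Δ _ => ?_
        exact hbad h (Finset.mem_range.1 hh) t (Finset.mem_range.1 ht) θ hθ Δ
    _ ≤ ∑ h ∈ Finset.range H, ENNReal.ofReal (T * (n₁ * (n₂ * Real.exp (-l)))) := by
        refine Finset.sum_le_sum fun h _ => ?_
        simp only [Finset.sum_const, nsmul_eq_mul, Finset.card_range]
        rw [← ENNReal.ofReal_natCast, ← ENNReal.ofReal_natCast, ← ENNReal.ofReal_natCast,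
          ← ENNReal.ofReal_mul (by positivity), ← ENNReal.ofReal_mul (by positivity),
          ← ENNReal.ofReal_mul (by positivity)]
        refine ENNReal.ofReal_le_ofReal ?_
        gcongr
        exact hcard₁ h
    _ = ENNReal.ofReal (δ / 2) := by
        simp only [Finset.sum_const, nsmul_eq_mul, Finset.card_range]
        rw [← ENNReal.ofReal_natCast, ← ENNReal.ofReal_mul (by positivity)]
        congr 1
        rw [Real.exp_neg, hl, Real.exp_log (by positivity)]
        field_simp

end MultiTask.Run

/-! ### Optimism and regret decomposition -/

section Measurability

variable {X Y W : Type*} {mX : MeasurableSpace X} [MeasurableSpace Y] [MeasurableSpace W]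

lemma measurable_section {f : X → Y → ℝ} (hf : Measurable (Function.uncurry f)) (x : X) :
    Measurable (f x) :=
  hf.comp measurable_prodMk_left

lemma measurable_uncurry_affine {f : X → Y → ℝ} (hf : Measurable (Function.uncurry f))
    (a b : ℝ) : Measurable (Function.uncurry fun x y => a * f x y - b) :=
  (hf.const_mul a).sub_const b

lemma measurable_integral_sub (κ : Kernel W Y) [IsSFiniteKernel κ] {w : X → W} (hw : Measurable w)
    {f : X → Y → ℝ} (hf : Measurable (Function.uncurry f)) :
    Measurable (Function.uncurry fun x (v : ℝ × Y) => ∫ y, f x y ∂κ (w x) - f x v.2) := by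
  have h1 : Measurable fun x => ∫ y, f x y ∂κ (w x) :=
    (hf.stronglyMeasurable.integral_kernel_prod_right' (κ := κ.comap w hw)).measurable
  have h2 : Measurable fun z : X × (ℝ × Y) => f z.1 z.2.2 :=
    hf.comp (measurable_fst.prodMk (measurable_snd.comp measurable_snd))
  exact (h1.comp measurable_fst).sub h2

end Measurability

lemma mahalanobisSq_neg {d : ℕ} (V : Matrix (Fin d) (Fin d) ℝ) (x : EuclideanSpace ℝ (Fin d)) :
    mahalanobisSq V (-x) = mahalanobisSq V x := by
  simp [mahalanobisSq, Matrix.mulVec_neg]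

namespace MultiTask

variable {S A : Type*} [MeasurableSpace S] [MeasurableSpace A] {M d : ℕ}

lemma mahalanobisSq_add_le (E : MultiTask S A M d) (x : Data S A M) (t h : ℕ) (i : Fin M)
    (θ θ' : EuclideanSpace ℝ (Fin d)) :
    mahalanobisSq (E.design x t h i) (θ + θ') ≤
      2 * mahalanobisSq (E.design x t h i) θ + 2 * mahalanobisSq (E.design x t h i) θ' := by
  simp only [mahalanobisSq_design]
  have h1 : ‖θ + θ'‖ ^ 2 ≤ 2 * ‖θ‖ ^ 2 + 2 * ‖θ'‖ ^ 2 := by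
    have := pow_le_pow_left₀ (norm_nonneg _) (norm_add_le θ θ') 2
    nlinarith [sq_nonneg (‖θ‖ - ‖θ'‖)]
  have h2 : ∑ j ∈ Finset.range t, E.qLin h (θ + θ') (x.s j h i) (x.a j h i) ^ 2 ≤
      2 * ∑ j ∈ Finset.range t, E.qLin h θ (x.s j h i) (x.a j h i) ^ 2 +
      2 * ∑ j ∈ Finset.range t, E.qLin h θ' (x.s j h i) (x.a j h i) ^ 2 := by
    rw [Finset.mul_sum, Finset.mul_sum, ← Finset.sum_add_distrib]
    refine Finset.sum_le_sum fun j _ => ?_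
    have e : E.qLin h (θ + θ') (x.s j h i) (x.a j h i) =
        E.qLin h θ (x.s j h i) (x.a j h i) + E.qLin h θ' (x.s j h i) (x.a j h i) := by
      simp only [qLin, inner_add_right]
    rw [e]
    nlinarith [sq_nonneg (E.qLin h θ (x.s j h i) (x.a j h i) - E.qLin h θ' (x.s j h i) (x.a j h i))]
  linarith

/-- If all regressions of an episode are accurate, then its program is feasible, with a solution
that almost satisfies the Bellman optimality equations. -/
lemma exists_feasible (E : MultiTask S A M d) {k H : ℕ} {D α κ : ℝ} (hE : E.Regular k H D)
    (hkd : k ≤ d) (hM : 1 ≤ M) {x : Data S A M} {t : ℕ}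
    (hacc : ∀ h < H, E.Accurate k H D α κ x t h) :
    ∃ ξ θh θ, E.Feasible k H D α x t ξ θh θ ∧ ∀ h < H, ∀ i s a,
      |E.qLin h (θ h i) s a - (E.mdp i).bellman h (E.qLin (h + 1) (θ (h + 1) i)) s a| ≤ κ := by
  choose! f hf hBell hconf using hacc
  let g : ℕ → Params M d := fun n => Nat.rec 0 (fun n θ => f (H - n - 1) θ) n
  have hstep : ∀ h < H, g (H - h) = f h (g (H - (h + 1))) := by
    intro h hh
    have e : H - h = (H - (h + 1)) + 1 := by omega
    have e2 : H - (H - (h + 1)) - 1 = h := by omega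
    rw [e]
    change f (H - (H - (h + 1)) - 1) (g (H - (h + 1))) = _
    rw [e2]
  have hmem : ∀ n ≤ H, g n ∈ E.jointClass k H (H - n) := by
    intro n
    induction n with
    | zero => intro _; rw [jointClass, if_neg (by omega)]; rfl
    | succ n ih =>
      intro hn
      have h1 := ih (by omega)
      have e : H - n = H - (n + 1) + 1 := by omega
      rw [e] at h1
      exact hf (H - (n + 1)) (by omega) _ h1
  have hmem' : ∀ h ≤ H, g (H - h) ∈ E.jointClass k H h := fun h hh => by
    have := hmem (H - h) (by omega)
    rwa [show H - (H - h) = h by omega] at this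
  have hD : ∀ h < H, 0 ≤ D := fun h hh =>
    (norm_nonneg _).trans (hE.norm_param h hh _ (hmem' h hh.le) ⟨0, hM⟩)
  choose! θh hθh hmin using fun h (hh : h < H) =>
    E.exists_leastSquares (M := M) hkd (hD h hh) x t h (g (H - (h + 1)))
  refine ⟨fun h i => g (H - h) i - θh h i, θh, fun h => g (H - h), ⟨?_, hθh, hmin, ?_, ?_, ?_⟩, ?_⟩
  · simp only [Nat.sub_self]; rfl
  · intro h _ i
    simp
  · intro h hh
    have h1 := hconf h hh _ (hmem' (h + 1) hh) (θh h) (hθh h hh) (hmin h hh)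
    refine le_trans (le_of_eq (Finset.sum_congr rfl fun i _ => ?_)) h1
    rw [← hstep h hh, ← mahalanobisSq_neg, neg_sub]
  · exact fun h hh => hmem' h hh.le
  · intro h hh i s a
    have := hBell h hh _ (hmem' (h + 1) hh) i s a
    rwa [← hstep h hh] at this

/-- Joint measurability of the overestimation of the value of a random policy by random
parameters, set to `0` if these are large. -/
lemma measurable_overestimate [Nonempty A] (E : MultiTask S A M d) {k H : ℕ} {D : ℝ}
    (hE : E.Regular k H D) {X : Type*} {mX : MeasurableSpace X} {h : ℕ} (hh : h < H) (i : Fin M)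
    {θ : X → EuclideanSpace ℝ (Fin d)} (hθ : Measurable θ) {π : X → Policy S A}
    (hπ : ∀ h, Measurable fun z : X × S => (π z.1).act h z.2) :
    Measurable ({z : X × S | ‖θ z.1‖ ≤ 1}.indicator fun z =>
      E.vLin h (θ z.1) z.2 - (E.mdp i).vPol H (π z.1) h z.2) := by
  have hV : Measurable fun z : X × S => E.vLin h (θ z.1) z.2 := by
    have h1 : Measurable fun z : EuclideanSpace ℝ (Fin d) × S => E.vLin h z.1 z.2 :=
      E.measurable_vLin_uncurry (hE.norm_feature h hh)
    have h2 : Measurable fun z : X × S => (θ z.1, z.2) :=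
      (hθ.comp measurable_fst).prodMk measurable_snd
    have h3 := h1.comp h2
    simpa only [Function.comp_def] using h3
  have hv : Measurable fun z : X × S => (E.mdp i).vPol H (π z.1) h z.2 :=
    (E.mdp i).measurable_vPol π hπ (hE.value_mem i) h hh
  have hs : MeasurableSet {z : X × S | ‖θ z.1‖ ≤ 1} :=
    measurableSet_le (hθ.comp measurable_fst).norm measurable_const
  exact (hV.sub hv).indicator hs

lemma vStar_le [Nonempty A] (E : MultiTask S A M d) {k H : ℕ} {D κ : ℝ} (hE : E.Regular k H D)
    (hH : 0 < H) [Nonempty (Policy S A)] (i : Fin M) (hκ : 0 ≤ κ) (θ : ℕ → Params M d)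
    (h0 : θ H = 0) (hθ : ∀ h < H, ∀ i s a,
      |E.qLin h (θ h i) s a - (E.mdp i).bellman h (E.qLin (h + 1) (θ (h + 1) i)) s a| ≤ κ) (s : S) :
    (E.mdp i).vStar H 0 s ≤ E.vLin 0 (θ 0 i) s + H * κ := by
  refine ciSup_le fun π => ?_
  have h1 := E.qPol_le_qLin_add i hE.norm_feature (hE.value_mem i) hκ (fun h => θ h i)
    (by rw [h0]; rfl) (fun h hh s a => hθ h hh i s a) π H 0 hH rfl s (π.act 0 s)
  have h2 := E.qLin_le_vLin (hE.norm_feature 0 hH) (θ 0 i) s (π.act 0 s)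
  simp only [EpisodicMDP.vPol]
  linarith

end MultiTask

namespace MultiTask.Run

variable {S A : Type*} [MeasurableSpace S] [MeasurableSpace A] {M d k H T : ℕ} {D α : ℝ}
  {E : MultiTask S A M d} {Ω : Type*} [MeasurableSpace Ω] {P : Measure Ω}

open scoped Classical in
/-- The overestimation of the value of the executed policy by the optimistic parameters. It is set
to `0` at the end of the episode, and where the parameters are not in the unit ball, which does not
happen if the program is feasible; so it is bounded everywhere. -/
noncomputable def gap (r : E.Run k H T D α P) (t h : ℕ) (i : Fin M) (ω : Ω) (s : S) : ℝ :=
  if h < H ∧ ‖r.θb t ω h i‖ ≤ 1 then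
    E.vLin h (r.θb t ω h i) s - (E.mdp i).vPol H (r.pol t i ω) h s else 0

lemma abs_gap_le [Nonempty A] (r : E.Run k H T D α P) (hE : E.Regular k H D) (t h : ℕ) (i : Fin M)
    (ω : Ω) (s : S) : |r.gap t h i ω s| ≤ 2 := by
  unfold gap
  split_ifs with hc
  · have h1 := abs_le.1 ((E.abs_vLin_le (hE.norm_feature h hc.1) (r.θb t ω h i) s).trans hc.2)
    have h2 := hE.value_mem i h hc.1 (r.pol t i ω) s ((r.pol t i ω).act h s)
    simp only [EpisodicMDP.vPol]
    rw [abs_le]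
    constructor <;> linarith [h1.1, h1.2, h2.1, h2.2]
  · simp

lemma measurable_gap [Nonempty A] (r : E.Run k H T D α P) (hE : E.Regular k H D) {t : ℕ}
    (ht : t < T) (h : ℕ) (i : Fin M) :
    Measurable[(r.𝓕 t 0).prod inferInstance] (Function.uncurry (r.gap t h i)) := by
  by_cases hh : h < H
  · have := E.measurable_overestimate hE hh i (r.measurable_param t ht h hh.le i)
      (fun h => r.measurable_pol t ht h i)
    have e : Function.uncurry (r.gap t h i) = {z : Ω × S | ‖r.θb t z.1 h i‖ ≤ 1}.indicator fun z =>
        E.vLin h (r.θb t z.1 h i) z.2 - (E.mdp i).vPol H (r.pol t i z.1) h z.2 := by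
      ext z
      simp only [Function.uncurry, gap, hh, true_and, Set.indicator_apply, Set.mem_ofPred_eq]
    rw [e]
    exact this
  · have : Function.uncurry (r.gap t h i) = fun _ => 0 := by
      ext z
      simp [Function.uncurry, gap, hh]
    rw [this]
    exact measurable_const

lemma measurable_gap_right [Nonempty A] (r : E.Run k H T D α P) (hE : E.Regular k H D) {t : ℕ}
    (ht : t < T) (h : ℕ) (i : Fin M) (ω : Ω) : Measurable (r.gap t h i ω) :=
  measurable_section (r.measurable_gap hE ht h i) ω

/-- The martingale difference of the overestimation. -/
noncomputable def gapNoise (r : E.Run k H T D α P) (t h : ℕ) (i : Fin M) (ω : Ω)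
    (v : ℝ × S) : ℝ :=
  ∫ s', r.gap t (h + 1) i ω s' ∂((E.mdp i).trans h (r.sa t h i ω)) - r.gap t (h + 1) i ω v.2

lemma measurable_gapNoise [Nonempty A] (r : E.Run k H T D α P) (hE : E.Regular k H D) {t h : ℕ}
    (ht : t < T) (hh : h < H) (i : Fin M) :
    Measurable[(r.𝓕 t h).prod inferInstance] (Function.uncurry (r.gapNoise t h i)) := by
  have hle : r.𝓕 t 0 ≤ r.𝓕 t h := r.le_of_le t (Nat.zero_le h)
  have hg : Measurable[(r.𝓕 t h).prod inferInstance] (Function.uncurry (r.gap t (h + 1) i)) :=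
    (r.measurable_gap hE ht (h + 1) i).mono
      (sup_le_sup_right (MeasurableSpace.comap_mono hle) _) le_rfl
  exact measurable_integral_sub ((E.mdp i).trans h) (r.measurable_sa ht hh i) hg

/-- Azuma's inequality for the overestimation at a fixed step of the episodes. -/
lemma measure_gapNoise_gt_le [IsProbabilityMeasure P] [Nonempty A] (r : E.Run k H T D α P)
    (hE : E.Regular k H D) {h : ℕ} (hh : h < H) (c l : ℝ) :
    P {ω | l < ∑ t ∈ Finset.range T, ∑ i,
      (c * r.gapNoise t h i ω (r.obs t h ω i) - (c * 4) ^ 2 / 2)} ≤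
      ENNReal.ofReal (Real.exp (-l)) := by
  refine r.measure_sum_gt_le hh
    (g := fun t i ω v => c * r.gapNoise t h i ω v - (c * 4) ^ 2 / 2) ?_ ?_ le_rfl l
  · intro t ht i
    exact measurable_uncurry_affine (r.measurable_gapNoise hE ht hh i) c _
  · intro t ht i ω
    have hm := r.measurable_gap_right hE ht (h + 1) i ω
    have hint : Integrable (fun v : ℝ × S => r.gap t (h + 1) i ω v.2)
        ((E.mdp i).step h (r.sa t h i ω)) :=
      Integrable.of_bound (hm.comp measurable_snd).aestronglyMeasurable 2
        (.of_forall fun v => r.abs_gap_le hE t (h + 1) i ω v.2)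
    refine lintegral_exp_le_one (b := 4) (f := r.gapNoise t h i ω) ?_ (.of_forall fun v => ?_) ?_ c
    · exact (measurable_const.sub (hm.comp measurable_snd)).aemeasurable
    · have h1 := abs_le.1 (abs_integral_le_of_forall
        (μ := (E.mdp i).trans h (r.sa t h i ω)) fun s => r.abs_gap_le hE t (h + 1) i ω s)
      have h2 := abs_le.1 (r.abs_gap_le hE t (h + 1) i ω v.2)
      rw [gapNoise, abs_le]
      constructor <;> linarith [h1.1, h1.2, h2.1, h2.2]
    · simp only [gapNoise]
      rw [integral_sub (integrable_const _) hint, (E.mdp i).integral_trans h _ hm]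
      simp

lemma measure_gapNoise_sum_gt_le [IsProbabilityMeasure P] [Nonempty A] (r : E.Run k H T D α P)
    (hE : E.Regular k H D) (hM : 1 ≤ M) (hT : 1 ≤ T) (hH : 1 ≤ H) {δ : ℝ} (hδ : 0 < δ) :
    P {ω | ¬ ∀ h < H, ∑ t ∈ Finset.range T, ∑ i, r.gapNoise t h i ω (r.obs t h ω i) ≤
      √(M * T) * (Real.log (2 * H / δ) + 8)} ≤ ENNReal.ofReal (δ / 2) := by
  have hM0 : (1 : ℝ) ≤ M := by exact_mod_cast hM
  have hT0 : (1 : ℝ) ≤ T := by exact_mod_cast hT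
  have hH0 : (1 : ℝ) ≤ H := by exact_mod_cast hH
  have hm : (0 : ℝ) < M * T := by positivity
  set l := Real.log (2 * H / δ) with hl
  -- this scale makes the variance term equal to the constant `8`
  set c := 1 / √((M : ℝ) * T) with hc
  have hc0 : 0 < c := by positivity
  let bad : ℕ → Set Ω := fun h => {ω | l < ∑ t ∈ Finset.range T, ∑ i,
      (c * r.gapNoise t h i ω (r.obs t h ω i) - (c * 4) ^ 2 / 2)}
  calc P _ ≤ P (⋃ h ∈ Finset.range H, bad h) := by
        refine measure_mono fun ω hnot => ?_
        by_contra hcon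
        refine hnot fun h hh => ?_
        simp only [Set.mem_iUnion, not_exists, Finset.mem_range] at hcon
        have h1 := hcon h hh
        simp only [bad, Set.mem_ofPred_eq, not_lt] at h1
        simp only [Finset.sum_sub_distrib, ← Finset.mul_sum, Finset.sum_const, nsmul_eq_mul,
          Finset.card_range, Finset.card_univ, Fintype.card_fin] at h1
        have hcc : (M : ℝ) * (T * ((c * 4) ^ 2 / 2)) = 8 := by
          rw [hc, div_mul_eq_mul_div, div_pow, Real.sq_sqrt hm.le]
          field_simp; norm_num
        rw [hcc, hc, one_div, inv_mul_eq_div, sub_le_iff_le_add, div_le_iff₀ (by positivity)] at h1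
        linarith
    _ ≤ ∑ h ∈ Finset.range H, P (bad h) := measure_biUnion_finset_le _ _
    _ ≤ ∑ h ∈ Finset.range H, ENNReal.ofReal (Real.exp (-l)) :=
        Finset.sum_le_sum fun h hh => r.measure_gapNoise_gt_le hE (Finset.mem_range.1 hh) c l
    _ = ENNReal.ofReal (δ / 2) := by
        simp only [Finset.sum_const, nsmul_eq_mul, Finset.card_range]
        rw [← ENNReal.ofReal_natCast, ← ENNReal.ofReal_mul (by positivity)]
        congr 1
        rw [Real.exp_neg, hl, Real.exp_log (by positivity)]
        field_simp

/-- The one-step recursion of the overestimation along a feasible episode. -/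
lemma gap_eq [Nonempty A] (r : E.Run k H T D α P) (hE : E.Regular k H D) {t h : ℕ}
    (ht : t < T) (hh : h < H) {ω : Ω} (hmem : ∀ h ≤ H, r.θb t ω h ∈ E.jointClass k H h)
    (i : Fin M) :
    r.gap t h i ω ((r.data ω).s t h i) - r.gap t (h + 1) i ω ((r.data ω).s t (h + 1) i) =
      (E.qLin h (r.θb t ω h i) ((r.data ω).s t h i) ((r.data ω).a t h i) -
        (E.mdp i).bellman h (E.qLin (h + 1) (r.θb t ω (h + 1) i))
          ((r.data ω).s t h i) ((r.data ω).a t h i)) +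
      r.gapNoise t h i ω (r.obs t h ω i) := by
  have hn : ∀ h ≤ H, ‖r.θb t ω h i‖ ≤ 1 := fun h hh => E.norm_le_one_of_mem (hmem h hh) i
  set s := (r.data ω).s t h i with hs
  set a := (r.data ω).a t h i with ha
  have hact : (r.pol t i ω).act h s = a := (r.executes t ht i ω h hh).symm
  have hV : E.vLin h (r.θb t ω h i) s = E.qLin h (r.θb t ω h i) s a := by
    refine le_antisymm (ciSup_le fun b => ?_) (E.qLin_le_vLin (hE.norm_feature h hh) _ _ _)
    rw [← hact]
    exact r.greedy t ht i ω h hh s b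
  have hgap : r.gap t h i ω s =
      E.qLin h (r.θb t ω h i) s a - (E.mdp i).qPol H (r.pol t i ω) h s a := by
    rw [gap, if_pos ⟨hh, hn h hh.le⟩, hV, EpisodicMDP.vPol, hact]
  have hnoise : r.gapNoise t h i ω (r.obs t h ω i) =
      ∫ s', r.gap t (h + 1) i ω s' ∂((E.mdp i).trans h (s, a)) -
        r.gap t (h + 1) i ω ((r.data ω).s t (h + 1) i) := rfl
  have hint : ∫ s', r.gap t (h + 1) i ω s' ∂((E.mdp i).trans h (s, a)) =
      (E.mdp i).bellman h (E.qLin (h + 1) (r.θb t ω (h + 1) i)) s a -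
        (E.mdp i).qPol H (r.pol t i ω) h s a := by
    rw [bellman_eq]
    by_cases hH : h + 1 < H
    · rw [(E.mdp i).qPol_eq hH _ (hE.value_mem i), add_sub_add_left_eq_sub, ← integral_sub]
      · refine integral_congr_ae (.of_forall fun s' => ?_)
        simp only [gap]
        rw [if_pos ⟨hH, hn _ hH.le⟩]
      · exact E.integrable_vLin (hE.norm_feature _ hH) _ _
      · refine Integrable.of_bound ((E.mdp i).measurable_vPol_right _ (hE.value_mem i) _
          hH).aestronglyMeasurable 1 (.of_forall fun x => ?_)
        have := hE.value_mem i _ hH (r.pol t i ω) x ((r.pol t i ω).act (h + 1) x)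
        rw [Real.norm_eq_abs, abs_le]
        exact ⟨by simp only [EpisodicMDP.vPol]; linarith [this.1], this.2⟩
    · have e : h + 1 = H := by omega
      have h0 := hmem (h + 1) hh
      rw [jointClass, if_neg hH] at h0
      have h0' : r.θb t ω (h + 1) i = 0 := by rw [show r.θb t ω (h + 1) = 0 from h0]; rfl
      rw [(E.mdp i).qPol_last e, h0']
      simp [gap, hH, vLin_zero]
  rw [hgap, hnoise, hint]
  ring

/-- The regret on the event on which the regressions are accurate and the martingales small. -/
lemma regret_le [Nonempty A] (r : E.Run k H T D α P) (hE : E.Regular k H D)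
    (hH : 1 ≤ H) (hM : 1 ≤ M) (hkd : k ≤ d) {κ β : ℝ} (hκ : 0 ≤ κ) {ω : Ω}
    (hacc : ∀ h < H, ∀ t < T, E.Accurate k H D α κ (r.data ω) t h)
    (hmart : ∀ h < H, ∑ t ∈ Finset.range T, ∑ i, r.gapNoise t h i ω (r.obs t h ω i) ≤ β) :
    r.regret ω ≤ H * (2 * (M * T * κ) + √(4 * α * T * (M * (2 * (d * Real.log (d + T))))) + β) := by
  -- optimism and the confidence bounds, episode by episode
  have hsolve : ∀ t < T, (∀ h ≤ H, r.θb t ω h ∈ E.jointClass k H h) ∧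
      ∑ i, (E.mdp i).vStar H 0 ((r.data ω).s t 0 i) ≤
        ∑ i, E.vLin 0 (r.θb t ω 0 i) ((r.data ω).s t 0 i) + M * (H * κ) ∧
      ∀ h < H, ∃ Δ : Params M d,
        ∑ i, mahalanobisSq (E.design (r.data ω) t h i) (Δ i) ≤ 4 * α ∧
        ∀ i, E.qLin h (r.θb t ω h i) ((r.data ω).s t h i) ((r.data ω).a t h i) -
          (E.mdp i).bellman h (E.qLin (h + 1) (r.θb t ω (h + 1) i))
            ((r.data ω).s t h i) ((r.data ω).a t h i) ≤
          E.qLin h (Δ i) ((r.data ω).s t h i) ((r.data ω).a t h i) + κ := by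
    intro t ht
    obtain ⟨ξ', θh', θ', hfeas', hBell'⟩ := E.exists_feasible hE hkd hM
      fun h hh => hacc h hh t ht
    obtain ⟨⟨ξ, θh, hfeas⟩, hopt⟩ := r.solves t ht ω ⟨ξ', θh', θ', hfeas'⟩
    have hmem : ∀ h ≤ H, r.θb t ω h ∈ E.jointClass k H h := by
      intro h hh
      rcases hh.lt_or_eq with hlt | rfl
      · exact hfeas.mem_class h hlt
      · rw [jointClass, if_neg (lt_irrefl _), hfeas.terminal]; rfl
    refine ⟨hmem, ?_, fun h hh => ?_⟩
    · have : Nonempty (Policy S A) := ⟨r.pol t ⟨0, hM⟩ ω⟩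
      have h1 := hopt ξ' θh' θ' hfeas'
      unfold objective at h1
      have h2 := Finset.sum_le_sum fun i (_ : i ∈ Finset.univ) =>
        E.vStar_le hE hH i hκ θ' hfeas'.terminal hBell' ((r.data ω).s t 0 i)
      rw [Finset.sum_add_distrib, Finset.sum_const, Finset.card_univ, Fintype.card_fin,
        nsmul_eq_mul] at h2
      linarith
    · obtain ⟨θ₀, hθ₀, hB, hconf⟩ := hacc h hh t ht _ (hmem (h + 1) hh)
      have hc := hconf (θh h) (hfeas.mem_lowRank h hh) (hfeas.least_squares h hh)
      refine ⟨fun i => ξ h i + (θh h i - θ₀ i), ?_, fun i => ?_⟩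
      · refine (Finset.sum_le_sum fun i _ => E.mahalanobisSq_add_le _ _ _ _ _ _).trans ?_
        rw [Finset.sum_add_distrib, ← Finset.mul_sum, ← Finset.mul_sum]
        linarith [hfeas.confidence h hh]
      · have e : ξ h i + (θh h i - θ₀ i) = r.θb t ω h i - θ₀ i := by
          rw [hfeas.bonus h hh i]; abel
        have := (abs_le.1 (hB i ((r.data ω).s t h i) ((r.data ω).a t h i))).2
        simp only [e, qLin_sub]
        linarith
  choose! hmem hopt Δ hΔ hΔ' using hsolve
  have htel : ∀ t ∈ Finset.range T, ∀ i, E.vLin 0 (r.θb t ω 0 i) ((r.data ω).s t 0 i) -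
      (E.mdp i).vPol H (r.pol t i ω) 0 ((r.data ω).s t 0 i) =
      ∑ h ∈ Finset.range H,
        ((E.qLin h (r.θb t ω h i) ((r.data ω).s t h i) ((r.data ω).a t h i) -
        (E.mdp i).bellman h (E.qLin (h + 1) (r.θb t ω (h + 1) i))
          ((r.data ω).s t h i) ((r.data ω).a t h i)) +
        r.gapNoise t h i ω (r.obs t h ω i)) := by
    intro t ht i
    rw [Finset.mem_range] at ht
    have h1 : E.vLin 0 (r.θb t ω 0 i) ((r.data ω).s t 0 i) -
        (E.mdp i).vPol H (r.pol t i ω) 0 ((r.data ω).s t 0 i) =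
        r.gap t 0 i ω ((r.data ω).s t 0 i) - r.gap t H i ω ((r.data ω).s t H i) := by
      have h2 : r.gap t H i ω ((r.data ω).s t H i) = 0 := by simp [gap]
      rw [h2, gap, if_pos ⟨hH, E.norm_le_one_of_mem (hmem t ht 0 (Nat.zero_le _)) i⟩, sub_zero]
    rw [h1, ← Finset.sum_range_sub' (fun h => r.gap t h i ω ((r.data ω).s t h i))]
    exact Finset.sum_congr rfl fun h hh =>
      r.gap_eq hE ht (Finset.mem_range.1 hh) (hmem t ht) i
  have hstep : ∀ h ∈ Finset.range H, ∑ t ∈ Finset.range T, ∑ i,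
        ((E.qLin h (r.θb t ω h i) ((r.data ω).s t h i) ((r.data ω).a t h i) -
        (E.mdp i).bellman h (E.qLin (h + 1) (r.θb t ω (h + 1) i))
          ((r.data ω).s t h i) ((r.data ω).a t h i)) +
        r.gapNoise t h i ω (r.obs t h ω i)) ≤
      M * T * κ + √(4 * α * T * (M * (2 * (d * Real.log (d + T))))) + β := by
    intro h hh
    rw [Finset.mem_range] at hh
    have h1 := E.sum_qLin_le (r.data ω) (hE.norm_feature h hh) T (fun t => Δ t h)
      fun t ht => hΔ t ht h hh
    have h2 : ∑ t ∈ Finset.range T, ∑ i,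
        (E.qLin h (r.θb t ω h i) ((r.data ω).s t h i) ((r.data ω).a t h i) -
        (E.mdp i).bellman h (E.qLin (h + 1) (r.θb t ω (h + 1) i))
          ((r.data ω).s t h i) ((r.data ω).a t h i)) ≤
        ∑ t ∈ Finset.range T, ∑ i,
          (E.qLin h (Δ t h i) ((r.data ω).s t h i) ((r.data ω).a t h i) + κ) :=
      Finset.sum_le_sum fun t ht => Finset.sum_le_sum fun i _ =>
        hΔ' t (Finset.mem_range.1 ht) h hh i
    simp only [Finset.sum_add_distrib, Finset.sum_const, Finset.card_range, Finset.card_univ,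
      Fintype.card_fin, nsmul_eq_mul] at h2 ⊢
    linarith [hmart h hh]
  have hreg : r.regret ω ≤ ∑ t ∈ Finset.range T, (∑ i, (E.vLin 0 (r.θb t ω 0 i)
      ((r.data ω).s t 0 i) - (E.mdp i).vPol H (r.pol t i ω) 0 ((r.data ω).s t 0 i)) +
        M * (H * κ)) := by
    refine Finset.sum_le_sum fun t ht => ?_
    have := hopt t (Finset.mem_range.1 ht)
    rw [Finset.sum_sub_distrib, Finset.sum_sub_distrib]
    linarith
  refine hreg.trans ?_
  rw [Finset.sum_add_distrib]
  have h3 : ∑ t ∈ Finset.range T, ∑ i, (E.vLin 0 (r.θb t ω 0 i) ((r.data ω).s t 0 i) -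
      (E.mdp i).vPol H (r.pol t i ω) 0 ((r.data ω).s t 0 i)) ≤
      H * (M * T * κ + √(4 * α * T * (M * (2 * (d * Real.log (d + T))))) + β) := by
    rw [Finset.sum_congr rfl fun t ht => Finset.sum_congr rfl fun i _ => htel t ht i]
    have : ∀ t ∈ Finset.range T, ∀ F : Fin M → ℕ → ℝ, ∑ i, ∑ h ∈ Finset.range H, F i h =
      ∑ h ∈ Finset.range H, ∑ i, F i h := fun _ _ _ => Finset.sum_comm
    rw [Finset.sum_congr rfl fun t ht => this t ht _, Finset.sum_comm]
    refine (Finset.sum_le_sum hstep).trans (le_of_eq ?_)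
    rw [Finset.sum_const, Finset.card_range, nsmul_eq_mul]
  have h4 : ∑ _t ∈ Finset.range T, (M : ℝ) * (H * κ) = H * (M * T * κ) := by
    rw [Finset.sum_const, Finset.card_range, nsmul_eq_mul]; ring
  rw [h4]
  linarith

/-- All values lie in `[0, 1]`, so the regret is at most `M T`. -/
lemma regret_le_card [Nonempty A] (r : E.Run k H T D α P) (hE : E.Regular k H D)
    (hH : 1 ≤ H) (ω : Ω) : r.regret ω ≤ M * T := by
  have h1 : r.regret ω ≤ ∑ t ∈ Finset.range T, ∑ _i : Fin M, (1 : ℝ) := by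
    refine Finset.sum_le_sum fun t _ => Finset.sum_le_sum fun i _ => ?_
    have : Nonempty (Policy S A) := ⟨r.pol t i ω⟩
    have h2 : (E.mdp i).vStar H 0 ((r.data ω).s t 0 i) ≤ 1 :=
      ciSup_le fun π => (hE.value_mem i 0 hH π _ _).2
    have h3 : 0 ≤ (E.mdp i).vPol H (r.pol t i ω) 0 ((r.data ω).s t 0 i) :=
      (hE.value_mem i 0 hH (r.pol t i ω) _ _).1
    linarith
  refine h1.trans (le_of_eq ?_)
  simp [mul_comm]

end MultiTask.Run

/-! ### Size of the regret bound -/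

/-- All logarithms of the analysis are at most `log (d M H T / δ)`. -/
lemma log_le_log_prod {M d k H T : ℕ} {δ : ℝ} (hM : 5 ≤ M) (hT : 5 ≤ T) (hH : 1 ≤ H) (hk : 1 ≤ k)
    (hkd : k ≤ d) (hδ : 0 < δ) (hδ1 : δ < 1) :
    1 ≤ Real.log (d * M * H * T / δ) ∧
    Real.log (k * M * T) ≤ Real.log (d * M * H * T / δ) ∧
    Real.log (M * T) ≤ Real.log (d * M * H * T / δ) ∧
    Real.log (2 / δ) ≤ Real.log (d * M * H * T / δ) ∧
    Real.log (2 * H / δ) ≤ Real.log (d * M * H * T / δ) ∧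
    Real.log (d + T) ≤ Real.log (d * M * H * T / δ) := by
  have hM' : (5 : ℝ) ≤ M := by exact_mod_cast hM
  have hT' : (5 : ℝ) ≤ T := by exact_mod_cast hT
  have hH' : (1 : ℝ) ≤ H := by exact_mod_cast hH
  have hk' : (1 : ℝ) ≤ k := by exact_mod_cast hk
  have hkd' : (k : ℝ) ≤ d := by exact_mod_cast hkd
  have hd' : (1 : ℝ) ≤ d := hk'.trans hkd'
  have hδ' : 1 ≤ 1 / δ := by rw [le_div_iff₀ hδ]; linarith
  have hMT : (25 : ℝ) ≤ M * T := by nlinarith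
  have hdMT : (d : ℝ) * (M * T) ≤ d * M * H * T := by
    have : (d : ℝ) * (M * T) * 1 ≤ d * (M * T) * H := by gcongr
    linarith
  have hdiv : (d : ℝ) * M * H * T ≤ d * M * H * T / δ := by
    rw [le_div_iff₀ hδ]
    exact mul_le_of_le_one_right (by positivity) hδ1.le
  have hMTd : (M : ℝ) * T ≤ d * (M * T) := le_mul_of_one_le_left (by positivity) hd'
  have hHM : (2 : ℝ) * H ≤ d * M * H * T := by
    have : (1 : ℝ) * 2 * H ≤ d * (M * T) * H := by gcongr; linarith
    linarith
  refine ⟨?_, ?_, ?_, ?_, ?_, ?_⟩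
  · rw [Real.le_log_iff_exp_le (by positivity)]
    linarith [Real.exp_one_lt_three]
  · refine Real.log_le_log (by positivity) ?_
    have : (k : ℝ) * (M * T) ≤ d * (M * T) := by gcongr
    linarith
  · exact Real.log_le_log (by positivity) (by linarith)
  · exact Real.log_le_log (by positivity) (by gcongr; linarith)
  · exact Real.log_le_log (by positivity) (by gcongr)
  · refine Real.log_le_log (by positivity) ?_
    have h1 : (d : ℝ) + T ≤ d * T + 1 := by nlinarith
    have h2 : (d : ℝ) * T * 5 ≤ d * T * M := by gcongr
    have h3 : (1 : ℝ) * 1 ≤ d * T := by gcongr; linarith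
    linarith

/-- The confidence radius is of order `√(M T) I + √(k (d + M))`, up to a logarithm. -/
lemma sqrt_radius_le {M d k H T : ℕ} {D I δ : ℝ} (hM : 5 ≤ M) (hT : 5 ≤ T) (hH : 1 ≤ H)
    (hk : 1 ≤ k) (hkd : k ≤ d) (hδ : 0 < δ) (hδ1 : δ < 1) (hI : 0 ≤ I) :
    √(radius M d k T D I δ) ≤ 2 * √(M * T) * I +
      (12 + 2 * |D|) * √(k * (d + M) * Real.log (d * M * H * T / δ)) := by
  obtain ⟨hL, h1, h2, h3, -, -⟩ := log_le_log_prod hM hT hH hk hkd hδ hδ1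
  set L := Real.log (d * M * H * T / δ)
  have hM' : (5 : ℝ) ≤ M := by exact_mod_cast hM
  have hk' : (1 : ℝ) ≤ k := by exact_mod_cast hk
  have hd' : (1 : ℝ) ≤ d := hk'.trans (by exact_mod_cast hkd)
  have hkd1 : (1 : ℝ) ≤ k * d := one_le_mul_of_one_le_of_one_le hk' hd'
  set N := (k : ℝ) * (d + M) * L with hN
  have hkL : (k : ℝ) ≤ k * d * L := by
    have : (k : ℝ) * 1 * 1 ≤ k * d * L := by gcongr
    linarith
  have hLk : L ≤ k * d * L := le_mul_of_one_le_left (by linarith) hkd1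
  have hMN : (M : ℝ) ≤ N := by
    have : (1 : ℝ) * M * 1 ≤ k * (d + M) * L := by gcongr; linarith
    linarith
  have hN1 : 1 ≤ N := by linarith
  have hkMT : (k : ℝ) * d * Real.log (k * M * T) ≤ k * d * L := by gcongr
  have hMT : (M : ℝ) * k * Real.log (M * T) ≤ M * k * L := by gcongr
  have hMkL : 0 ≤ M * k * L := by positivity
  have hkdL : 0 ≤ k * d * L := by positivity
  have hNe : N = k * d * L + M * k * L := by rw [hN]; ring
  have sqrt_le {x c : ℝ} (hc : 0 ≤ c) (h : x ≤ c ^ 2 * N) : √x ≤ c * √N := by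
    rw [← Real.sqrt_sq hc, ← Real.sqrt_mul (sq_nonneg c)]
    exact Real.sqrt_le_sqrt h
  have hF1 : widthOne M d k T δ ≤ 4 * √N := sqrt_le (by norm_num) (by linarith)
  have hF2 : widthTwo M d k T δ ≤ 6 * N := by
    have e1 := sqrt_le (x := 4 * k * d * Real.log (k * M * T) + 5 * M * k * Real.log (M * T) +
      2 * Real.log (2 / δ)) (c := 3) (by norm_num) (by linarith)
    have e2 := sqrt_le (x := k + 5 * k * d * Real.log (k * M * T) + 2 * M * k * Real.log (M * T) +
      Real.log (2 / δ)) (c := 3) (by norm_num) (by linarith)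
    have e3 : √N ≤ N := (Real.sqrt_le_left (by linarith)).2 (by nlinarith)
    rw [widthTwo]
    linarith
  have hF3 : √(2 * widthTwo M d k T δ + 4 * M * D ^ 2) ≤ (4 + 2 * |D|) * √N := by
    refine sqrt_le (by positivity) ?_
    have : (M : ℝ) * D ^ 2 ≤ N * D ^ 2 := by gcongr
    have h0 : 0 ≤ |D| * N := by positivity
    have : (4 + 2 * |D|) ^ 2 = 16 + 16 * |D| + 4 * D ^ 2 := by rw [← sq_abs D]; ring
    rw [this]
    linarith
  have h0 : 0 ≤ widthOne M d k T δ := Real.sqrt_nonneg _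
  rw [radius, Real.sqrt_sq (by positivity)]
  linarith

set_option maxHeartbeats 400000 in
/-- The bound on the regret, expressed through its three summands. -/
lemma regret_bound_le {M d k H T : ℕ} {D I δ : ℝ} (hM : 5 ≤ M) (hT : 5 ≤ T) (hH : 1 ≤ H)
    (hk : 1 ≤ k) (hkd : k ≤ d) (hδ : 0 < δ) (hδ1 : δ < 1) (hI : 0 ≤ I) :
    H * (2 * (M * T * (I + 2 * (1 / (4 * √(M * T))))) +
      √(4 * radius M d k T D I δ * T * (M * (2 * (d * Real.log (d + T))))) +
      √(M * T) * (Real.log (2 * H / δ) + 8)) ≤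
    (46 + 6 * |D|) * Real.log (d * M * H * T / δ) *
      (H * M * √(d * k * T) + H * d * √(k * M * T) + H * M * T * √d * I) := by
  have hR := sqrt_radius_le (D := D) hM hT hH hk hkd hδ hδ1 hI
  obtain ⟨hL, -, -, -, h4, h5⟩ := log_le_log_prod hM hT hH hk hkd hδ hδ1
  set L := Real.log (d * M * H * T / δ)
  set α := radius M d k T D I δ
  have hM' : (5 : ℝ) ≤ M := by exact_mod_cast hM
  have hT' : (5 : ℝ) ≤ T := by exact_mod_cast hT
  have hk' : (1 : ℝ) ≤ k := by exact_mod_cast hk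
  have hd' : (1 : ℝ) ≤ d := hk'.trans (by exact_mod_cast hkd)
  have hα : 0 ≤ α := sq_nonneg _
  have hm : (0 : ℝ) < M * T := by positivity
  have hs : (M : ℝ) * T * (1 / √(M * T)) = √(M * T) := by
    rw [mul_one_div, Real.div_sqrt]
  set G1 := (M : ℝ) * √(d * k * T) with hG1
  set G2 := (d : ℝ) * √(k * M * T) with hG2
  set G3 := (M : ℝ) * T * √d * I with hG3
  have hG10 : 0 ≤ G1 := by positivity
  have hG20 : 0 ≤ G2 := by positivity
  have hG30 : 0 ≤ G3 := by positivity
  have hMTI : (M : ℝ) * T * I ≤ G3 := by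
    have : (1 : ℝ) ≤ √d := Real.one_le_sqrt.2 hd'
    have : (M : ℝ) * T * 1 * I ≤ M * T * √d * I := by gcongr
    linarith
  have hsG1 : √((M : ℝ) * T) ≤ G1 := by
    rw [hG1, ← Real.sqrt_sq (by positivity : (0 : ℝ) ≤ M), ← Real.sqrt_mul (by positivity),
      Real.sqrt_sq (by positivity)]
    refine Real.sqrt_le_sqrt ?_
    have : (M : ℝ) * 1 * (1 * 1 * T) ≤ M * M * (d * k * T) := by gcongr; linarith
    nlinarith
  have hLsq : √L ≤ L := (Real.sqrt_le_left (by linarith)).2 (by nlinarith)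
  have hpot : √(4 * α * T * (M * (2 * (d * Real.log (d + T))))) ≤
      √α * (3 * √(T * M * d * L)) := by
    have e : √α * (3 * √(T * M * d * L)) = √(α * (9 * (T * M * d * L))) := by
      rw [Real.sqrt_mul hα, Real.sqrt_mul (by norm_num : (0 : ℝ) ≤ 9),
        show (9 : ℝ) = 3 ^ 2 by norm_num, Real.sqrt_sq (by norm_num : (0 : ℝ) ≤ 3)]
    rw [e]
    refine Real.sqrt_le_sqrt ?_
    have e1 : (α * (T * M * d)) * Real.log (d + T) ≤ (α * (T * M * d)) * L := by gcongr
    have e2 : 0 ≤ (α * (T * M * d)) * L := by positivity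
    linarith
  have hc1 : √((M : ℝ) * T) * I * √(T * M * d * L) ≤ L * G3 := by
    have e : √((M : ℝ) * T) * I * √(T * M * d * L) = √L * G3 := by
      rw [show (T : ℝ) * M * d * L = (M * T) * (d * L) by ring, Real.sqrt_mul hm.le,
        Real.sqrt_mul (by positivity : (0 : ℝ) ≤ d), hG3]
      have := Real.mul_self_sqrt hm.le
      linear_combination (I * √d * √L) * this
    rw [e]
    gcongr
  have hc2 : √(k * (d + M) * L) * √(T * M * d * L) ≤ L * (G2 + G1) := by
    have e : √(k * (d + M) * L) * √(T * M * d * L) =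
        L * √(d ^ 2 * (k * M * T) + M ^ 2 * (d * k * T)) := by
      rw [← Real.sqrt_mul (by positivity), show k * (d + M) * L * (T * M * d * L) =
        L ^ 2 * (d ^ 2 * (k * M * T) + M ^ 2 * (d * k * T)) by ring,
        Real.sqrt_mul (sq_nonneg L), Real.sqrt_sq (by linarith)]
    rw [e]
    have e2 : √((d : ℝ) ^ 2 * (k * M * T) + M ^ 2 * (d * k * T)) ≤ G2 + G1 := by
      have q1 : G1 ^ 2 = M ^ 2 * (d * k * T) := by
        rw [hG1, mul_pow, Real.sq_sqrt (by positivity)]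
      have q2 : G2 ^ 2 = d ^ 2 * (k * M * T) := by
        rw [hG2, mul_pow, Real.sq_sqrt (by positivity)]
      rw [← q1, ← q2]
      exact (Real.sqrt_le_left (by positivity)).2 (by nlinarith)
    gcongr
  have hmain : √α * (3 * √(T * M * d * L)) ≤
      6 * (L * G3) + (36 + 6 * |D|) * (L * (G2 + G1)) := by
    calc √α * (3 * √(T * M * d * L))
        ≤ (2 * √(M * T) * I + (12 + 2 * |D|) * √(k * (d + M) * L)) * (3 * √(T * M * d * L)) := by
          gcongr
      _ = 6 * (√((M : ℝ) * T) * I * √(T * M * d * L)) +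
          (36 + 6 * |D|) * (√(k * (d + M) * L) * √(T * M * d * L)) := by ring
      _ ≤ _ := by gcongr
  have hmart : √((M : ℝ) * T) * (Real.log (2 * H / δ) + 8 + 1) ≤ 10 * (L * G1) := by
    calc √((M : ℝ) * T) * (Real.log (2 * H / δ) + 8 + 1) ≤ G1 * (10 * L) := by
          exact mul_le_mul hsG1 (by linarith)
            (by have := Real.log_nonneg (x := 2 * H / δ) (by
                  rw [le_div_iff₀ hδ]
                  have : (1 : ℝ) ≤ H := by exact_mod_cast hH
                  linarith)
                linarith) hG10
      _ = _ := by ring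
  have hbias : (M : ℝ) * T * I ≤ L * G3 := hMTI.trans (le_mul_of_one_le_left hG30 hL)
  have hfin : 2 * (M * T * (I + 2 * (1 / (4 * √(M * T))))) +
      √(4 * α * T * (M * (2 * (d * Real.log (d + T))))) +
      √(M * T) * (Real.log (2 * H / δ) + 8) ≤ (46 + 6 * |D|) * L * (G1 + G2 + G3) := by
    have e : 2 * (M * T * (I + 2 * (1 / (4 * √(M * T))))) = 2 * (M * T * I) + √((M : ℝ) * T) := by
      have : 1 / (4 * √((M : ℝ) * T)) = 1 / 4 * (1 / √(M * T)) := by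
        rw [one_div_mul_one_div]
      rw [this]
      linear_combination hs
    rw [e]
    have p1 : 0 ≤ L * G2 := by positivity
    have p2 : 0 ≤ L * G3 := by positivity
    have p3 : 0 ≤ |D| * (L * G3) := by positivity
    clear_value G1 G2 G3 L α
    linarith
  calc _ ≤ (H : ℝ) * ((46 + 6 * |D|) * L * (G1 + G2 + G3)) := by gcongr
    _ = _ := by rw [hG1, hG2, hG3]; ring

/-- If there are few episodes, then the claimed bound exceeds the trivial bound `M T`. -/
lemma card_le_of_lt {M d k H T : ℕ} {c : ℝ} (hH : 1 ≤ H) (hk : 1 ≤ k) (hkd : k ≤ d) (hc : 1 ≤ c)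
    (h : T < H ^ 2 * (d * k) ∨ (T : ℝ) < c ^ 2) :
    (M : ℝ) * T ≤ c * (H * M * √(d * k * T)) := by
  have hH' : (1 : ℝ) ≤ H := by exact_mod_cast hH
  have hk' : (1 : ℝ) ≤ k := by exact_mod_cast hk
  have hd' : (1 : ℝ) ≤ d := hk'.trans (by exact_mod_cast hkd)
  have hdk : (1 : ℝ) ≤ d * k := one_le_mul_of_one_le_of_one_le hd' hk'
  have key : √(T : ℝ) ≤ c * (H * √(d * k)) := by
    rcases h with h | h
    · have h' : (T : ℝ) ≤ H ^ 2 * (d * k) := by exact_mod_cast h.le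
      have := Real.sqrt_le_sqrt h'
      rw [Real.sqrt_mul (sq_nonneg _), Real.sqrt_sq (by positivity)] at this
      exact this.trans (le_mul_of_one_le_left (by positivity) hc)
    · have := Real.sqrt_le_sqrt h.le
      rw [Real.sqrt_sq (by linarith)] at this
      have e : (1 : ℝ) * 1 ≤ H * √(d * k) := by
        gcongr
        exact Real.one_le_sqrt.2 hdk
      nlinarith
  calc (M : ℝ) * T = M * √T * √T := by rw [mul_assoc, Real.mul_self_sqrt (by positivity)]
    _ ≤ M * √T * (c * (H * √(d * k))) := by gcongr
    _ = _ := by rw [Real.sqrt_mul (by positivity : (0 : ℝ) ≤ d * k)]; ring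

end MTRL

theorem mainTheorem4 (D : ℝ) :
    ∃ (C : ℝ) (p : ℕ), 0 < C ∧
      ∀ {S A Ω : Type*} [MeasurableSpace S] [MeasurableSpace A] [MeasurableSpace Ω]
        (P : Measure Ω) [IsProbabilityMeasure P]
        (M d k H T : ℕ) (δ : ℝ) (E : MTRL.MultiTask S A M d),
        5 ≤ M → 5 ≤ T → 1 ≤ H → 1 ≤ k → k ≤ d → 0 < δ → δ < 1 →
        E.Regular k H D → E.bellmanError k H ≠ ∞ →
        ∀ r : E.Run k H T D (MTRL.radius M d k T D (E.bellmanError k H).toReal δ) P,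
          P {ω | C * Real.log (d * M * H * T / δ) ^ p *
              (H * M * √(d * k * T) + H * d * √(k * M * T)
                + H * M * T * √d * (E.bellmanError k H).toReal) < r.regret ω} ≤ ENNReal.ofReal δ := by
  set c : ℝ := (28 * (49 * (max D 1) ^ 2)) ^ 2 with hc
  have hc1 : 1 ≤ c := by
    have h1 : (1 : ℝ) ≤ max D 1 := le_max_right _ _
    have h2 : (1 : ℝ) ≤ (max D 1) ^ 2 := one_le_pow₀ h1
    exact one_le_pow₀ (by linarith)
  -- `c` covers the case of few episodes, and `46 + 6 * |D|` the other one
  refine ⟨46 + 6 * |D| + c, 1, by positivity, ?_⟩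
  intro S A Ω _ _ _ P _ M d k H T δ E hM hT hH hk hkd hδ hδ1 hE hI
  rw [pow_one]
  have hL := (MTRL.log_le_log_prod hM hT hH hk hkd hδ hδ1).1
  have hbd := MTRL.regret_bound_le (D := D) hM hT hH hk hkd hδ hδ1
    (ENNReal.toReal_nonneg (a := E.bellmanError k H))
  set L := Real.log (d * M * H * T / δ)
  set I := (E.bellmanError k H).toReal with hIdef
  intro r
  have hI0 : 0 ≤ I := ENNReal.toReal_nonneg
  have : Nonempty Ω := P.nonempty_of_neZero
  have : Nonempty A := ⟨(r.data (Classical.arbitrary Ω)).a 0 0 ⟨0, by omega⟩⟩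
  set G := H * M * √(d * k * T) + H * d * √(k * M * T) + H * M * T * √d * I with hG
  have hG0 : 0 ≤ G := by positivity
  have hLG : 0 ≤ L * G := by positivity
  by_cases hsmall : T < H ^ 2 * (d * k) ∨ (T : ℝ) < c ^ 2
  · have hempty : {ω | (46 + 6 * |D| + c) * L * G < r.regret ω} = ∅ := by
      refine Set.eq_empty_of_forall_notMem fun ω hω => ?_
      have h1 := r.regret_le_card hE hH ω
      have h2 := MTRL.card_le_of_lt (M := M) hH hk hkd hc1 hsmall
      have h3 : c * (H * M * √(d * k * T)) ≤ c * G := by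
        gcongr
        rw [hG]
        have : 0 ≤ H * d * √(k * M * T) + H * M * T * √d * I := by positivity
        linarith
      have h4 : c * G ≤ c * (L * G) := by
        gcongr
        exact le_mul_of_one_le_left hG0 hL
      have h5 : 0 ≤ (46 + 6 * |D|) * (L * G) := by positivity
      simp only [Set.mem_ofPred_eq] at hω
      linarith
    rw [hempty, measure_empty]
    exact zero_le
  · rw [not_or, not_lt, not_lt] at hsmall
    have hTc : (28 * (49 * (max D 1) ^ 2)) ^ 4 ≤ (T : ℝ) := by
      have := hsmall.2
      rwa [hc, ← pow_mul] at this
    have hb1 := r.measure_not_accurate_le hE hI hM hT hH hk hkd hδ hδ1 hsmall.1 hTc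
    have hb2 := r.measure_gapNoise_sum_gt_le hE (by omega) (by omega) hH hδ
    have hδδ : ENNReal.ofReal δ = ENNReal.ofReal (δ / 2) + ENNReal.ofReal (δ / 2) := by
      rw [← ENNReal.ofReal_add (by positivity) (by positivity), add_halves]
    rw [hδδ]
    refine (measure_mono ?_).trans ((measure_union_le _ _).trans (add_le_add hb1 hb2))
    intro ω hω
    by_contra hcon
    simp only [Set.mem_union, Set.mem_ofPred_eq, not_or, not_not] at hcon
    have hreg := r.regret_le hE hH (by omega) hkd (by positivity) hcon.1 hcon.2
    have h6 : 0 ≤ c * (L * G) := by positivity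
    simp only [Set.mem_ofPred_eq] at hω
    linarith
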